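/- Let $A$ be a Lie algebroid over a smooth (Hausdorff, second countable) manifold $M$, i.e. a smooth real vector bundle of constant finite rank with a smooth anchor $\rho:A\to TM$ and a Lie bracket on $\Gamma(A)$ satisfying the Leibniz rule and $\rho([\alpha,\beta])=[\rho(\alpha),\rho(\beta)]$. For a vector bundle $E$ of rank $r$ put $\mathcal V_E=\Lambda^{\mathrm{top}}E^*$, and let $\mathcal D_E=|\Lambda^{\mathrm{top}}E^*|$ be its density bundle: their fibres consist of the functions $\xi$ on frames with $\xi(e\cdot g)=\det(g)\,\xi(e)$, respectively $\xi(e\cdot g)=|\det g|\,\xi(e)$, for $g\in GL_r(\mathbb R)$. Consider the line bundles $$\mathcal D_A^{\mathrm{tr}}=\mathcal D_{A^*}\otimes\mathcal D_{TM},\qquad \mathcal V_A^{\mathrm{tr}}=\mathcal V_{A^*}\otimes\mathcal V_{TM}=\Lambda^{\mathrm{top}}A\otimes\Lambda^{\mathrm{top}}T^*M,\qquad Q_A=\mathcal V_{A^*}\otimes\mathcal D_{TM}=\Lambda^{\mathrm{top}}A\otimes|\Lambda^{\mathrm{top}}T^*M|,$$ each with the operation of $\Gamma(A)$ given by Lie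 derivatives, $\nabla_\alpha(\omega\otimes\mu)=L_\alpha\omega\otimes\mu+\omega\otimes L_{\rho(\alpha)}\mu$. For a representation $(L,\nabla)$ of $A$ on a line bundle (a flat $A$-connection), the characteristic class $\theta_A(L)\in H^1(A)$ is $\tfrac12[c_\sigma]$, where $\sigma$ is any nowhere vanishing section of $L\otimes L$ and $c_\sigma\in\Gamma(A^*)$ is the closed form with $\nabla_\alpha\sigma=c_\sigma(\alpha)\,\sigma$ for the induced representation on $L\otimes L$. The modular class is $\mathrm{mod}(A):=\theta_A(\mathcal D_A^{\mathrm{tr}})$. Then $Q_A$, $\mathcal D_A^{\mathrm{tr}}$ and $\mathcal V_A^{\mathrm{tr}}$ are representations of $A$, their characteristic classes are well defined (such $\sigma$ exist, and $[c_\sigma]$ does not depend on $\sigma$), and $$\theta_A(Q_A)=\theta_A(\mathcal D_A^{\mathrm{tr}})=\theta_A(\mathcal V_A^{\mathrm{tr}})=\mathrm{mod}(A).$$ -/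

import Mathlib

open Bundle Set Filter Topology Module
open scoped Manifold ContDiff TensorProduct

noncomputable section

/-! ### Real line bundles from local frames -/

/-- A cover of the base of a family of real lines by open sets with local frames and coframes,
such that the transition functions are continuous. -/
structure LineFrames (B : Type*) [TopologicalSpace B] (L : B → Type*)
    [∀ x, AddCommGroup (L x)] [∀ x, Module ℝ (L x)] where
  U : B → Set B
  isOpen_U : ∀ b, IsOpen (U b)
  mem_U : ∀ b, b ∈ U b
  coord : B → ∀ x, L x →ₗ[ℝ] ℝ
  frame : B → ∀ x, L x
  coord_frame : ∀ b, ∀ x ∈ U b, coord b x (frame b x) = 1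
  coord_smul_frame : ∀ b, ∀ x ∈ U b, ∀ v : L x, coord b x v • frame b x = v
  continuousOn : ∀ b b', ContinuousOn (fun x => coord b' x (frame b x)) (U b ∩ U b')

namespace LineFrames

variable {B : Type*} [TopologicalSpace B] {L : B → Type*}
  [∀ x, AddCommGroup (L x)] [∀ x, Module ℝ (L x)] (a : LineFrames B L)

open Classical in
/-- The local trivialization `v ↦ (x, coord b x v)` over `U b`. -/
def pretriv (b : B) : Pretrivialization ℝ (π ℝ L) where
  toFun p := (p.1, a.coord b p.1 p.2)
  invFun q := ⟨q.1, q.2 • a.frame b q.1⟩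
  source := π ℝ L ⁻¹' a.U b
  target := a.U b ×ˢ univ
  map_source' p hp := ⟨hp, mem_univ _⟩
  map_target' q hq := hq.1
  left_inv' := by
    rintro ⟨x, v⟩ hp
    simp only [a.coord_smul_frame b x hp v]
  right_inv' := by
    rintro ⟨x, t⟩ hq
    simp only [map_smul, a.coord_frame b x hq.1, smul_eq_mul, mul_one]
  open_target := (a.isOpen_U b).prod isOpen_univ
  baseSet := a.U b
  open_baseSet := a.isOpen_U b
  source_eq := rfl
  target_eq := rfl
  proj_toFun _ _ := rfl

lemma pretriv_symm (b x : B) (hx : x ∈ a.U b) (t : ℝ) :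
    (a.pretriv b).symm x t = t • a.frame b x := by
  have h : x ∈ (a.pretriv b).baseSet := hx
  rw [Pretrivialization.symm_apply _ h]
  rfl

lemma pretriv_change (b b' x : B) (hx : x ∈ a.U b) (t : ℝ) :
    ((a.pretriv b') ⟨x, (a.pretriv b).symm x t⟩).2 = a.coord b' x (a.frame b x) * t := by
  rw [a.pretriv_symm b x hx]
  change a.coord b' x (t • a.frame b x) = _
  rw [map_smul, smul_eq_mul, mul_comm]

variable [∀ x, TopologicalSpace (L x)] [∀ x, IsModuleTopology ℝ (L x)]

/-- The vector prebundle defined by a compatible family of local frames. -/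
def prebundle : VectorPrebundle ℝ ℝ L where
  pretrivializationAtlas := range a.pretriv
  pretrivialization_linear' := by
    rintro _ ⟨b, rfl⟩
    exact ⟨fun x _ => (a.coord b x).isLinear⟩
  pretrivializationAt := a.pretriv
  mem_base_pretrivializationAt := a.mem_U
  pretrivialization_mem_atlas b := mem_range_self b
  exists_coordChange := by
    rintro _ ⟨b, rfl⟩ _ ⟨b', rfl⟩
    refine ⟨fun x => ContinuousLinearMap.mul ℝ ℝ (a.coord b' x (a.frame b x)), ?_, ?_⟩
    · exact (ContinuousLinearMap.mul ℝ ℝ).continuous.comp_continuousOn (a.continuousOn b b')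
    · intro x hx v
      rw [a.pretriv_change b b' x hx.1]
      rfl
  totalSpaceMk_isInducing b := by
    have hc : Continuous (a.coord b b) := IsModuleTopology.continuous_of_linearMap _
    have := IsModuleTopology.toContinuousSMul ℝ (L b)
    have hs : Continuous (fun t : ℝ => t • a.frame b b) := by fun_prop
    have h1 : IsInducing (a.coord b b) :=
      IsInducing.of_comp hc hs (by
        have : (fun t : ℝ => t • a.frame b b) ∘ a.coord b b = id :=
          funext fun v => a.coord_smul_frame b b (a.mem_U b) v
        rw [this]
        exact IsInducing.id)
    have h2 : IsInducing (fun t : ℝ => (b, t)) := isInducing_prodMkRight b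
    exact h2.comp h1

lemma prebundle_isContMDiff {E : Type*} [NormedAddCommGroup E] [NormedSpace ℝ E]
    [ChartedSpace E B]
    (h : ∀ b b', ContMDiffOn 𝓘(ℝ, E) 𝓘(ℝ, ℝ) ∞ (fun x => a.coord b' x (a.frame b x))
      (a.U b ∩ a.U b')) :
    a.prebundle.IsContMDiff 𝓘(ℝ, E) ∞ where
  exists_contMDiffCoordChange := by
    rintro _ ⟨b, rfl⟩ _ ⟨b', rfl⟩
    refine ⟨fun x => ContinuousLinearMap.mul ℝ ℝ (a.coord b' x (a.frame b x)), ?_, ?_⟩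
    · exact (ContinuousLinearMap.mul ℝ ℝ).contDiff.contMDiff.comp_contMDiffOn (h b b')
    · intro x hx v
      rw [a.pretriv_change b b' x hx.1]
      rfl

end LineFrames

/-! ### The line `L_δ(V)` of a vector space -/

/-- A smooth homomorphism `χ : ℝ* → ℝ*`, extended by `χ 0 = 0`. -/
structure SmoothCharacter where
  toHom : ℝ →*₀ ℝ
  smooth : ContDiffOn ℝ ∞ toHom {0}ᶜ

/-- The derivative of a smooth character at `1`. -/
def SmoothCharacter.weight (χ : SmoothCharacter) : ℝ := deriv χ.toHom 1

/-- The character `t ↦ t`, so that `χ ∘ det = det`. -/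
def volChar : SmoothCharacter := ⟨MonoidWithZeroHom.id ℝ, contDiff_id.contDiffOn⟩

/-- The character `t ↦ |t|`, so that `χ ∘ det = |det|`. -/
def densChar : SmoothCharacter := ⟨absHom, fun _ hx => (contDiffAt_abs hx).contDiffWithinAt⟩

section Assoc

variable (χ : SmoothCharacter) (F : Type*) [NormedAddCommGroup F] [NormedSpace ℝ F]

/-- `L_δ(V)` for `δ = χ ∘ det`: the functions `ξ` on the frames `e : F ≃ V` with
`ξ (e ∘ g) = δ g * ξ e` for `g ∈ GL(F)`. -/
def assocLine (V : Type*) [AddCommGroup V] [Module ℝ V] : Submodule ℝ ((F ≃ₗ[ℝ] V) → ℝ) where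
  carrier := {ξ | ∀ (e : F ≃ₗ[ℝ] V) (g : F ≃ₗ[ℝ] F),
    ξ (g.trans e) = χ.toHom (LinearMap.det (g : F →ₗ[ℝ] F)) * ξ e}
  add_mem' := by
    intro ξ η hξ hη e g
    simp only [Pi.add_apply, hξ e g, hη e g, mul_add]
  zero_mem' := by
    intro e g
    simp
  smul_mem' := by
    intro c ξ hξ e g
    simp only [Pi.smul_apply, hξ e g, smul_eq_mul]
    ring

/-- The element of `L_δ(V)` with value `1` at the frame `e₀`. -/
def assocLineUnit {V : Type*} [AddCommGroup V] [Module ℝ V] (e₀ : F ≃ₗ[ℝ] V) :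
    assocLine χ F V :=
  ⟨fun e => χ.toHom (LinearMap.det ((e.trans e₀.symm : F ≃ₗ[ℝ] F) : F →ₗ[ℝ] F)), by
    intro e g
    have : (((g.trans e).trans e₀.symm : F ≃ₗ[ℝ] F) : F →ₗ[ℝ] F) =
        ((e.trans e₀.symm : F ≃ₗ[ℝ] F) : F →ₗ[ℝ] F) ∘ₗ (g : F →ₗ[ℝ] F) := rfl
    beta_reduce
    rw [this, LinearMap.det_comp, map_mul, mul_comm]⟩

/-- Evaluation at a frame. -/
def assocLineEval {V : Type*} [AddCommGroup V] [Module ℝ V] (e₀ : F ≃ₗ[ℝ] V) :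
    assocLine χ F V →ₗ[ℝ] ℝ where
  toFun ξ := ξ.1 e₀
  map_add' _ _ := rfl
  map_smul' _ _ := rfl

lemma assocLineEval_unit {V : Type*} [AddCommGroup V] [Module ℝ V] (e₀ e₁ : F ≃ₗ[ℝ] V) :
    assocLineEval χ F e₁ (assocLineUnit χ F e₀) =
      χ.toHom (LinearMap.det ((e₁.trans e₀.symm : F ≃ₗ[ℝ] F) : F →ₗ[ℝ] F)) := rfl

lemma assocLineEval_smul_unit {V : Type*} [AddCommGroup V] [Module ℝ V] (e₀ : F ≃ₗ[ℝ] V)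
    (ξ : assocLine χ F V) : assocLineEval χ F e₀ ξ • assocLineUnit χ F e₀ = ξ := by
  ext e
  have h := ξ.2 e₀ (e.trans e₀.symm)
  have h' : (e.trans e₀.symm).trans e₀ = e := by ext; simp
  rw [h'] at h
  rw [h, mul_comm]
  rfl

variable {B : Type*} [TopologicalSpace B] (E : B → Type*)
  [∀ x, AddCommGroup (E x)] [∀ x, Module ℝ (E x)]

/-- The family of lines `L_δ(E_x)`. -/
def AssocBundle (x : B) : Type _ := assocLine χ F (E x)

instance (x : B) : AddCommGroup (AssocBundle χ F E x) :=
  inferInstanceAs (AddCommGroup (assocLine χ F (E x)))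
instance (x : B) : Module ℝ (AssocBundle χ F E x) :=
  inferInstanceAs (Module ℝ (assocLine χ F (E x)))
instance (x : B) : TopologicalSpace (AssocBundle χ F E x) :=
  moduleTopology ℝ (AssocBundle χ F E x)
instance (x : B) : IsModuleTopology ℝ (AssocBundle χ F E x) := ⟨rfl⟩
instance (x : B) : IsTopologicalAddGroup (AssocBundle χ F E x) :=
  IsModuleTopology.topologicalAddGroup ℝ _
instance (x : B) : ContinuousSMul ℝ (AssocBundle χ F E x) :=
  IsModuleTopology.toContinuousSMul ℝ _

variable [∀ x, TopologicalSpace (E x)] [TopologicalSpace (TotalSpace F E)]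
  [FiberBundle F E] [VectorBundle ℝ F E]

/-- The frame `F ≃ E_x` given by the preferred trivialization of `E` around `b`. -/
def trivFrame (b x : B) (hx : x ∈ (trivializationAt F E b).baseSet) : F ≃ₗ[ℝ] E x :=
  ((trivializationAt F E b).linearEquivAt ℝ x hx).symm

/-- The element of `L_δ(E_x)` with value `1` at the frame `e₀`. -/
def AssocBundle.unit {x : B} (e₀ : F ≃ₗ[ℝ] E x) : AssocBundle χ F E x := assocLineUnit χ F e₀

/-- Evaluation of elements of `L_δ(E_x)` at the frame `e₀`. -/
def AssocBundle.eval {x : B} (e₀ : F ≃ₗ[ℝ] E x) : AssocBundle χ F E x →ₗ[ℝ] ℝ :=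
  assocLineEval χ F e₀

open Classical in
/-- The local section of `L_δ(E)` with value `1` on the frame of `E` given by the preferred
trivialization around `b`. -/
def AssocBundle.frame (b x : B) : AssocBundle χ F E x :=
  if hx : x ∈ (trivializationAt F E b).baseSet then AssocBundle.unit χ F E (trivFrame F E b x hx) else 0

open Classical in
/-- Evaluation on the frame of `E` given by the preferred trivialization around `b`. -/
def AssocBundle.coord (b x : B) : AssocBundle χ F E x →ₗ[ℝ] ℝ :=
  if hx : x ∈ (trivializationAt F E b).baseSet then AssocBundle.eval χ F E (trivFrame F E b x hx) else 0

lemma AssocBundle.coord_frame' (b b' x : B) (hx : x ∈ (trivializationAt F E b).baseSet)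
    (hx' : x ∈ (trivializationAt F E b').baseSet) :
    AssocBundle.coord χ F E b' x (AssocBundle.frame χ F E b x) =
      χ.toHom (((trivializationAt F E b').coordChangeL ℝ (trivializationAt F E b) x :
        F →L[ℝ] F).det) := by
  have h1 : AssocBundle.coord χ F E b' x = AssocBundle.eval χ F E (trivFrame F E b' x hx') := by
    unfold AssocBundle.coord; rw [dif_pos hx']
  have h2 : AssocBundle.frame χ F E b x = AssocBundle.unit χ F E (trivFrame F E b x hx) := by
    unfold AssocBundle.frame; rw [dif_pos hx]
  rw [h1, h2]
  refine (assocLineEval_unit χ F _ _).trans ?_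
  congr 2
  ext v
  rw [ContinuousLinearMap.coe_coe, ContinuousLinearEquiv.coe_coe,
    Trivialization.coordChangeL_apply _ _ ⟨hx', hx⟩]
  simp [trivFrame]

lemma coordChangeL_det_ne_zero (b b' x : B) :
    ((trivializationAt F E b').coordChangeL ℝ (trivializationAt F E b) x :
        F →L[ℝ] F).det ≠ 0 :=
  (LinearEquiv.isUnit_det'
    ((trivializationAt F E b').coordChangeL ℝ (trivializationAt F E b) x).toLinearEquiv).ne_zero

variable [FiniteDimensional ℝ F]

lemma contDiff_clm_det : ContDiff ℝ ∞ (fun f : F →L[ℝ] F => f.det) := by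
  let b := Module.finBasis ℝ F
  have h : (fun f : F →L[ℝ] F => f.det) =
      fun f : F →L[ℝ] F => (LinearMap.toMatrix b b (f : F →ₗ[ℝ] F)).det := by
    ext f
    rw [LinearMap.det_toMatrix]
  rw [h]
  simp only [Matrix.det_apply]
  refine ContDiff.sum fun σ _ => ContDiff.const_smul _ (contDiff_prod fun i _ => ?_)
  simp only [LinearMap.toMatrix_apply]
  let φ : F →L[ℝ] ℝ := (b.coord (σ i)).toContinuousLinearMap
  exact (φ.contDiff (n := ∞)).comp (contDiff_id.clm_apply contDiff_const)

/-- The defining local frames of the line bundle `L_δ(E)`. -/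
def AssocBundle.lineFrames : LineFrames B (AssocBundle χ F E) where
  U b := (trivializationAt F E b).baseSet
  isOpen_U b := (trivializationAt F E b).open_baseSet
  mem_U b := FiberBundle.mem_baseSet_trivializationAt F E b
  coord := AssocBundle.coord χ F E
  frame := AssocBundle.frame χ F E
  coord_frame b x hx := by
    rw [AssocBundle.coord_frame' χ F E b b x hx hx]
    have : ((trivializationAt F E b).coordChangeL ℝ (trivializationAt F E b) x : F →L[ℝ] F) =
        ContinuousLinearMap.id ℝ F := by
      ext v
      rw [ContinuousLinearEquiv.coe_coe, Trivialization.coordChangeL_apply _ _ ⟨hx, hx⟩]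
      simp [hx]
    rw [this]
    simp [ContinuousLinearMap.det]
  coord_smul_frame b x hx v := by
    unfold AssocBundle.coord AssocBundle.frame
    rw [dif_pos hx, dif_pos hx]
    exact assocLineEval_smul_unit χ F _ v
  continuousOn b b' := by
    have h : ContinuousOn (fun x => χ.toHom
        (((trivializationAt F E b').coordChangeL ℝ (trivializationAt F E b) x :
          F →L[ℝ] F).det))
        ((trivializationAt F E b).baseSet ∩ (trivializationAt F E b').baseSet) := by
      refine χ.smooth.continuousOn.comp (t := {0}ᶜ) ?_
        (fun x _ => coordChangeL_det_ne_zero F E b b' x)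
      refine ((contDiff_clm_det F).continuous).comp_continuousOn ?_
      rw [inter_comm]
      exact continuousOn_coordChange ℝ _ _
    exact h.congr fun x hx => AssocBundle.coord_frame' χ F E b b' x hx.1 hx.2

instance : TopologicalSpace (TotalSpace ℝ (AssocBundle χ F E)) :=
  (AssocBundle.lineFrames χ F E).prebundle.totalSpaceTopology
instance : FiberBundle ℝ (AssocBundle χ F E) :=
  (AssocBundle.lineFrames χ F E).prebundle.toFiberBundle
instance : VectorBundle ℝ ℝ (AssocBundle χ F E) :=
  (AssocBundle.lineFrames χ F E).prebundle.toVectorBundle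

instance {EB : Type*} [NormedAddCommGroup EB] [NormedSpace ℝ EB] [ChartedSpace EB B]
    [ContMDiffVectorBundle ∞ F E 𝓘(ℝ, EB)] :
    ContMDiffVectorBundle ∞ ℝ (AssocBundle χ F E) 𝓘(ℝ, EB) := by
  have : (AssocBundle.lineFrames χ F E).prebundle.IsContMDiff 𝓘(ℝ, EB) ∞ := by
    refine LineFrames.prebundle_isContMDiff _ fun b b' => ?_
    have h : ContMDiffOn 𝓘(ℝ, EB) 𝓘(ℝ, ℝ) ∞ (fun x => χ.toHom
        (((trivializationAt F E b').coordChangeL ℝ (trivializationAt F E b) x :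
          F →L[ℝ] F).det))
        ((trivializationAt F E b).baseSet ∩ (trivializationAt F E b').baseSet) := by
      refine χ.smooth.contMDiffOn.comp (t := {0}ᶜ) ?_
        (fun x _ => coordChangeL_det_ne_zero F E b b' x)
      refine ((contDiff_clm_det F).contMDiff).comp_contMDiffOn ?_
      rw [inter_comm]
      exact contMDiffOn_coordChangeL _ _
    exact h.congr fun x hx => AssocBundle.coord_frame' χ F E b b' x hx.1 hx.2
  exact (AssocBundle.lineFrames χ F E).prebundle.contMDiffVectorBundle 𝓘(ℝ, EB)

end Assoc

/-! ### Tensor products of line bundles -/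

section Tensor

variable {B : Type*} [TopologicalSpace B] (L₁ L₂ : B → Type*)
  [∀ x, AddCommGroup (L₁ x)] [∀ x, Module ℝ (L₁ x)]
  [∀ x, AddCommGroup (L₂ x)] [∀ x, Module ℝ (L₂ x)]

/-- The family of lines `L₁ ⊗ L₂`. -/
def TensorBundle (x : B) : Type _ := L₁ x ⊗[ℝ] L₂ x

instance (x : B) : AddCommGroup (TensorBundle L₁ L₂ x) :=
  inferInstanceAs (AddCommGroup (L₁ x ⊗[ℝ] L₂ x))
instance (x : B) : Module ℝ (TensorBundle L₁ L₂ x) :=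
  inferInstanceAs (Module ℝ (L₁ x ⊗[ℝ] L₂ x))
instance (x : B) : TopologicalSpace (TensorBundle L₁ L₂ x) :=
  moduleTopology ℝ (TensorBundle L₁ L₂ x)
instance (x : B) : IsModuleTopology ℝ (TensorBundle L₁ L₂ x) := ⟨rfl⟩
instance (x : B) : IsTopologicalAddGroup (TensorBundle L₁ L₂ x) :=
  IsModuleTopology.topologicalAddGroup ℝ _
instance (x : B) : ContinuousSMul ℝ (TensorBundle L₁ L₂ x) :=
  IsModuleTopology.toContinuousSMul ℝ _

variable {L₁ L₂} in
/-- The pure tensor `u ⊗ v` in the fibre of `L₁ ⊗ L₂` at `x`. -/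
def TensorBundle.tmul {x : B} (u : L₁ x) (v : L₂ x) : TensorBundle L₁ L₂ x := u ⊗ₜ[ℝ] v

variable [∀ x, TopologicalSpace (L₁ x)] [TopologicalSpace (TotalSpace ℝ L₁)]
  [FiberBundle ℝ L₁] [VectorBundle ℝ ℝ L₁]
  [∀ x, TopologicalSpace (L₂ x)] [TopologicalSpace (TotalSpace ℝ L₂)]
  [FiberBundle ℝ L₂] [VectorBundle ℝ ℝ L₂]

/-- The local frame of a line bundle given by the preferred trivialization around `b`. -/
def lineFrame (L : B → Type*) [∀ x, AddCommGroup (L x)] [∀ x, Module ℝ (L x)]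
    [∀ x, TopologicalSpace (L x)] [TopologicalSpace (TotalSpace ℝ L)]
    [FiberBundle ℝ L] [VectorBundle ℝ ℝ L] (b x : B) : L x :=
  (trivializationAt ℝ L b).symm x 1

/-- The coordinate with respect to `lineFrame`. -/
def lineCoord (L : B → Type*) [∀ x, AddCommGroup (L x)] [∀ x, Module ℝ (L x)]
    [∀ x, TopologicalSpace (L x)] [TopologicalSpace (TotalSpace ℝ L)]
    [FiberBundle ℝ L] [VectorBundle ℝ ℝ L] (b x : B) : L x →ₗ[ℝ] ℝ :=
  (trivializationAt ℝ L b).linearMapAt ℝ x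

section

variable (L : B → Type*) [∀ x, AddCommGroup (L x)] [∀ x, Module ℝ (L x)]
    [∀ x, TopologicalSpace (L x)] [TopologicalSpace (TotalSpace ℝ L)]
    [FiberBundle ℝ L] [VectorBundle ℝ ℝ L]

lemma lineCoord_lineFrame' (b b' x : B) (hx : x ∈ (trivializationAt ℝ L b).baseSet)
    (hx' : x ∈ (trivializationAt ℝ L b').baseSet) :
    lineCoord L b' x (lineFrame L b x) =
      ((trivializationAt ℝ L b).coordChangeL ℝ (trivializationAt ℝ L b') x : ℝ →L[ℝ] ℝ) 1 := by
  rw [ContinuousLinearEquiv.coe_coe, Trivialization.coordChangeL_apply _ _ ⟨hx, hx'⟩]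
  unfold lineCoord lineFrame
  rw [Trivialization.coe_linearMapAt_of_mem _ hx']

lemma lineCoord_lineFrame (b x : B) (hx : x ∈ (trivializationAt ℝ L b).baseSet) :
    lineCoord L b x (lineFrame L b x) = 1 := by
  unfold lineCoord lineFrame
  rw [Trivialization.coe_linearMapAt_of_mem _ hx]
  simp [hx]

lemma lineCoord_smul_lineFrame (b x : B) (hx : x ∈ (trivializationAt ℝ L b).baseSet) (v : L x) :
    lineCoord L b x v • lineFrame L b x = v := by
  unfold lineCoord lineFrame
  rw [← Trivialization.symmₗ_apply (R := ℝ) _ hx, ← map_smul, smul_eq_mul, mul_one,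
    Trivialization.symmₗ_linearMapAt _ hx]

end

/-- The coordinate on `L₁ ⊗ L₂` with respect to the tensor product of local frames. -/
def TensorBundle.coord (b x : B) : TensorBundle L₁ L₂ x →ₗ[ℝ] ℝ :=
  LinearMap.mul' ℝ ℝ ∘ₗ TensorProduct.map (lineCoord L₁ b x) (lineCoord L₂ b x)

lemma TensorBundle.coord_tmul (b x : B) (u : L₁ x) (v : L₂ x) :
    TensorBundle.coord L₁ L₂ b x (TensorBundle.tmul u v) =
      lineCoord L₁ b x u * lineCoord L₂ b x v := rfl

/-- The defining local frames of the line bundle `L₁ ⊗ L₂`. -/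
def TensorBundle.lineFrames : LineFrames B (TensorBundle L₁ L₂) where
  U b := (trivializationAt ℝ L₁ b).baseSet ∩ (trivializationAt ℝ L₂ b).baseSet
  isOpen_U b := (trivializationAt ℝ L₁ b).open_baseSet.inter (trivializationAt ℝ L₂ b).open_baseSet
  mem_U b := ⟨FiberBundle.mem_baseSet_trivializationAt ℝ L₁ b,
    FiberBundle.mem_baseSet_trivializationAt ℝ L₂ b⟩
  coord := TensorBundle.coord L₁ L₂
  frame b x := TensorBundle.tmul (lineFrame L₁ b x) (lineFrame L₂ b x)
  coord_frame b x hx := by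
    rw [TensorBundle.coord_tmul, lineCoord_lineFrame L₁ b x hx.1, lineCoord_lineFrame L₂ b x hx.2,
      mul_one]
  coord_smul_frame b x hx v := by
    induction v using TensorProduct.induction_on with
    | zero => exact (congrArg (· • _) (map_zero (TensorBundle.coord L₁ L₂ b x))).trans (zero_smul ℝ _)
    | tmul u w =>
      change (lineCoord L₁ b x u * lineCoord L₂ b x w) •
        (lineFrame L₁ b x ⊗ₜ[ℝ] lineFrame L₂ b x) = u ⊗ₜ[ℝ] w
      rw [← TensorProduct.smul_tmul_smul, lineCoord_smul_lineFrame L₁ b x hx.1,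
        lineCoord_smul_lineFrame L₂ b x hx.2]
    | add y z hy hz =>
      refine (congrArg (· • _) (map_add (TensorBundle.coord L₁ L₂ b x) y z)).trans ?_
      refine (add_smul _ _ _).trans ?_
      exact congrArg₂ (· + ·) hy hz
  continuousOn b b' := by
    have h₁ : ContinuousOn (fun x => lineCoord L₁ b' x (lineFrame L₁ b x))
        ((trivializationAt ℝ L₁ b).baseSet ∩ (trivializationAt ℝ L₁ b').baseSet) := by
      refine ContinuousOn.congr ?_ fun x hx => lineCoord_lineFrame' L₁ b b' x hx.1 hx.2
      exact (continuousOn_coordChange ℝ _ _).clm_apply continuousOn_const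
    have h₂ : ContinuousOn (fun x => lineCoord L₂ b' x (lineFrame L₂ b x))
        ((trivializationAt ℝ L₂ b).baseSet ∩ (trivializationAt ℝ L₂ b').baseSet) := by
      refine ContinuousOn.congr ?_ fun x hx => lineCoord_lineFrame' L₂ b b' x hx.1 hx.2
      exact (continuousOn_coordChange ℝ _ _).clm_apply continuousOn_const
    exact (h₁.mono fun x hx => ⟨hx.1.1, hx.2.1⟩).mul (h₂.mono fun x hx => ⟨hx.1.2, hx.2.2⟩)

instance : TopologicalSpace (TotalSpace ℝ (TensorBundle L₁ L₂)) :=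
  (TensorBundle.lineFrames L₁ L₂).prebundle.totalSpaceTopology
instance : FiberBundle ℝ (TensorBundle L₁ L₂) :=
  (TensorBundle.lineFrames L₁ L₂).prebundle.toFiberBundle
instance : VectorBundle ℝ ℝ (TensorBundle L₁ L₂) :=
  (TensorBundle.lineFrames L₁ L₂).prebundle.toVectorBundle

lemma contMDiffOn_lineCoord_lineFrame (L : B → Type*)
    [∀ x, AddCommGroup (L x)] [∀ x, Module ℝ (L x)]
    [∀ x, TopologicalSpace (L x)] [TopologicalSpace (TotalSpace ℝ L)]
    [FiberBundle ℝ L] [VectorBundle ℝ ℝ L]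
    {EB : Type*} [NormedAddCommGroup EB] [NormedSpace ℝ EB] [ChartedSpace EB B]
    [ContMDiffVectorBundle ∞ ℝ L 𝓘(ℝ, EB)] (b b' : B) :
    ContMDiffOn 𝓘(ℝ, EB) 𝓘(ℝ, ℝ) ∞ (fun x => lineCoord L b' x (lineFrame L b x))
      ((trivializationAt ℝ L b).baseSet ∩ (trivializationAt ℝ L b').baseSet) := by
  refine ContMDiffOn.congr ?_ fun x hx => lineCoord_lineFrame' L b b' x hx.1 hx.2
  exact (contMDiffOn_coordChangeL _ _).clm_apply contMDiffOn_const

instance {EB : Type*} [NormedAddCommGroup EB] [NormedSpace ℝ EB] [ChartedSpace EB B]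
    [ContMDiffVectorBundle ∞ ℝ L₁ 𝓘(ℝ, EB)] [ContMDiffVectorBundle ∞ ℝ L₂ 𝓘(ℝ, EB)] :
    ContMDiffVectorBundle ∞ ℝ (TensorBundle L₁ L₂) 𝓘(ℝ, EB) := by
  have : (TensorBundle.lineFrames L₁ L₂).prebundle.IsContMDiff 𝓘(ℝ, EB) ∞ := by
    refine LineFrames.prebundle_isContMDiff _ fun b b' => ?_
    exact ((contMDiffOn_lineCoord_lineFrame L₁ b b').mono fun x hx => ⟨hx.1.1, hx.2.1⟩).mul
      ((contMDiffOn_lineCoord_lineFrame L₂ b b').mono fun x hx => ⟨hx.1.2, hx.2.2⟩)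
  exact (TensorBundle.lineFrames L₁ L₂).prebundle.contMDiffVectorBundle 𝓘(ℝ, EB)

end Tensor

/-! ### Smooth sections, directional derivatives, the dual bundle -/

section Basics

variable {E : Type*} [NormedAddCommGroup E] [NormedSpace ℝ E]
  {M : Type*} [TopologicalSpace M] [ChartedSpace E M]

/-- The derivative `X f` of a function along a vector field. -/
def dirDeriv (X : ∀ x : M, TangentSpace 𝓘(ℝ, E) x) (f : M → ℝ) (x : M) : ℝ :=
  mvfderiv 𝓘(ℝ, E) f x (X x)

/-- The section `σ` is smooth on the set `U`. -/
def SmoothSectionOn (E : Type*) [NormedAddCommGroup E] [NormedSpace ℝ E] [ChartedSpace E M]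
    (F : Type*) [NormedAddCommGroup F] [NormedSpace ℝ F]
    {V : M → Type*} [TopologicalSpace (TotalSpace F V)] [∀ x, TopologicalSpace (V x)]
    [FiberBundle F V] (σ : ∀ x, V x) (U : Set M) : Prop :=
  ContMDiffOn 𝓘(ℝ, E) (𝓘(ℝ, E).prod 𝓘(ℝ, F)) ∞ (fun x => TotalSpace.mk' F x (σ x)) U

variable {F : Type*} [NormedAddCommGroup F] [NormedSpace ℝ F]
  {A : M → Type*} [TopologicalSpace (TotalSpace F A)] [∀ x, AddCommGroup (A x)]
  [∀ x, Module ℝ (A x)] [∀ x, TopologicalSpace (A x)] [FiberBundle F A] [VectorBundle ℝ F A]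

lemma mvfderiv_constMul (t : ℝ) {f : M → ℝ} {x : M}
    (hf : MDifferentiableAt 𝓘(ℝ, E) 𝓘(ℝ, ℝ) f x) :
    mvfderiv 𝓘(ℝ, E) (fun y => t * f y) x = t • mvfderiv 𝓘(ℝ, E) f x := by
  have h := mvfderiv_mul (I := 𝓘(ℝ, E)) (f := fun _ : M => t) (g := f) (x := x)
    mdifferentiableAt_const hf
  rw [mvfderiv_const, smul_zero, add_zero] at h
  exact h

/-- The product of a smooth function and a smooth section. -/
def smulSection (f : C^∞⟮𝓘(ℝ, E), M; 𝓘(ℝ, ℝ), ℝ⟯) (α : Cₛ^∞⟮𝓘(ℝ, E); F, A⟯) :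
    Cₛ^∞⟮𝓘(ℝ, E); F, A⟯ :=
  ⟨fun x => f x • α x, f.contMDiff.smul_section α.contMDiff⟩

/-- The dual bundle `A*`, with model fibre `F →L[ℝ] ℝ`. -/
abbrev DualBundle (A : M → Type*) [∀ x, AddCommGroup (A x)]
    [∀ x, Module ℝ (A x)] [∀ x, TopologicalSpace (A x)] : M → Type _ :=
  fun x => A x →L[ℝ] Bundle.Trivial M ℝ x

end Basics

/-! ### Lie algebroids and their first cohomology -/

section Algebroid

variable (E : Type*) [NormedAddCommGroup E] [NormedSpace ℝ E]
  {M : Type*} [TopologicalSpace M] [ChartedSpace E M] [IsManifold 𝓘(ℝ, E) ∞ M]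
  (F : Type*) [NormedAddCommGroup F] [NormedSpace ℝ F]
  (A : M → Type*) [TopologicalSpace (TotalSpace F A)] [∀ x, AddCommGroup (A x)]
  [∀ x, Module ℝ (A x)] [∀ x, TopologicalSpace (A x)] [FiberBundle F A] [VectorBundle ℝ F A]

/-- A Lie algebroid structure on the smooth vector bundle `A` over `M`: a smooth bundle map
`A → TM` and a real Lie bracket on `Γ(A)`, satisfying the Leibniz rule. -/
structure LieAlgebroid where
  anchor : Cₛ^∞⟮𝓘(ℝ, E); F →L[ℝ] E, fun x : M => A x →L[ℝ] TangentSpace 𝓘(ℝ, E) x⟯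
  bracket : Cₛ^∞⟮𝓘(ℝ, E); F, A⟯ → Cₛ^∞⟮𝓘(ℝ, E); F, A⟯ → Cₛ^∞⟮𝓘(ℝ, E); F, A⟯
  add_bracket : ∀ α β γ, bracket (α + β) γ = bracket α γ + bracket β γ
  smul_bracket : ∀ (t : ℝ) α β, bracket (t • α) β = t • bracket α β
  bracket_self : ∀ α, bracket α α = 0
  bracket_add : ∀ α β γ, bracket α (β + γ) = bracket α β + bracket α γ
  jacobi : ∀ α β γ,
    bracket α (bracket β γ) = bracket (bracket α β) γ + bracket β (bracket α γ)
  anchor_bracket : ∀ α β x, anchor x (bracket α β x) =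
    VectorField.mlieBracket 𝓘(ℝ, E) (fun y => anchor y (α y)) (fun y => anchor y (β y)) x
  leibniz : ∀ (f : C^∞⟮𝓘(ℝ, E), M; 𝓘(ℝ, ℝ), ℝ⟯) α β x,
    bracket α (smulSection f β) x =
      f x • bracket α β x + dirDeriv (fun y => anchor y (α y)) f x • β x

namespace LieAlgebroid

variable {E F A} (𝔸 : LieAlgebroid E F A)

/-- The vector field `ρ(α)`, where `ρ` is the anchor. -/
def rho (α : Cₛ^∞⟮𝓘(ℝ, E); F, A⟯) (x : M) : TangentSpace 𝓘(ℝ, E) x := 𝔸.anchor x (α x)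

/-- `A`-forms of degree one, i.e. smooth sections of `A*`. -/
abbrev Form1 (_ : LieAlgebroid E F A) : Type _ :=
  Cₛ^∞⟮𝓘(ℝ, E); F →L[ℝ] ℝ, DualBundle A⟯

lemma mdifferentiableAt_pairing (c : 𝔸.Form1) (α : Cₛ^∞⟮𝓘(ℝ, E); F, A⟯) (x : M) :
    MDifferentiableAt 𝓘(ℝ, E) 𝓘(ℝ, ℝ) (fun y => (c y (α y) : ℝ)) x := by
  have h := ContMDiff.clm_bundle_apply (b := fun y : M => y) (ϕ := fun y => c y)
    (v := fun y => α y) c.contMDiff α.contMDiff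
  have h2 : ContMDiff 𝓘(ℝ, E) 𝓘(ℝ, ℝ) ∞ (fun y => (c y (α y) : ℝ)) := by
    intro y
    exact ((contMDiffAt_section y).1 (h y))
  exact (h2 x).mdifferentiableAt (by simp)

/-- The closed one-forms: `ρ(α)(c(β)) - ρ(β)(c(α)) - c([α, β]) = 0`. -/
def closedForms : Submodule ℝ 𝔸.Form1 where
  carrier := {c | ∀ (α β : Cₛ^∞⟮𝓘(ℝ, E); F, A⟯) (x : M),
    dirDeriv (𝔸.rho α) (fun y => (c y (β y) : ℝ)) x
      - dirDeriv (𝔸.rho β) (fun y => (c y (α y) : ℝ)) x - c x (𝔸.bracket α β x) = 0}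
  add_mem' := by
    intro c d hc hd α β x
    have key : ∀ (γ δ : Cₛ^∞⟮𝓘(ℝ, E); F, A⟯),
        dirDeriv (𝔸.rho γ) (fun y => ((c + d) y (δ y) : ℝ)) x =
        dirDeriv (𝔸.rho γ) (fun y => (c y (δ y) : ℝ)) x +
        dirDeriv (𝔸.rho γ) (fun y => (d y (δ y) : ℝ)) x := by
      intro γ δ
      have := mvfderiv_add (𝔸.mdifferentiableAt_pairing c δ x)
        (𝔸.mdifferentiableAt_pairing d δ x)
      exact DFunLike.congr_fun this (𝔸.rho γ x)
    have e : ((c + d) x (𝔸.bracket α β x) : ℝ) = c x (𝔸.bracket α β x) + d x (𝔸.bracket α β x) :=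
      rfl
    have h1 := hc α β x
    have h2 := hd α β x
    rw [key, key]
    linarith
  zero_mem' := by
    intro α β x
    have key : ∀ (γ δ : Cₛ^∞⟮𝓘(ℝ, E); F, A⟯),
        dirDeriv (𝔸.rho γ) (fun y => ((0 : 𝔸.Form1) y (δ y) : ℝ)) x = 0 := by
      intro γ δ
      exact DFunLike.congr_fun (mvfderiv_const (I := 𝓘(ℝ, E)) (0 : ℝ) (x := x)) (𝔸.rho γ x)
    have e : ((0 : 𝔸.Form1) x (𝔸.bracket α β x) : ℝ) = 0 := rfl
    rw [key, key]
    linarith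
  smul_mem' := by
    intro t c hc α β x
    have key : ∀ (γ δ : Cₛ^∞⟮𝓘(ℝ, E); F, A⟯),
        dirDeriv (𝔸.rho γ) (fun y => ((t • c) y (δ y) : ℝ)) x =
        t * dirDeriv (𝔸.rho γ) (fun y => (c y (δ y) : ℝ)) x := by
      intro γ δ
      have := mvfderiv_constMul t (𝔸.mdifferentiableAt_pairing c δ x)
      exact DFunLike.congr_fun this (𝔸.rho γ x)
    have e : ((t • c) x (𝔸.bracket α β x) : ℝ) = t * c x (𝔸.bracket α β x) := rfl
    have h1 := hc α β x
    rw [key, key]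
    rw [e]
    linear_combination t * h1

/-- The exact one-forms `d_A f`, where `(d_A f)(α) = ρ(α)(f)`. -/
def exactForms : Submodule ℝ 𝔸.Form1 where
  carrier := {c | ∃ f : C^∞⟮𝓘(ℝ, E), M; 𝓘(ℝ, ℝ), ℝ⟯, ∀ (x : M) (v : A x),
    c x v = mvfderiv 𝓘(ℝ, E) f x (𝔸.anchor x v)}
  add_mem' := by
    rintro c d ⟨f, hf⟩ ⟨g, hg⟩
    refine ⟨f + g, fun x v => ?_⟩
    have := mvfderiv_add ((f.contMDiff x).mdifferentiableAt (by simp))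
      ((g.contMDiff x).mdifferentiableAt (by simp))
    refine Eq.trans ?_ (DFunLike.congr_fun this (𝔸.anchor x v)).symm
    exact congrArg₂ (· + ·) (hf x v) (hg x v)
  zero_mem' := by
    refine ⟨0, fun x v => ?_⟩
    exact (DFunLike.congr_fun (mvfderiv_const (I := 𝓘(ℝ, E)) (0 : ℝ) (x := x))
      (𝔸.anchor x v)).symm
  smul_mem' := by
    rintro t c ⟨f, hf⟩
    refine ⟨t • f, fun x v => ?_⟩
    have := mvfderiv_constMul t ((f.contMDiff x).mdifferentiableAt (by simp))
    refine Eq.trans ?_ (DFunLike.congr_fun this (𝔸.anchor x v)).symm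
    exact congrArg (t * ·) (hf x v)

/-- The Lie algebroid cohomology `H¹(A)`. -/
abbrev H1 : Type _ := 𝔸.closedForms ⧸ 𝔸.exactForms.submoduleOf 𝔸.closedForms

/-! ### Representations on line bundles and their characteristic classes -/

section Rep

variable (L : M → Type*) [∀ x, AddCommGroup (L x)] [∀ x, Module ℝ (L x)]
  [∀ x, TopologicalSpace (L x)] [TopologicalSpace (TotalSpace ℝ L)]
  [FiberBundle ℝ L] [VectorBundle ℝ ℝ L]

/-- An infinitesimal operation `(α, σ) ↦ ∇_α σ` of `Γ(A)` on sections of `L`. To be able to apply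
it to local sections, it is given on arbitrary functions `σ`; only its values at points near which
`σ` is smooth are meaningful. -/
abbrev Operation (_ : LieAlgebroid E F A) : Type _ :=
  Cₛ^∞⟮𝓘(ℝ, E); F, A⟯ → (∀ x, L x) → ∀ x, L x

variable {L}

/-- The operation `∇` is a representation of `A` on `L`, i.e. a flat `A`-connection. -/
structure IsRepresentation (nabla : 𝔸.Operation L) : Prop where
  smooth : ∀ α σ (U : Set M), IsOpen U → SmoothSectionOn E ℝ σ U →
    SmoothSectionOn E ℝ (nabla α σ) U
  add_left : ∀ α β σ (U : Set M), IsOpen U → SmoothSectionOn E ℝ σ U →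
    ∀ x ∈ U, nabla (α + β) σ x = nabla α σ x + nabla β σ x
  smul_left : ∀ (f : C^∞⟮𝓘(ℝ, E), M; 𝓘(ℝ, ℝ), ℝ⟯) α σ (U : Set M), IsOpen U →
    SmoothSectionOn E ℝ σ U → ∀ x ∈ U, nabla (smulSection f α) σ x = f x • nabla α σ x
  add_right : ∀ α σ τ (U : Set M), IsOpen U → SmoothSectionOn E ℝ σ U →
    SmoothSectionOn E ℝ τ U → ∀ x ∈ U, nabla α (σ + τ) x = nabla α σ x + nabla α τ x
  leibniz : ∀ α σ (f : M → ℝ) (U : Set M), IsOpen U → SmoothSectionOn E ℝ σ U →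
    ContMDiffOn 𝓘(ℝ, E) 𝓘(ℝ, ℝ) ∞ f U → ∀ x ∈ U,
      nabla α (fun y => f y • σ y) x = f x • nabla α σ x + dirDeriv (𝔸.rho α) f x • σ x
  flat : ∀ α β σ (U : Set M), IsOpen U → SmoothSectionOn E ℝ σ U → ∀ x ∈ U,
    nabla (𝔸.bracket α β) σ x = nabla α (nabla β σ) x - nabla β (nabla α σ) x

/-- `c` is the connection form of the section `σ`: `∇_α σ = c(α) σ` for all `α`. -/
def IsConnectionForm (nabla : 𝔸.Operation L) (σ : Cₛ^∞⟮𝓘(ℝ, E); ℝ, L⟯) (c : 𝔸.Form1) : Prop :=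
  ∀ (α : Cₛ^∞⟮𝓘(ℝ, E); F, A⟯) (x : M), nabla α σ x = (c x (α x) : ℝ) • σ x

/-- `L` is trivializable and, for every nowhere vanishing section `σ` of `L`, the form `c_σ` with
`∇_α σ = c_σ(α) σ` exists, is closed, and has class `θ`. -/
def IsTrivializedClass (nabla : 𝔸.Operation L) (θ : 𝔸.H1) : Prop :=
  (∃ σ : Cₛ^∞⟮𝓘(ℝ, E); ℝ, L⟯, ∀ x, σ x ≠ 0) ∧
  ∀ σ : Cₛ^∞⟮𝓘(ℝ, E); ℝ, L⟯, (∀ x, σ x ≠ 0) →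
    (∃ c : 𝔸.closedForms, 𝔸.IsConnectionForm nabla σ c) ∧
    ∀ c : 𝔸.closedForms, 𝔸.IsConnectionForm nabla σ c → Submodule.Quotient.mk c = θ

end Rep

section TensorRep

variable {L₁ L₂ : M → Type*}
  [∀ x, AddCommGroup (L₁ x)] [∀ x, Module ℝ (L₁ x)]
  [∀ x, AddCommGroup (L₂ x)] [∀ x, Module ℝ (L₂ x)]
  [∀ x, TopologicalSpace (L₁ x)] [TopologicalSpace (TotalSpace ℝ L₁)]
  [FiberBundle ℝ L₁] [VectorBundle ℝ ℝ L₁]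
  [∀ x, TopologicalSpace (L₂ x)] [TopologicalSpace (TotalSpace ℝ L₂)]
  [FiberBundle ℝ L₂] [VectorBundle ℝ ℝ L₂]

/-- The operation `D_α ⊗ 1 + 1 ⊗ D'_α` on `L₁ ⊗ L₂`: if `ζ = f s₁ ⊗ s₂` near `x` for the preferred
local frames `s₁`, `s₂` around `x`, then its value on `ζ` at `x` is
`ρ(α)(f) s₁ ⊗ s₂ + f (D_α s₁ ⊗ s₂ + s₁ ⊗ D'_α s₂)`. -/
def tensorOp (D : 𝔸.Operation L₁) (D' : 𝔸.Operation L₂) : 𝔸.Operation (TensorBundle L₁ L₂) :=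
  fun α ζ x =>
    dirDeriv (𝔸.rho α) (fun y => TensorBundle.coord L₁ L₂ x y (ζ y)) x •
        TensorBundle.tmul (lineFrame L₁ x x) (lineFrame L₂ x x) +
      TensorBundle.coord L₁ L₂ x x (ζ x) •
        (TensorBundle.tmul (D α (lineFrame L₁ x) x) (lineFrame L₂ x x) +
          TensorBundle.tmul (lineFrame L₁ x x) (D' α (lineFrame L₂ x) x))

end TensorRep

section CharClass

variable {L : M → Type*} [∀ x, AddCommGroup (L x)] [∀ x, Module ℝ (L x)]
  [∀ x, TopologicalSpace (L x)] [TopologicalSpace (TotalSpace ℝ L)]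
  [FiberBundle ℝ L] [VectorBundle ℝ ℝ L]

/-- `θ` is the characteristic class of the representation `∇` on `L`: half of the class of the
(trivializable) representation on `L ⊗ L`. -/
def IsCharClass (nabla : 𝔸.Operation L) (θ : 𝔸.H1) : Prop :=
  ∃ θ' : 𝔸.H1, 𝔸.IsTrivializedClass (𝔸.tensorOp nabla nabla) θ' ∧ θ = (1 / 2 : ℝ) • θ'

lemma IsCharClass.unique {nabla : 𝔸.Operation L} {θ₁ θ₂ : 𝔸.H1}
    (h₁ : 𝔸.IsCharClass nabla θ₁) (h₂ : 𝔸.IsCharClass nabla θ₂) : θ₁ = θ₂ := by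
  obtain ⟨η₁, ⟨⟨σ, hσ⟩, k₁⟩, rfl⟩ := h₁
  obtain ⟨η₂, ⟨-, k₂⟩, rfl⟩ := h₂
  obtain ⟨⟨c, hc⟩, hc₁⟩ := k₁ σ hσ
  rw [← hc₁ c hc, ← (k₂ σ hσ).2 c hc]

open Classical in
/-- The characteristic class `θ_A(L)` of a representation of `A` on `L`: the unique `θ` with
`IsCharClass`, and `0` if there is none. -/
def charClass (nabla : 𝔸.Operation L) : 𝔸.H1 :=
  if h : ∃ θ, 𝔸.IsCharClass nabla θ then h.choose else 0

lemma IsCharClass.charClass_eq {nabla : 𝔸.Operation L} {θ : 𝔸.H1}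
    (h : 𝔸.IsCharClass nabla θ) : 𝔸.charClass nabla = θ := by
  have h' : ∃ θ, 𝔸.IsCharClass nabla θ := ⟨θ, h⟩
  unfold charClass
  rw [dif_pos h']
  exact IsCharClass.unique 𝔸 h'.choose_spec h

end CharClass

/-! ### Lie derivatives on the associated line bundles -/

open Classical in
/-- The bracket `[α, s]` with a local section `s`: its value at `x` is `[α, β](x)` for any global
section `β` that agrees with `s` near `x`. -/
def localBracket (α : Cₛ^∞⟮𝓘(ℝ, E); F, A⟯) (s : ∀ x, A x) (x : M) : A x :=
  if h : ∃ β : Cₛ^∞⟮𝓘(ℝ, E); F, A⟯, ∀ᶠ y in 𝓝 x, β y = s y then 𝔸.bracket α h.choose x else 0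

variable [FiniteDimensional ℝ F]

/-- The Lie derivative on sections of `A*`, `(L_α φ)(s) = ρ(α)(φ(s)) - φ([α, s])`, computed at `x`
by letting `s` run through a local frame of `A` around `x`. -/
def lieDual (α : Cₛ^∞⟮𝓘(ℝ, E); F, A⟯) (φ : ∀ x, DualBundle A x) (x : M) : DualBundle A x :=
  ∑ i, (dirDeriv (𝔸.rho α)
        (fun y => (φ y ((trivializationAt F A x).localFrame (Module.finBasis ℝ F) i y) : ℝ)) x
      - (φ x (𝔸.localBracket α
          ((trivializationAt F A x).localFrame (Module.finBasis ℝ F) i) x) : ℝ)) •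
    ((Module.finBasis ℝ F).coord i).toContinuousLinearMap.comp
      ((trivializationAt F A x).continuousLinearMapAt ℝ x)

end LieAlgebroid

/-- The operator on sections of `L_δ(V)`, `δ = χ ∘ det`, induced by an operator `D` on sections of
`V` with `D (f s) = X(f) s + f D s`. If `e` is a local frame of `V` and `D e = e a`, then
`(L ξ)(e) = X(ξ(e)) - (dδ)₁(a) ξ(e)`, where `(dδ)₁(a) = χ'(1) tr a`; at `x` this is used for the
frame given by the preferred trivialization of `V` around `x`. -/
def lieAssoc {E : Type*} [NormedAddCommGroup E] [NormedSpace ℝ E]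
    {M : Type*} [TopologicalSpace M] [ChartedSpace E M] (χ : SmoothCharacter)
    {F : Type*} [NormedAddCommGroup F] [NormedSpace ℝ F] [FiniteDimensional ℝ F]
    {V : M → Type*} [TopologicalSpace (TotalSpace F V)] [∀ x, AddCommGroup (V x)]
    [∀ x, Module ℝ (V x)] [∀ x, TopologicalSpace (V x)] [FiberBundle F V] [VectorBundle ℝ F V]
    (X : ∀ x : M, TangentSpace 𝓘(ℝ, E) x) (D : (∀ x, V x) → ∀ x, V x)
    (ξ : ∀ x, AssocBundle χ F V x) (x : M) : AssocBundle χ F V x :=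
  (dirDeriv X (fun y => AssocBundle.coord χ F V x y (ξ y)) x
    - χ.weight *
      (∑ i, (Module.finBasis ℝ F).coord i ((trivializationAt F V x).linearMapAt ℝ x
        (D ((trivializationAt F V x).localFrame (Module.finBasis ℝ F) i) x))) *
      AssocBundle.coord χ F V x x (ξ x)) • AssocBundle.frame χ F V x x

namespace LieAlgebroid

variable {E F A} [FiniteDimensional ℝ E] [FiniteDimensional ℝ F] (𝔸 : LieAlgebroid E F A)

/-- The line bundle `L_δ(A*) ⊗ L_δ'(TM)`, where `δ = χ ∘ det` and `δ' = χ' ∘ det`. -/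
abbrev TransverseBundle (_ : LieAlgebroid E F A) (χ χ' : SmoothCharacter) : M → Type _ :=
  TensorBundle (AssocBundle χ (F →L[ℝ] ℝ) (DualBundle A))
    (AssocBundle χ' E (fun x : M => TangentSpace 𝓘(ℝ, E) x))

/-- The operation `∇_α (ω ⊗ μ) = L_α ω ⊗ μ + ω ⊗ L_{ρ(α)} μ` of `A` on `L_δ(A*) ⊗ L_δ'(TM)`. -/
def transverseOp (χ χ' : SmoothCharacter) : 𝔸.Operation (𝔸.TransverseBundle χ χ') :=
  𝔸.tensorOp (fun α => lieAssoc χ (𝔸.rho α) (𝔸.lieDual α))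
    (fun α => lieAssoc χ' (𝔸.rho α) (VectorField.mlieBracket 𝓘(ℝ, E) (𝔸.rho α)))

/-- The transverse density representation, on `D_{A*} ⊗ D_{TM}`. -/
def densOp : 𝔸.Operation (𝔸.TransverseBundle densChar densChar) :=
  𝔸.transverseOp densChar densChar

/-- The transverse volume representation, on `V_{A*} ⊗ V_{TM} = Λ^top A ⊗ Λ^top T*M`. -/
def volOp : 𝔸.Operation (𝔸.TransverseBundle volChar volChar) :=
  𝔸.transverseOp volChar volChar

/-- The canonical representation `Q_A`, on `V_{A*} ⊗ D_{TM} = Λ^top A ⊗ |Λ^top T*M|`. -/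
def canOp : 𝔸.Operation (𝔸.TransverseBundle volChar densChar) :=
  𝔸.transverseOp volChar densChar

/-- The modular class of `A`. -/
def modularClass : 𝔸.H1 := 𝔸.charClass 𝔸.densOp

end LieAlgebroid

end Algebroid

end

/-! ### Germs of smooth functions and of smooth sections -/

section Germs

variable (E : Type*) [NormedAddCommGroup E] [NormedSpace ℝ E]
  {M : Type*} [TopologicalSpace M] [ChartedSpace E M]

/-! All three bundles have the form `L_χ(A*) ⊗ L_χ'(TM)`, where each of `χ`, `χ'` is `t ↦ t` or `t ↦
|t|`. The proof isolates the two places where a character matters and shows that the choice is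
invisible in both.

Infinitesimally, only the derivative of the character at `1` is seen. In a local frame an operation
on a line bundle reads `s ↦ X(s) + w s` (`HasLocalForm`). For `lieAssoc` the function `w` is minus
the weight of the character times the trace of the underlying derivation (`hasLocalForm_lieAssoc`,
which rests on Jacobi's formula), and under tensor products these functions add
(`hasLocalForm_tensorOp`). Both characters have weight `1`, and the trace on `A*` is minus the trace
on `A` (`frameTrace_lieDual`). So in every case `w` is the difference of the traces of `[α, ·]` on
`A` and of `[ρ(α), ·]` on `TM`, called `divergence`. It is linear over functions in `α`, because the
anomalies of the two traces cancel, and it satisfies the cocycle identity, because traces of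
commutators contain only derivatives of traces. By `isRepresentation_of_hasLocalForm` this makes all
three operations flat connections.

Globally, the characteristic class is computed on `L ⊗ L`, whose transition functions involve the
characters only through their squares, and `|t|² = t²`. Hence the three squares have the same
transition functions and the same local forms. A nowhere vanishing section of one becomes a section
of another with the same coordinates and the same connection form
(`IsTrivializedClass.eq_of_transition`), so the classes agree.

The classes exist because the transition functions of a square are positive, so that local frames
can be averaged by a partition of unity. Flatness makes the connection form of a section closed, and
multiplying the section by `f` changes it by the exact form `d_A log|f|`. -/

/-- The function `f` is smooth near `x`. -/
def SmoothFnNear (f : M → ℝ) (x : M) : Prop :=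
  ∀ᶠ y in 𝓝 x, ContMDiffAt 𝓘(ℝ, E) 𝓘(ℝ, ℝ) ∞ f y

variable (F : Type*) [NormedAddCommGroup F] [NormedSpace ℝ F]
  {V : M → Type*} [TopologicalSpace (TotalSpace F V)]
  [∀ x, TopologicalSpace (V x)] [FiberBundle F V]

/-- The section `σ` is smooth near `x`. -/
def SmoothNear (σ : ∀ x, V x) (x : M) : Prop :=
  ∀ᶠ y in 𝓝 x, ContMDiffAt 𝓘(ℝ, E) (𝓘(ℝ, E).prod 𝓘(ℝ, F)) ∞ (fun z => TotalSpace.mk' F z (σ z)) y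

variable {E F}

namespace SmoothFnNear

variable {f g : M → ℝ} {x : M}

lemma contMDiffAt (h : SmoothFnNear E f x) : ContMDiffAt 𝓘(ℝ, E) 𝓘(ℝ, ℝ) ∞ f x :=
  h.self_of_nhds

lemma mdifferentiableAt (h : SmoothFnNear E f x) : MDifferentiableAt 𝓘(ℝ, E) 𝓘(ℝ, ℝ) f x :=
  h.contMDiffAt.mdifferentiableAt (by simp)

lemma of_contMDiff (h : ContMDiff 𝓘(ℝ, E) 𝓘(ℝ, ℝ) ∞ f) : SmoothFnNear E f x :=
  Eventually.of_forall h

lemma of_contMDiffOn {U : Set M} (hU : IsOpen U) (h : ContMDiffOn 𝓘(ℝ, E) 𝓘(ℝ, ℝ) ∞ f U)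
    (hx : x ∈ U) : SmoothFnNear E f x := by
  filter_upwards [hU.mem_nhds hx] with y hy using h.contMDiffAt (hU.mem_nhds hy)

lemma const (c : ℝ) : SmoothFnNear E (fun _ : M => c) x := of_contMDiff contMDiff_const

lemma congr (h : SmoothFnNear E f x) (hfg : g =ᶠ[𝓝 x] f) : SmoothFnNear E g x := by
  filter_upwards [h, hfg.eventuallyEq_nhds] with y hy hy' using hy.congr_of_eventuallyEq hy'

lemma add (hf : SmoothFnNear E f x) (hg : SmoothFnNear E g x) :
    SmoothFnNear E (fun y => f y + g y) x := by
  filter_upwards [hf, hg] with y h h' using h.add h'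

lemma sub (hf : SmoothFnNear E f x) (hg : SmoothFnNear E g x) :
    SmoothFnNear E (fun y => f y - g y) x := by
  filter_upwards [hf, hg] with y h h' using h.sub h'

lemma mul (hf : SmoothFnNear E f x) (hg : SmoothFnNear E g x) :
    SmoothFnNear E (fun y => f y * g y) x := by
  filter_upwards [hf, hg] with y h h' using h.mul h'

lemma sum {ι : Type*} (s : Finset ι) {f : ι → M → ℝ} (hf : ∀ i ∈ s, SmoothFnNear E (f i) x) :
    SmoothFnNear E (fun y => ∑ i ∈ s, f i y) x := by
  classical
  induction s using Finset.induction_on with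
  | empty => simpa using const 0
  | insert a s ha ih =>
    simp only [Finset.sum_insert ha]
    exact (hf a (by simp)).add (ih fun i hi => hf i (by simp [hi]))

lemma comp_of_contDiffOn {φ : ℝ → ℝ} {s : Set ℝ} (hs : IsOpen s) (hφ : ContDiffOn ℝ ∞ φ s)
    (hf : SmoothFnNear E f x) (hx : f x ∈ s) : SmoothFnNear E (fun y => φ (f y)) x := by
  filter_upwards [hf, hf.contMDiffAt.continuousAt.preimage_mem_nhds (hs.mem_nhds hx)] with y h h'
  exact (hφ.contDiffAt (hs.mem_nhds h')).contMDiffAt.comp y h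

lemma inv (hf : SmoothFnNear E f x) (hx : f x ≠ 0) : SmoothFnNear E (fun y => (f y)⁻¹) x :=
  hf.comp_of_contDiffOn (φ := fun t => t⁻¹) isOpen_compl_singleton
    (fun _ ht => (contDiffAt_inv ℝ ht).contDiffWithinAt) hx

end SmoothFnNear

namespace SmoothNear

variable {σ τ : ∀ x, V x} {f : M → ℝ} {x : M}

lemma contMDiffAt (h : SmoothNear E F σ x) : ContMDiffAt 𝓘(ℝ, E) (𝓘(ℝ, E).prod 𝓘(ℝ, F)) ∞
    (fun z => TotalSpace.mk' F z (σ z)) x :=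
  h.self_of_nhds

lemma of_smoothSectionOn {U : Set M} (hU : IsOpen U) (h : SmoothSectionOn E F σ U) (hx : x ∈ U) :
    SmoothNear E F σ x := by
  filter_upwards [hU.mem_nhds hx] with y hy using ContMDiffOn.contMDiffAt h (hU.mem_nhds hy)

lemma of_section (s : Cₛ^∞⟮𝓘(ℝ, E); F, V⟯) : SmoothNear E F s x :=
  Eventually.of_forall s.contMDiff

lemma congr (h : SmoothNear E F σ x) (hτ : ∀ᶠ y in 𝓝 x, τ y = σ y) : SmoothNear E F τ x := by
  filter_upwards [h, hτ.eventually_nhds] with y hy hy'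
  refine hy.congr_of_eventuallyEq ?_
  filter_upwards [hy'] with z hz using by rw [hz]

variable [∀ x, AddCommGroup (V x)] [∀ x, Module ℝ (V x)] [VectorBundle ℝ F V]

lemma add (hσ : SmoothNear E F σ x) (hτ : SmoothNear E F τ x) : SmoothNear E F (σ + τ) x := by
  filter_upwards [hσ, hτ] with y h h' using h.add_section h'

lemma smul (hf : SmoothFnNear E f x) (hσ : SmoothNear E F σ x) :
    SmoothNear E F (fun y => f y • σ y) x := by
  filter_upwards [hf, hσ] with y h h' using h.smul_section h'

lemma zero : SmoothNear E F (fun y => (0 : V y)) x :=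
  Eventually.of_forall fun y => contMDiff_zeroSection ℝ V y

lemma sum {ι : Type*} (s : Finset ι) {σ : ι → ∀ x, V x} (h : ∀ i ∈ s, SmoothNear E F (σ i) x) :
    SmoothNear E F (fun y => ∑ i ∈ s, σ i y) x := by
  classical
  induction s using Finset.induction_on with
  | empty => simpa using zero
  | insert a s ha ih =>
    simp only [Finset.sum_insert ha]
    exact (h a (by simp)).add (ih fun i hi => h i (by simp [hi]))

end SmoothNear

lemma smoothSectionOn_of_smoothNear {σ : ∀ x, V x} {U : Set M} (h : ∀ x ∈ U, SmoothNear E F σ x) :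
    SmoothSectionOn E F σ U :=
  fun x hx => (h x hx).contMDiffAt.contMDiffWithinAt

/-! ### Directional derivatives -/

section DirDeriv

variable {X Y : ∀ x : M, TangentSpace 𝓘(ℝ, E) x} {f g : M → ℝ} {x : M}

lemma dirDeriv_congr (h : f =ᶠ[𝓝 x] g) : dirDeriv X f x = dirDeriv X g x := by
  unfold dirDeriv
  rw [mvfderiv, mvfderiv, h.mfderiv_eq, h.self_of_nhds]

lemma dirDeriv_const (c : ℝ) : dirDeriv X (fun _ => c) x = 0 :=
  DFunLike.congr_fun (mvfderiv_const (I := 𝓘(ℝ, E)) c (x := x)) (X x)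

lemma dirDeriv_add (hf : SmoothFnNear E f x) (hg : SmoothFnNear E g x) :
    dirDeriv X (fun y => f y + g y) x = dirDeriv X f x + dirDeriv X g x :=
  DFunLike.congr_fun (mvfderiv_add hf.mdifferentiableAt hg.mdifferentiableAt) (X x)

lemma dirDeriv_sub (hf : SmoothFnNear E f x) (hg : SmoothFnNear E g x) :
    dirDeriv X (fun y => f y - g y) x = dirDeriv X f x - dirDeriv X g x :=
  DFunLike.congr_fun (mvfderiv_sub hf.mdifferentiableAt hg.mdifferentiableAt) (X x)

lemma dirDeriv_mul (hf : SmoothFnNear E f x) (hg : SmoothFnNear E g x) :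
    dirDeriv X (fun y => f y * g y) x = f x * dirDeriv X g x + g x * dirDeriv X f x :=
  DFunLike.congr_fun (mvfderiv_mul hf.mdifferentiableAt hg.mdifferentiableAt) (X x)

lemma dirDeriv_sum {ι : Type*} (s : Finset ι) {f : ι → M → ℝ}
    (hf : ∀ i ∈ s, SmoothFnNear E (f i) x) :
    dirDeriv X (fun y => ∑ i ∈ s, f i y) x = ∑ i ∈ s, dirDeriv X (f i) x := by
  classical
  induction s using Finset.induction_on with
  | empty => simpa using dirDeriv_const 0
  | insert a s ha ih =>
    simp only [Finset.sum_insert ha]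
    rw [dirDeriv_add (hf a (by simp)) (.sum s fun i hi => hf i (by simp [hi])),
      ih fun i hi => hf i (by simp [hi])]

lemma dirDeriv_comp {φ : ℝ → ℝ} {φ' : ℝ} (hf : SmoothFnNear E f x) (hφ : HasDerivAt φ φ' (f x)) :
    dirDeriv X (fun y => φ (f y)) x = φ' * dirDeriv X f x := by
  have h := mvfderiv_comp_apply (I := 𝓘(ℝ, ℝ)) (I' := 𝓘(ℝ, E)) (g := φ) (f := f) x
    hφ.differentiableAt.mdifferentiableAt hf.mdifferentiableAt (X x)
  refine h.trans ?_
  rw [mvfderiv, mfderiv_eq_fderiv, hφ.hasFDerivAt.fderiv]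
  exact mul_comm _ _

lemma smoothFnNear_dirDeriv [IsManifold 𝓘(ℝ, E) ∞ M] (hf : SmoothFnNear E f x)
    (hX : SmoothNear E E X x) : SmoothFnNear E (dirDeriv X f) x := by
  filter_upwards [hf, hX] with y h h'
  -- The differential of `f` is a smooth family of maps of tangent spaces. It is applied to the
  -- field and the fibre component in the tangent bundle of `ℝ` is read off.
  have h1 := h.mfderiv_const (m := ∞) (by simp)
  have h2 := ContMDiffAt.clm_apply_of_inCoordinates (b₁ := fun z : M => z) (b₂ := f)
    (E₁ := fun z : M => TangentSpace 𝓘(ℝ, E) z) (E₂ := fun t : ℝ => TangentSpace 𝓘(ℝ, ℝ) t)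
    (ϕ := fun z => mfderiv 𝓘(ℝ, E) 𝓘(ℝ, ℝ) f z) h1 h' h
  exact (contMDiff_snd_tangentBundle_modelSpace ℝ 𝓘(ℝ, ℝ)).contMDiffAt.comp y h2

end DirDeriv

end Germs

/-! ### Local frames and coframes -/

section Frames

variable {E : Type*} [NormedAddCommGroup E] [NormedSpace ℝ E]
  {M : Type*} [TopologicalSpace M] [ChartedSpace E M]
  (F : Type*) [NormedAddCommGroup F] [NormedSpace ℝ F] [FiniteDimensional ℝ F]
  (V : M → Type*) [TopologicalSpace (TotalSpace F V)]
  [∀ x, AddCommGroup (V x)] [∀ x, Module ℝ (V x)]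
  [∀ x, TopologicalSpace (V x)] [FiberBundle F V] [VectorBundle ℝ F V]

/-- The local frame given by the preferred trivialization around `b`. -/
noncomputable def frameAt (b : M) (i : Fin (finrank ℝ F)) (y : M) : V y :=
  (trivializationAt F V b).localFrame (finBasis ℝ F) i y

/-- The coframe dual to `frameAt`. -/
noncomputable def coframeAt (b : M) (i : Fin (finrank ℝ F)) (y : M) : V y →ₗ[ℝ] ℝ :=
  (finBasis ℝ F).coord i ∘ₗ (trivializationAt F V b).linearMapAt ℝ y

variable {b x y : M}

lemma linearMapAt_frameAt (hy : y ∈ (trivializationAt F V b).baseSet) (i : Fin (finrank ℝ F)) :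
    (trivializationAt F V b).linearMapAt ℝ y (frameAt F V b i y) = finBasis ℝ F i := by
  rw [frameAt, Trivialization.localFrame_apply_of_mem_baseSet _ _ hy, Trivialization.basisAt,
    Basis.map_apply, Trivialization.coe_linearMapAt_of_mem (R := ℝ) _ hy]
  exact ((trivializationAt F V b).linearEquivAt ℝ y hy).apply_symm_apply _

lemma coframeAt_frameAt (hy : y ∈ (trivializationAt F V b).baseSet) (i j : Fin (finrank ℝ F)) :
    coframeAt F V b i y (frameAt F V b j y) = if j = i then 1 else 0 := by
  rw [coframeAt, LinearMap.comp_apply, linearMapAt_frameAt F V hy, Basis.coord_apply,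
    Basis.repr_self, Finsupp.single_apply]

lemma sum_coframeAt_smul_frameAt (hy : y ∈ (trivializationAt F V b).baseSet) (v : V y) :
    ∑ i, coframeAt F V b i y v • frameAt F V b i y = v := by
  have hinj : Function.Injective ((trivializationAt F V b).linearMapAt ℝ y) := by
    intro u w h
    rw [← Trivialization.symmₗ_linearMapAt (R := ℝ) _ hy u, h,
      Trivialization.symmₗ_linearMapAt (R := ℝ) _ hy w]
  apply hinj
  simp only [map_sum, map_smul, linearMapAt_frameAt F V hy]
  exact (finBasis ℝ F).sum_repr _

variable [ContMDiffVectorBundle ∞ F V 𝓘(ℝ, E)]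

lemma smoothNear_frameAt (hx : x ∈ (trivializationAt F V b).baseSet) (i : Fin (finrank ℝ F)) :
    SmoothNear E F (frameAt F V b i) x :=
  .of_smoothSectionOn (trivializationAt F V b).open_baseSet
    ((trivializationAt F V b).contMDiffOn_localFrame_baseSet ∞ (finBasis ℝ F) i) hx

variable {F V}

lemma SmoothNear.coframeAt {σ : ∀ x, V x} (h : SmoothNear E F σ x)
    (hx : x ∈ (trivializationAt F V b).baseSet) (i : Fin (finrank ℝ F)) :
    SmoothFnNear E (fun y => coframeAt F V b i y (σ y)) x := by
  have hb := (trivializationAt F V b).open_baseSet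
  filter_upwards [h, hb.mem_nhds hx] with y hy hyb
  refine ((((finBasis ℝ F).coord i).toContinuousLinearMap.contMDiff (n := ∞)).contMDiffAt.comp y
    (((trivializationAt F V b).contMDiffAt_section_iff hyb).1 hy)).congr_of_eventuallyEq ?_
  filter_upwards [hb.mem_nhds hyb] with z hz
  rw [_root_.coframeAt, LinearMap.comp_apply, Trivialization.coe_linearMapAt_of_mem _ hz]
  rfl

end Frames

/-! ### Derivations of sections and their traces -/

section Derivations

variable {E : Type*} [NormedAddCommGroup E] [NormedSpace ℝ E]
  {M : Type*} [TopologicalSpace M] [ChartedSpace E M]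
  (F : Type*) [NormedAddCommGroup F] [NormedSpace ℝ F]
  {V : M → Type*} [TopologicalSpace (TotalSpace F V)]
  [∀ x, AddCommGroup (V x)] [∀ x, Module ℝ (V x)]
  [∀ x, TopologicalSpace (V x)] [FiberBundle F V]

/-- `D` is an operator on germs of smooth sections with `D (f s) = X(f) s + f D s`. -/
structure IsDerivation (X : ∀ x : M, TangentSpace 𝓘(ℝ, E) x) (D : (∀ x, V x) → ∀ x, V x) :
    Prop where
  add : ∀ {σ τ : ∀ x, V x} {x : M}, SmoothNear E F σ x → SmoothNear E F τ x →
    D (σ + τ) x = D σ x + D τ x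
  leibniz : ∀ {f : M → ℝ} {σ : ∀ x, V x} {x : M}, SmoothFnNear E f x → SmoothNear E F σ x →
    D (fun y => f y • σ y) x = f x • D σ x + dirDeriv X f x • σ x

/-- `D` maps smooth germs of sections to smooth germs. -/
def PreservesSmooth (E : Type*) [NormedAddCommGroup E] [NormedSpace ℝ E] [ChartedSpace E M]
    (D : (∀ x, V x) → ∀ x, V x) : Prop :=
  ∀ {σ : ∀ x, V x} {x : M}, SmoothNear E F σ x → SmoothNear E F (D σ) x

variable {F} {X Y : ∀ x : M, TangentSpace 𝓘(ℝ, E) x} {D D₁ D₂ D₃ : (∀ x, V x) → ∀ x, V x}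

namespace IsDerivation

/-- Locality is forced by the Leibniz rule. Let `ψ` be the indicator function of the set where `τ =
σ`. Then `ψ τ = ψ σ` everywhere, while `ψ` is `1` near `x`. No bump function is needed, since `D`
accepts arbitrary sections and the rule asks for smoothness near `x` only. -/
lemma congr (hD : IsDerivation F X D) {σ τ : ∀ x, V x} {x : M} (hσ : SmoothNear E F σ x)
    (h : ∀ᶠ y in 𝓝 x, τ y = σ y) : D τ x = D σ x := by
  classical
  let ψ (y : M) : ℝ := if τ y = σ y then 1 else 0
  have hψ1 : ψ =ᶠ[𝓝 x] fun _ => 1 := by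
    filter_upwards [h] with y hy using by simp [ψ, hy]
  have hψ : SmoothFnNear E ψ x := (SmoothFnNear.const 1).congr hψ1
  have hψx : ψ x = 1 := hψ1.self_of_nhds
  have hd : dirDeriv X ψ x = 0 := by rw [dirDeriv_congr hψ1, dirDeriv_const]
  have heq : (fun y => ψ y • τ y) = fun y => ψ y • σ y := by
    funext y
    by_cases hy : τ y = σ y <;> simp [ψ, hy]
  have h1 := hD.leibniz hψ (hσ.congr h)
  have h2 := hD.leibniz hψ hσ
  rw [heq, h2, hψx, hd] at h1
  simpa using h1.symm

variable [VectorBundle ℝ F V]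

lemma zero (hD : IsDerivation F X D) (x : M) : D (fun _ => 0) x = 0 := by
  have h := hD.leibniz (SmoothFnNear.const (x := x) 0) (SmoothNear.zero (E := E) (F := F) (V := V))
  simpa [dirDeriv_const] using h

lemma sum (hD : IsDerivation F X D) {ι : Type*} (s : Finset ι) {σ : ι → ∀ x, V x} {x : M}
    (h : ∀ i ∈ s, SmoothNear E F (σ i) x) :
    D (fun y => ∑ i ∈ s, σ i y) x = ∑ i ∈ s, D (σ i) x := by
  classical
  induction s using Finset.induction_on with
  | empty => simpa using hD.zero x
  | insert a s ha ih =>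
    simp only [Finset.sum_insert ha]
    rw [← ih fun i hi => h i (by simp [hi])]
    exact hD.add (h a (by simp)) (.sum s fun i hi => h i (by simp [hi]))

variable [FiniteDimensional ℝ F] [ContMDiffVectorBundle ∞ F V 𝓘(ℝ, E)]

/-- By locality a section may be replaced by its expansion in a frame, so a derivation is determined
by its values on that frame. -/
lemma eq_sum_frameAt (hD : IsDerivation F X D) {σ : ∀ x, V x} {b x : M}
    (hx : x ∈ (trivializationAt F V b).baseSet) (hσ : SmoothNear E F σ x) :
    D σ x = ∑ i, (coframeAt F V b i x (σ x) • D (frameAt F V b i) x +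
      dirDeriv X (fun y => coframeAt F V b i y (σ y)) x • frameAt F V b i x) := by
  have h1 : ∀ i, SmoothFnNear E (fun y => coframeAt F V b i y (σ y)) x := hσ.coframeAt hx
  have h2 : ∀ i, SmoothNear E F (frameAt F V b i) x := smoothNear_frameAt F V hx
  have h3 : ∀ᶠ y in 𝓝 x, σ y = ∑ i, coframeAt F V b i y (σ y) • frameAt F V b i y := by
    filter_upwards [(trivializationAt F V b).open_baseSet.mem_nhds hx] with y hy
    exact (sum_coframeAt_smul_frameAt F V hy _).symm
  rw [hD.congr (.sum _ fun i _ => .smul (h1 i) (h2 i)) h3,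
    hD.sum _ fun i _ => .smul (h1 i) (h2 i)]
  exact Finset.sum_congr rfl fun i _ => hD.leibniz (h1 i) (h2 i)

end IsDerivation

variable [FiniteDimensional ℝ F] [VectorBundle ℝ F V]

variable (F) in
/-- The trace of the operator `D` with respect to the local frame around `b`. -/
noncomputable def frameTrace (D : (∀ x, V x) → ∀ x, V x) (b x : M) : ℝ :=
  ∑ i, coframeAt F V b i x (D (frameAt F V b i) x)

variable [ContMDiffVectorBundle ∞ F V 𝓘(ℝ, E)] {b b' x : M}

lemma smoothFnNear_frameTrace (hD : PreservesSmooth F E D)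
    (hx : x ∈ (trivializationAt F V b).baseSet) : SmoothFnNear E (frameTrace F D b) x :=
  .sum _ fun i _ => (hD (smoothNear_frameAt F V hx i)).coframeAt hx i

/-- The dependence of the trace on the frame. -/
lemma IsDerivation.frameTrace_change (hD : IsDerivation F X D)
    (hx : x ∈ (trivializationAt F V b).baseSet) (hx' : x ∈ (trivializationAt F V b').baseSet) :
    frameTrace F D b' x = frameTrace F D b x +
      ∑ j, ∑ i, dirDeriv X (fun y => coframeAt F V b i y (frameAt F V b' j y)) x *
        coframeAt F V b' j x (frameAt F V b i x) := by
  -- Expanding the frame of `b'` in that of `b` gives the matrix of `D` conjugated by the transition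
  -- matrix, whose trace is unchanged (`h2`), plus the trace of the derivative of the transition
  -- matrix times its inverse.
  have h1 : ∀ j, coframeAt F V b' j x (D (frameAt F V b' j) x) =
      (∑ i, coframeAt F V b i x (frameAt F V b' j x) *
        coframeAt F V b' j x (D (frameAt F V b i) x)) +
      ∑ i, dirDeriv X (fun y => coframeAt F V b i y (frameAt F V b' j y)) x *
        coframeAt F V b' j x (frameAt F V b i x) := fun j => by
    rw [hD.eq_sum_frameAt hx (smoothNear_frameAt F V hx' j), map_sum, ← Finset.sum_add_distrib]
    simp
  have h2 : ∀ i, ∑ j, coframeAt F V b i x (frameAt F V b' j x) *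
      coframeAt F V b' j x (D (frameAt F V b i) x) =
      coframeAt F V b i x (D (frameAt F V b i) x) := fun i => by
    conv_rhs => rw [← sum_coframeAt_smul_frameAt F V hx' (D (frameAt F V b i) x)]
    simp [mul_comm]
  unfold frameTrace
  rw [Finset.sum_congr rfl fun j _ => h1 j, Finset.sum_add_distrib, Finset.sum_comm,
    Finset.sum_congr rfl fun i _ => h2 i]

/-- The trace of a commutator of derivations. -/
lemma frameTrace_commutator (h₁ : IsDerivation F X D₁) (h₂ : IsDerivation F Y D₂)
    (s₁ : PreservesSmooth F E D₁) (s₂ : PreservesSmooth F E D₂)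
    (h₃ : ∀ {σ : ∀ x, V x} {x : M}, SmoothNear E F σ x → D₃ σ x = D₁ (D₂ σ) x - D₂ (D₁ σ) x)
    (hx : x ∈ (trivializationAt F V b).baseSet) :
    frameTrace F D₃ b x =
      dirDeriv X (frameTrace F D₂ b) x - dirDeriv Y (frameTrace F D₁ b) x := by
  have hs : ∀ i, SmoothNear E F (frameAt F V b i) x := smoothNear_frameAt F V hx
  -- The trace of `D₁ D₂` is the trace of a product of two matrices plus `X` applied to the trace of
  -- `D₂`. The product term is symmetric in the two operators and drops out of the commutator.
  have key : ∀ {X : ∀ x : M, TangentSpace 𝓘(ℝ, E) x} {D₁ D₂ : (∀ x, V x) → ∀ x, V x},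
      IsDerivation F X D₁ → PreservesSmooth F E D₂ →
      ∑ j, coframeAt F V b j x (D₁ (D₂ (frameAt F V b j)) x) =
        (∑ j, ∑ i, coframeAt F V b i x (D₂ (frameAt F V b j) x) *
          coframeAt F V b j x (D₁ (frameAt F V b i) x)) + dirDeriv X (frameTrace F D₂ b) x := by
    intro X D₁ D₂ h₁ s₂
    have e : dirDeriv X (frameTrace F D₂ b) x =
        ∑ j, dirDeriv X (fun y => coframeAt F V b j y (D₂ (frameAt F V b j) y)) x :=
      dirDeriv_sum _ fun j _ => (s₂ (hs j)).coframeAt hx j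
    rw [e, ← Finset.sum_add_distrib]
    refine Finset.sum_congr rfl fun j _ => ?_
    rw [h₁.eq_sum_frameAt hx (s₂ (hs j)), map_sum]
    simp [Finset.sum_add_distrib, coframeAt_frameAt F V hx]
  have e₃ : frameTrace F D₃ b x = ∑ j, coframeAt F V b j x (D₁ (D₂ (frameAt F V b j)) x) -
      ∑ j, coframeAt F V b j x (D₂ (D₁ (frameAt F V b j)) x) := by
    rw [← Finset.sum_sub_distrib]
    exact Finset.sum_congr rfl fun j _ => by rw [h₃ (hs j), map_sub]
  rw [e₃, key h₁ s₂, key h₂ s₁, Finset.sum_comm]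
  simp only [mul_comm]
  ring

end Derivations

/-! ### Extension of germs -/

section Extension

variable {E : Type*} [NormedAddCommGroup E] [NormedSpace ℝ E] [FiniteDimensional ℝ E]
  {M : Type*} [TopologicalSpace M] [ChartedSpace E M] [IsManifold 𝓘(ℝ, E) ∞ M] [T2Space M]

lemma exists_smooth_bump {x : M} {U : Set M} (hU : U ∈ 𝓝 x) :
    ∃ f : C^∞⟮𝓘(ℝ, E), M; 𝓘(ℝ, ℝ), ℝ⟯, tsupport f ⊆ U ∧ ∀ᶠ y in 𝓝 x, f y = 1 := by
  obtain ⟨f, -, hf⟩ := (SmoothBumpFunction.nhds_basis_tsupport (I := 𝓘(ℝ, E)) x).mem_iff.1 hU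
  exact ⟨⟨f, f.contMDiff⟩, hf, f.eventuallyEq_one⟩

variable {F : Type*} [NormedAddCommGroup F] [NormedSpace ℝ F]
  {V : M → Type*} [TopologicalSpace (TotalSpace F V)]
  [∀ x, AddCommGroup (V x)] [∀ x, Module ℝ (V x)]
  [∀ x, TopologicalSpace (V x)] [FiberBundle F V] [VectorBundle ℝ F V]

/-- The germ is cut off by a bump function supported where it is smooth. This lets the bracket,
which is given on global sections, act on local frames. -/
lemma SmoothNear.exists_section {σ : ∀ x, V x} {x : M} (h : SmoothNear E F σ x) :
    ∃ s : Cₛ^∞⟮𝓘(ℝ, E); F, V⟯, ∀ᶠ y in 𝓝 x, s y = σ y := by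
  obtain ⟨U, hU, hUo, hxU⟩ := eventually_nhds_iff.1 h
  obtain ⟨f, hf, hf1⟩ := exists_smooth_bump (E := E) (hUo.mem_nhds hxU)
  refine ⟨⟨_, ContMDiffOn.smul_section_of_tsupport f.contMDiff.contMDiffOn hUo hf
    fun y hy => (hU y hy).contMDiffWithinAt⟩, ?_⟩
  filter_upwards [hf1] with y hy
  change f y • σ y = σ y
  rw [hy, one_smul]

lemma SmoothFnNear.exists_contMDiff {f : M → ℝ} {x : M} (h : SmoothFnNear E f x) :
    ∃ g : C^∞⟮𝓘(ℝ, E), M; 𝓘(ℝ, ℝ), ℝ⟯, ∀ᶠ y in 𝓝 x, g y = f y := by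
  obtain ⟨U, hU, hUo, hxU⟩ := eventually_nhds_iff.1 h
  obtain ⟨f', hf, hf1⟩ := exists_smooth_bump (E := E) (hUo.mem_nhds hxU)
  have hs : ContMDiff 𝓘(ℝ, E) 𝓘(ℝ, ℝ) ∞ fun y => f' y • f y := by
    refine contMDiff_of_tsupport fun y hy => ?_
    exact f'.contMDiff.contMDiffAt.smul (hU y (hf (tsupport_smul_subset_left f' f hy)))
  refine ⟨⟨_, hs⟩, ?_⟩
  filter_upwards [hf1] with y hy
  change f' y • f y = f y
  rw [hy, one_smul]

end Extension

/-! ### The Lie derivatives on `A`, `TM` and `A*` -/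

namespace LieAlgebroid

section Derivatives

variable {E : Type*} [NormedAddCommGroup E] [NormedSpace ℝ E]
  {M : Type*} [TopologicalSpace M] [ChartedSpace E M] [IsManifold 𝓘(ℝ, E) ∞ M]
  {F : Type*} [NormedAddCommGroup F] [NormedSpace ℝ F]
  {A : M → Type*} [TopologicalSpace (TotalSpace F A)] [∀ x, AddCommGroup (A x)]
  [∀ x, Module ℝ (A x)] [∀ x, TopologicalSpace (A x)] [FiberBundle F A] [VectorBundle ℝ F A]
  (𝔸 : LieAlgebroid E F A)

lemma smoothNear_rho (α : Cₛ^∞⟮𝓘(ℝ, E); F, A⟯) (x : M) : SmoothNear E E (𝔸.rho α) x :=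
  Eventually.of_forall <| ContMDiff.clm_bundle_apply (b := fun y : M => y)
    (ϕ := fun y => 𝔸.anchor y) (v := fun y => α y) 𝔸.anchor.contMDiff α.contMDiff

lemma rho_bracket (α β : Cₛ^∞⟮𝓘(ℝ, E); F, A⟯) : 𝔸.rho (𝔸.bracket α β) =
    VectorField.mlieBracket 𝓘(ℝ, E) (𝔸.rho α) (𝔸.rho β) :=
  funext fun x => 𝔸.anchor_bracket α β x

lemma rho_smulSection (f : C^∞⟮𝓘(ℝ, E), M; 𝓘(ℝ, ℝ), ℝ⟯) (α : Cₛ^∞⟮𝓘(ℝ, E); F, A⟯) :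
    𝔸.rho (smulSection f α) = fun x => f x • 𝔸.rho α x :=
  funext fun x => map_smul (𝔸.anchor x) (f x) (α x)

lemma rho_add (α β : Cₛ^∞⟮𝓘(ℝ, E); F, A⟯) : 𝔸.rho (α + β) = 𝔸.rho α + 𝔸.rho β :=
  funext fun x => map_add (𝔸.anchor x) (α x) (β x)

lemma bracket_zero (α : Cₛ^∞⟮𝓘(ℝ, E); F, A⟯) : 𝔸.bracket α 0 = 0 := by
  have h := 𝔸.bracket_add α 0 0
  simpa using h

lemma bracket_sub (α β γ : Cₛ^∞⟮𝓘(ℝ, E); F, A⟯) :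
    𝔸.bracket α (β - γ) = 𝔸.bracket α β - 𝔸.bracket α γ := by
  rw [eq_sub_iff_add_eq, ← 𝔸.bracket_add, sub_add_cancel]

lemma bracket_skew (α β : Cₛ^∞⟮𝓘(ℝ, E); F, A⟯) : 𝔸.bracket α β = -𝔸.bracket β α := by
  have h := 𝔸.bracket_self (α + β)
  rw [𝔸.add_bracket, 𝔸.bracket_add, 𝔸.bracket_add, 𝔸.bracket_self, 𝔸.bracket_self, zero_add,
    add_zero] at h
  exact eq_neg_of_add_eq_zero_left h

lemma smulSection_bracket (f : C^∞⟮𝓘(ℝ, E), M; 𝓘(ℝ, ℝ), ℝ⟯) (α β : Cₛ^∞⟮𝓘(ℝ, E); F, A⟯) (x : M) :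
    𝔸.bracket (smulSection f α) β x =
      f x • 𝔸.bracket α β x - dirDeriv (𝔸.rho β) f x • α x := by
  rw [𝔸.bracket_skew, 𝔸.bracket_skew α β]
  change -(𝔸.bracket β (smulSection f α) x) = f x • -(𝔸.bracket β α x) - _
  rw [𝔸.leibniz, smul_neg, neg_add, ← sub_eq_add_neg]
  rfl

variable [FiniteDimensional ℝ E] [T2Space M]

/-- For a bump function `f` supported where `β = γ`, the section `f (β - γ)` is zero. The Leibniz
rule at `x`, where `f` is `1` and `β - γ` vanishes, leaves `[α, β - γ](x) = 0`. -/
lemma bracket_congr_right {α β γ : Cₛ^∞⟮𝓘(ℝ, E); F, A⟯} {x : M} (h : ∀ᶠ y in 𝓝 x, β y = γ y) :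
    𝔸.bracket α β x = 𝔸.bracket α γ x := by
  obtain ⟨f, hf, hf1⟩ := exists_smooth_bump (E := E) h
  have h0 : smulSection f (β - γ) = 0 := by
    ext y
    change f y • (β y - γ y) = 0
    by_cases hy : y ∈ tsupport f
    · rw [show β y = γ y from hf hy, sub_self, smul_zero]
    · rw [image_eq_zero_of_notMem_tsupport hy, zero_smul]
  have h1 := 𝔸.leibniz f α (β - γ) x
  have h2 : (β - γ : Cₛ^∞⟮𝓘(ℝ, E); F, A⟯) x = 0 := sub_eq_zero.2 h.self_of_nhds
  rw [h0, 𝔸.bracket_zero, h2, smul_zero, add_zero, hf1.self_of_nhds, one_smul,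
    𝔸.bracket_sub] at h1
  exact (sub_eq_zero.1 h1.symm)

lemma localBracket_eq {α β : Cₛ^∞⟮𝓘(ℝ, E); F, A⟯} {s : ∀ x, A x} {x : M}
    (h : ∀ᶠ y in 𝓝 x, β y = s y) : 𝔸.localBracket α s x = 𝔸.bracket α β x := by
  have hex : ∃ β : Cₛ^∞⟮𝓘(ℝ, E); F, A⟯, ∀ᶠ y in 𝓝 x, β y = s y := ⟨β, h⟩
  unfold localBracket
  rw [dif_pos hex]
  refine 𝔸.bracket_congr_right ?_
  filter_upwards [h, hex.choose_spec] with y h1 h2 using h2.trans h1.symm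

lemma eventually_localBracket_eq {α β : Cₛ^∞⟮𝓘(ℝ, E); F, A⟯} {s : ∀ x, A x} {x : M}
    (h : ∀ᶠ y in 𝓝 x, β y = s y) : ∀ᶠ y in 𝓝 x, 𝔸.bracket α β y = 𝔸.localBracket α s y := by
  filter_upwards [h.eventually_nhds] with y hy using (𝔸.localBracket_eq hy).symm

lemma isDerivation_localBracket (α : Cₛ^∞⟮𝓘(ℝ, E); F, A⟯) :
    IsDerivation (F := F) (𝔸.rho α) (𝔸.localBracket α) where
  add {σ τ x} hσ hτ := by
    obtain ⟨s, hs⟩ := hσ.exists_section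
    obtain ⟨t, ht⟩ := hτ.exists_section
    have hst : ∀ᶠ y in 𝓝 x, (s + t) y = (σ + τ) y := by
      filter_upwards [hs, ht] with y h h' using congrArg₂ (· + ·) h h'
    rw [𝔸.localBracket_eq hst, 𝔸.localBracket_eq hs, 𝔸.localBracket_eq ht, 𝔸.bracket_add]
    rfl
  leibniz {f σ x} hf hσ := by
    obtain ⟨s, hs⟩ := hσ.exists_section
    obtain ⟨g, hg⟩ := hf.exists_contMDiff
    have hst : ∀ᶠ y in 𝓝 x, smulSection g s y = f y • σ y := by
      filter_upwards [hs, hg] with y h h' using congrArg₂ (· • ·) h' h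
    rw [𝔸.localBracket_eq hst, 𝔸.localBracket_eq hs, 𝔸.leibniz, hs.self_of_nhds, hg.self_of_nhds]
    exact congrArg (_ + · • _) (dirDeriv_congr hg)

lemma preservesSmooth_localBracket (α : Cₛ^∞⟮𝓘(ℝ, E); F, A⟯) :
    PreservesSmooth F E (𝔸.localBracket α) := fun {σ x} hσ => by
  obtain ⟨s, hs⟩ := hσ.exists_section
  refine (SmoothNear.of_section (𝔸.bracket α s)).congr ?_
  filter_upwards [𝔸.eventually_localBracket_eq hs] with y hy using hy.symm

lemma localBracket_bracket (α β : Cₛ^∞⟮𝓘(ℝ, E); F, A⟯) {σ : ∀ x, A x} {x : M}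
    (hσ : SmoothNear E F σ x) : 𝔸.localBracket (𝔸.bracket α β) σ x =
      𝔸.localBracket α (𝔸.localBracket β σ) x - 𝔸.localBracket β (𝔸.localBracket α σ) x := by
  obtain ⟨s, hs⟩ := hσ.exists_section
  rw [𝔸.localBracket_eq hs, 𝔸.localBracket_eq (𝔸.eventually_localBracket_eq hs),
    𝔸.localBracket_eq (𝔸.eventually_localBracket_eq hs), 𝔸.jacobi α β s]
  exact (add_sub_cancel_right _ _).symm

lemma localBracket_add_left (α β : Cₛ^∞⟮𝓘(ℝ, E); F, A⟯) {σ : ∀ x, A x} {x : M}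
    (hσ : SmoothNear E F σ x) :
    𝔸.localBracket (α + β) σ x = 𝔸.localBracket α σ x + 𝔸.localBracket β σ x := by
  obtain ⟨s, hs⟩ := hσ.exists_section
  rw [𝔸.localBracket_eq hs, 𝔸.localBracket_eq hs, 𝔸.localBracket_eq hs, 𝔸.add_bracket]
  rfl

lemma localBracket_smul_left (f : C^∞⟮𝓘(ℝ, E), M; 𝓘(ℝ, ℝ), ℝ⟯) (α : Cₛ^∞⟮𝓘(ℝ, E); F, A⟯)
    {σ : ∀ x, A x} {x : M} (hσ : SmoothNear E F σ x) :
    𝔸.localBracket (smulSection f α) σ x =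
      f x • 𝔸.localBracket α σ x - mvfderiv 𝓘(ℝ, E) f x (𝔸.anchor x (σ x)) • α x := by
  obtain ⟨s, hs⟩ := hσ.exists_section
  rw [𝔸.localBracket_eq hs, 𝔸.localBracket_eq hs, 𝔸.smulSection_bracket, ← hs.self_of_nhds]
  rfl

end Derivatives

end LieAlgebroid

/-! ### Lie brackets of vector fields as derivations. -/

section VectorFields

lemma minSmoothness_le_infty (k : ℕ∞) : minSmoothness ℝ (k : ℕ∞ω) ≤ ∞ := by
  rw [minSmoothness_of_isRCLikeNormedField]
  exact_mod_cast le_top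

variable {E : Type*} [NormedAddCommGroup E] [NormedSpace ℝ E]
  {M : Type*} [TopologicalSpace M] [ChartedSpace E M] [IsManifold 𝓘(ℝ, E) ∞ M]
  {X Y : ∀ x : M, TangentSpace 𝓘(ℝ, E) x}

lemma SmoothNear.mdifferentiableAt {x : M} (hX : SmoothNear E E X x) :
    MDifferentiableAt 𝓘(ℝ, E) 𝓘(ℝ, E).tangent
      (fun y => (⟨y, X y⟩ : TangentBundle 𝓘(ℝ, E) M)) x :=
  ContMDiffAt.mdifferentiableAt (n := ∞) hX.contMDiffAt (by simp)

variable [FiniteDimensional ℝ E]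

lemma isDerivation_mlieBracket : IsDerivation (F := E) X
    (VectorField.mlieBracket 𝓘(ℝ, E) X) where
  add hσ hτ := VectorField.mlieBracket_add_right hσ.mdifferentiableAt hτ.mdifferentiableAt
  leibniz hf hσ := (VectorField.mlieBracket_smul_right hf.mdifferentiableAt
    hσ.mdifferentiableAt).trans (add_comm _ _)

lemma preservesSmooth_mlieBracket (hX : ∀ x, SmoothNear E E X x) :
    PreservesSmooth E E (VectorField.mlieBracket 𝓘(ℝ, E) X) := fun {σ x} hσ => by
  have := IsManifold.of_le (I := 𝓘(ℝ, E)) (M := M) (m := minSmoothness ℝ 2) (n := ∞)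
    (minSmoothness_le_infty 2)
  -- The bracket costs one derivative, which is harmless because `∞ + 1` is `∞`.
  have : IsManifold 𝓘(ℝ, E) ((⊤ : ℕ∞) + 1) M := ‹IsManifold 𝓘(ℝ, E) ∞ M›
  filter_upwards [hσ] with y hy
  exact ContMDiffAt.mlieBracket_vectorField (m := ⊤) (n := ⊤) (hX y).contMDiffAt hy (minSmoothness_le_infty ⊤)

lemma mlieBracket_mlieBracket (hX : ∀ x, SmoothNear E E X x) (hY : ∀ x, SmoothNear E E Y x)
    {σ : ∀ x : M, TangentSpace 𝓘(ℝ, E) x} {x : M} (hσ : SmoothNear E E σ x) :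
    VectorField.mlieBracket 𝓘(ℝ, E) (VectorField.mlieBracket 𝓘(ℝ, E) X Y) σ x =
      VectorField.mlieBracket 𝓘(ℝ, E) X (VectorField.mlieBracket 𝓘(ℝ, E) Y σ) x -
      VectorField.mlieBracket 𝓘(ℝ, E) Y (VectorField.mlieBracket 𝓘(ℝ, E) X σ) x := by
  have h2 := minSmoothness_le_infty 2
  have := IsManifold.of_le (I := 𝓘(ℝ, E)) (M := M) (m := minSmoothness ℝ 3) (n := ∞)
    (minSmoothness_le_infty 3)
  rw [VectorField.leibniz_identity_mlieBracket_apply ((hX x).contMDiffAt.of_le h2)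
    ((hY x).contMDiffAt.of_le h2) (hσ.contMDiffAt.of_le h2), add_sub_cancel_right]

end VectorFields

/-! ### The dual bundle -/

section Dual

variable {E : Type*} [NormedAddCommGroup E] [NormedSpace ℝ E]
  {M : Type*} [TopologicalSpace M] [ChartedSpace E M]
  (F : Type*) [NormedAddCommGroup F] [NormedSpace ℝ F]
  (A : M → Type*) [TopologicalSpace (TotalSpace F A)] [∀ x, AddCommGroup (A x)]
  [∀ x, Module ℝ (A x)] [∀ x, TopologicalSpace (A x)] [FiberBundle F A] [VectorBundle ℝ F A]

variable {b x : M}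

lemma baseSet_dualBundle (b : M) :
    (trivializationAt (F →L[ℝ] ℝ) (DualBundle A) b).baseSet = (trivializationAt F A b).baseSet := by
  rw [hom_trivializationAt_baseSet]
  exact inter_univ _

/-- The trivialization of a hom bundle conjugates by those of source and target, and the target here
is the trivial bundle. What remains is precomposition with the inverse trivialization of `A`. -/
lemma linearMapAt_dualBundle (hx : x ∈ (trivializationAt F A b).baseSet) (ψ : DualBundle A x)
    (w : F) : (trivializationAt (F →L[ℝ] ℝ) (DualBundle A) b).linearMapAt ℝ x ψ w =
      (ψ ((trivializationAt F A b).symm x w) : ℝ) := by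
  have hx' := hx
  rw [← baseSet_dualBundle] at hx'
  rw [Trivialization.coe_linearMapAt_of_mem (R := ℝ) _ hx']
  beta_reduce
  rw [hom_trivializationAt_apply]
  change (trivializationAt ℝ (Bundle.Trivial M ℝ) b).continuousLinearMapAt ℝ x
    (ψ ((trivializationAt F A b).symmL ℝ x w)) = _
  rw [Trivialization.continuousLinearMapAt_apply, Trivialization.coe_linearMapAt_of_mem (R := ℝ) _
    (show x ∈ (trivializationAt ℝ (Bundle.Trivial M ℝ) b).baseSet from mem_univ x)]
  change (ψ ((trivializationAt F A b).symmL ℝ x w) : ℝ) = _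
  rw [Trivialization.symmL_apply (R := ℝ) _ hx]

variable {A F}

lemma SmoothNear.pairing {φ : ∀ x, DualBundle A x} {s : ∀ x, A x}
    (hφ : SmoothNear E (F →L[ℝ] ℝ) φ x) (hs : SmoothNear E F s x) :
    SmoothFnNear E (fun y => (φ y (s y) : ℝ)) x := by
  filter_upwards [hφ, hs] with y h h'
  exact (contMDiffAt_section y).1
    (ContMDiffAt.clm_bundle_apply (b := fun y : M => y) (ϕ := φ) (v := s) h h')

/-- Both sums are the trace of `T`. This is needed because `frameTrace` on `A*` uses `finBasis` of
the dual space, which need not be the dual basis of `finBasis ℝ F`. -/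
lemma sum_coord_eq_of_bases {G : Type*} [AddCommGroup G] [Module ℝ G]
    {κ : Type*} [Fintype κ] (B : Basis κ ℝ G) {κ' : Type*} [Fintype κ'] (B' : Basis κ' ℝ G)
    (T : G →ₗ[ℝ] G) : ∑ k, B.coord k (T (B k)) = ∑ k, B'.coord k (T (B' k)) := by
  classical
  have h1 := LinearMap.trace_eq_matrix_trace ℝ B T
  have h2 := LinearMap.trace_eq_matrix_trace ℝ B' T
  simp only [Matrix.trace, Matrix.diag, LinearMap.toMatrix_apply] at h1 h2
  exact h1.symm.trans h2

end Dual

namespace LieAlgebroid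

section LieDual

variable {E : Type*} [NormedAddCommGroup E] [NormedSpace ℝ E]
  {M : Type*} [TopologicalSpace M] [ChartedSpace E M] [IsManifold 𝓘(ℝ, E) ∞ M]
  {F : Type*} [NormedAddCommGroup F] [NormedSpace ℝ F] [FiniteDimensional ℝ F]
  {A : M → Type*} [TopologicalSpace (TotalSpace F A)] [∀ x, AddCommGroup (A x)]
  [∀ x, Module ℝ (A x)] [∀ x, TopologicalSpace (A x)] [FiberBundle F A] [VectorBundle ℝ F A]
  (𝔸 : LieAlgebroid E F A) {α : Cₛ^∞⟮𝓘(ℝ, E); F, A⟯}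

lemma lieDual_apply_eq_sum (φ : ∀ x, DualBundle A x) (x : M) (v : A x) :
    (𝔸.lieDual α φ x v : ℝ) = ∑ i, (dirDeriv (𝔸.rho α) (fun y => (φ y (frameAt F A x i y) : ℝ)) x -
      (φ x (𝔸.localBracket α (frameAt F A x i) x) : ℝ)) * coframeAt F A x i x v := by
  unfold lieDual
  refine (_root_.sum_apply _ _ v).trans ?_
  rfl

variable [ContMDiffVectorBundle ∞ F A 𝓘(ℝ, E)]

/-- At `x` the operator is written in a fixed frame of `A`, and its bracket term is linear over
functions in `φ`. Both rules therefore follow coefficient by coefficient from those for `dirDeriv`.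
-/
lemma isDerivation_lieDual (α : Cₛ^∞⟮𝓘(ℝ, E); F, A⟯) :
    IsDerivation (F := F →L[ℝ] ℝ) (𝔸.rho α) (𝔸.lieDual α) where
  add {φ ψ x} hφ hψ := by
    have hx : x ∈ (trivializationAt F A x).baseSet :=
      FiberBundle.mem_baseSet_trivializationAt F A x
    refine ContinuousLinearMap.ext fun v => ?_
    refine Eq.trans ?_ (_root_.add_apply _ _ v).symm
    refine (𝔸.lieDual_apply_eq_sum _ x v).trans ?_
    refine Eq.trans ?_ (congrArg₂ (· + ·) (𝔸.lieDual_apply_eq_sum φ x v)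
      (𝔸.lieDual_apply_eq_sum ψ x v)).symm
    rw [← Finset.sum_add_distrib]
    refine Finset.sum_congr rfl fun i _ => ?_
    have h := dirDeriv_add (X := 𝔸.rho α) (hφ.pairing (smoothNear_frameAt F A hx i))
      (hψ.pairing (smoothNear_frameAt F A hx i))
    have h' : dirDeriv (𝔸.rho α) (fun y => ((φ + ψ) y (frameAt F A x i y) : ℝ)) x = _ := h
    have h2 : ((φ + ψ) x (𝔸.localBracket α (frameAt F A x i) x) : ℝ) =
      φ x (𝔸.localBracket α (frameAt F A x i) x) +
      ψ x (𝔸.localBracket α (frameAt F A x i) x) := rfl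
    rw [h', h2]
    ring
  leibniz {f φ x} hf hφ := by
    have hx : x ∈ (trivializationAt F A x).baseSet :=
      FiberBundle.mem_baseSet_trivializationAt F A x
    refine ContinuousLinearMap.ext fun v => ?_
    have e0 : (φ x v : ℝ) = ∑ i, (φ x (frameAt F A x i x) : ℝ) * coframeAt F A x i x v := by
      conv_lhs => rw [← sum_coframeAt_smul_frameAt F A hx v]
      refine (map_sum (φ x) _ _).trans (Finset.sum_congr rfl fun i _ => ?_)
      exact (map_smul (φ x) _ _).trans (mul_comm _ _)
    have e1 : ((f x • 𝔸.lieDual α φ x + dirDeriv (𝔸.rho α) f x • φ x) v : ℝ) =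
      f x * (𝔸.lieDual α φ x v : ℝ) + dirDeriv (𝔸.rho α) f x * (φ x v : ℝ) := rfl
    refine (𝔸.lieDual_apply_eq_sum _ x v).trans (Eq.trans ?_ e1.symm)
    rw [𝔸.lieDual_apply_eq_sum φ x v, e0, Finset.mul_sum, Finset.mul_sum,
      ← Finset.sum_add_distrib]
    refine Finset.sum_congr rfl fun i _ => ?_
    have h := dirDeriv_mul (X := 𝔸.rho α) hf (hφ.pairing (smoothNear_frameAt F A hx i))
    have h' : dirDeriv (𝔸.rho α) (fun y => ((f y • φ y) (frameAt F A x i y) : ℝ)) x = _ := h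
    have h2 : ((f x • φ x) (𝔸.localBracket α (frameAt F A x i) x) : ℝ) =
      f x * φ x (𝔸.localBracket α (frameAt F A x i) x) := rfl
    rw [h', h2]
    ring

variable [FiniteDimensional ℝ E] [T2Space M]

/-- `(L_α φ)(s) = ρ(α)(φ(s)) - φ([α, s])`. -/
lemma lieDual_apply {φ : ∀ x, DualBundle A x} {s : ∀ x, A x} {x : M}
    (hφ : SmoothNear E (F →L[ℝ] ℝ) φ x) (hs : SmoothNear E F s x) :
    (𝔸.lieDual α φ x (s x) : ℝ) = dirDeriv (𝔸.rho α) (fun y => (φ y (s y) : ℝ)) x -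
      (φ x (𝔸.localBracket α s x) : ℝ) := by
  have hx : x ∈ (trivializationAt F A x).baseSet :=
    FiberBundle.mem_baseSet_trivializationAt F A x
  have h1 : ∀ i, SmoothFnNear E (fun y => coframeAt F A x i y (s y)) x := hs.coframeAt hx
  have h2 : ∀ i, SmoothFnNear E (fun y => (φ y (frameAt F A x i y) : ℝ)) x := fun i =>
    hφ.pairing (smoothNear_frameAt F A hx i)
  have h3 : (fun y => (φ y (s y) : ℝ)) =ᶠ[𝓝 x]
      fun y => ∑ i, coframeAt F A x i y (s y) * (φ y (frameAt F A x i y) : ℝ) := by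
    filter_upwards [(trivializationAt F A x).open_baseSet.mem_nhds hx] with y hy
    conv_lhs => rw [← sum_coframeAt_smul_frameAt F A hy (s y)]
    refine (map_sum (φ y) _ _).trans (Finset.sum_congr rfl fun i _ => ?_)
    exact map_smul (φ y) _ _
  -- With `s` expanded in the frame, the Leibniz rules for `φ(s)` and for `[α, s]` produce the same
  -- terms, the derivatives of the coefficients of `s` times the values of `φ` on the frame. These
  -- cancel.
  rw [lieDual_apply_eq_sum, dirDeriv_congr h3, dirDeriv_sum _ fun i _ => (h1 i).mul (h2 i),
    (𝔸.isDerivation_localBracket α).eq_sum_frameAt hx hs]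
  have h4 : (φ x (∑ i, (coframeAt F A x i x (s x) • 𝔸.localBracket α (frameAt F A x i) x +
      dirDeriv (𝔸.rho α) (fun y => coframeAt F A x i y (s y)) x • frameAt F A x i x)) : ℝ) =
      ∑ i, (coframeAt F A x i x (s x) * (φ x (𝔸.localBracket α (frameAt F A x i) x) : ℝ) +
      dirDeriv (𝔸.rho α) (fun y => coframeAt F A x i y (s y)) x *
        (φ x (frameAt F A x i x) : ℝ)) := by
    refine (map_sum (φ x) _ _).trans (Finset.sum_congr rfl fun i _ => ?_)
    refine (map_add (φ x) _ _).trans ?_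
    exact congrArg₂ (· + ·) (map_smul (φ x) _ _) (map_smul (φ x) _ _)
  rw [h4, ← Finset.sum_sub_distrib]
  refine Finset.sum_congr rfl fun i _ => ?_
  rw [dirDeriv_mul (h1 i) (h2 i)]
  ring

/-- The trace of the Lie derivative on `A*` is minus the trace of the Lie derivative on `A`. -/
lemma frameTrace_lieDual (α : Cₛ^∞⟮𝓘(ℝ, E); F, A⟯) {b x : M}
    (hx : x ∈ (trivializationAt F A b).baseSet) :
    frameTrace (F →L[ℝ] ℝ) (𝔸.lieDual α) b x = -frameTrace F (𝔸.localBracket α) b x := by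
  have hx' := hx
  rw [← baseSet_dualBundle] at hx'
  let e := finBasis ℝ F
  -- `T` is the matrix of `[α, ·]` in the frame of `A`, and `Tt` is its transpose.
  let T : F →ₗ[ℝ] F := e.constr ℝ fun i =>
    (trivializationAt F A b).linearMapAt ℝ x (𝔸.localBracket α (frameAt F A b i) x)
  let Tt : (F →L[ℝ] ℝ) →ₗ[ℝ] (F →L[ℝ] ℝ) :=
    { toFun ψ := ψ.comp T.toContinuousLinearMap
      map_add' _ _ := rfl
      map_smul' _ _ := rfl }
  have hsymm : ∀ {y : M}, y ∈ (trivializationAt F A b).baseSet → ∀ i,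
      (trivializationAt F A b).symm y (e i) = frameAt F A b i y := fun {y} hy i => by
    rw [← linearMapAt_frameAt F A hy i, Trivialization.coe_linearMapAt_of_mem (R := ℝ) _ hy]
    exact Trivialization.symm_apply_apply_mk _ hy _
  have hε : ∀ k {y : M}, y ∈ (trivializationAt F A b).baseSet → ∀ v : A y,
      (frameAt (F →L[ℝ] ℝ) (DualBundle A) b k y v : ℝ) = finBasis ℝ (F →L[ℝ] ℝ) k
        ((trivializationAt F A b).linearMapAt ℝ y v) := fun k y hy v => by
    have hy' := hy
    rw [← baseSet_dualBundle] at hy'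
    rw [← linearMapAt_frameAt (F →L[ℝ] ℝ) (DualBundle A) hy' k, linearMapAt_dualBundle F A hy,
      ← Trivialization.symmₗ_apply (R := ℝ) _ hy, Trivialization.symmₗ_linearMapAt _ hy]
  -- The frames of `A*` and `A` around `b` pair to constants, so the derivative term of the Lie
  -- derivative vanishes and only the bracket term survives: the matrix is minus the transpose of
  -- `T`.
  have hD : ∀ k, (trivializationAt (F →L[ℝ] ℝ) (DualBundle A) b).linearMapAt ℝ x
      (𝔸.lieDual α (frameAt (F →L[ℝ] ℝ) (DualBundle A) b k) x) =
      -Tt (finBasis ℝ (F →L[ℝ] ℝ) k) := fun k => by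
    refine ContinuousLinearMap.coe_injective (e.ext fun i => ?_)
    change (trivializationAt (F →L[ℝ] ℝ) (DualBundle A) b).linearMapAt ℝ x
      (𝔸.lieDual α (frameAt (F →L[ℝ] ℝ) (DualBundle A) b k) x) (e i) =
      -(finBasis ℝ (F →L[ℝ] ℝ) k (T (e i)))
    rw [linearMapAt_dualBundle F A hx, hsymm hx, 𝔸.lieDual_apply
      (smoothNear_frameAt (F →L[ℝ] ℝ) (DualBundle A) hx' k) (smoothNear_frameAt F A hx i),
      hε k hx, Basis.constr_basis, dirDeriv_congr (g := fun _ => finBasis ℝ (F →L[ℝ] ℝ) k (e i)),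
      dirDeriv_const, zero_sub]
    filter_upwards [(trivializationAt F A b).open_baseSet.mem_nhds hx] with y hy
    rw [hε k hy, linearMapAt_frameAt F A hy]
  -- In the dual basis the diagonal entries of `Tt` are those of `T`.
  let e' := e.dualBasis.map (LinearMap.toContinuousLinearMap (𝕜 := ℝ) (E := F) (F' := ℝ))
  have h1 : frameTrace (F →L[ℝ] ℝ) (𝔸.lieDual α) b x = -∑ k, (finBasis ℝ (F →L[ℝ] ℝ)).coord k
      (Tt (finBasis ℝ (F →L[ℝ] ℝ) k)) := by
    rw [← Finset.sum_neg_distrib]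
    refine Finset.sum_congr rfl fun k _ => ?_
    rw [coframeAt, LinearMap.comp_apply, hD k, map_neg]
  rw [h1, sum_coord_eq_of_bases _ e']
  refine congrArg _ (Finset.sum_congr rfl fun i _ => ?_)
  have h2 : ∀ ψ : F →L[ℝ] ℝ, e'.coord i ψ = ψ (e i) := fun ψ => by
    simp [e', Basis.coord_apply]
  have h3 : ∀ w : F, e' i w = e.coord i w := fun w => by
    simp [e']
  rw [h2]
  change e' i (T (e i)) = _
  rw [h3, Basis.constr_basis]
  rfl

end LieDual

end LieAlgebroid

/-! ### Derivatives of determinants and of characters -/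

section Determinant

variable {F : Type*} [NormedAddCommGroup F] [NormedSpace ℝ F] [FiniteDimensional ℝ F]

/-- Jacobi's formula at an invertible map. -/
lemma fderiv_det_apply (e : F ≃L[ℝ] F) (B : F →L[ℝ] F) {ι : Type*} [Fintype ι]
    (v : Basis ι ℝ F) :
    fderiv ℝ (fun f : F →L[ℝ] F => f.det) (e : F →L[ℝ] F) B =
      (e : F →L[ℝ] F).det * ∑ j, ∑ i, v.coord i (B (v j)) * v.coord j (e.symm (v i)) := by
  classical
  let N : Matrix ι ι ℝ := LinearMap.toMatrix v v ((e.symm : F →L[ℝ] F).comp B).toLinearMap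
  -- The derivative is taken along the line `e + t B`, where the determinant is `det e · det (1 + t
  -- N)`, with `N` the matrix of `e⁻¹ B`. The polynomial `p` is the remainder after the linear term
  -- in `Matrix.det_one_add_smul`; it is multiplied by `t²` and does not contribute at `0`.
  let p : Polynomial ℝ := (1 + (Polynomial.X : Polynomial ℝ) • N.map Polynomial.C).det.divX.divX
  have h1 : HasDerivAt (fun t : ℝ => ((e : F →L[ℝ] F) + t • B).det)
      (fderiv ℝ (fun f : F →L[ℝ] F => f.det) (e : F →L[ℝ] F) B) 0 := by
    have hl : HasDerivAt (fun t : ℝ => (e : F →L[ℝ] F) + t • B) B 0 := by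
      simpa using ((hasDerivAt_id (0 : ℝ)).smul_const B).const_add (e : F →L[ℝ] F)
    have hd : HasFDerivAt (fun f : F →L[ℝ] F => f.det)
        (fderiv ℝ (fun f : F →L[ℝ] F => f.det) (e : F →L[ℝ] F)) ((e : F →L[ℝ] F) + (0 : ℝ) • B) := by
      simpa using ((contDiff_clm_det F).differentiable (by simp) (e : F →L[ℝ] F)).hasFDerivAt
    exact hd.comp_hasDerivAt (0 : ℝ) hl
  have h2 : (fun t : ℝ => ((e : F →L[ℝ] F) + t • B).det) =
      fun t => (e : F →L[ℝ] F).det * (1 + N.trace * t + p.eval t * t ^ 2) := by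
    funext t
    rw [← Matrix.det_one_add_smul]
    have : ((e : F →L[ℝ] F) + t • B : F →L[ℝ] F) = (e : F →L[ℝ] F).comp
        (ContinuousLinearMap.id ℝ F + t • (e.symm : F →L[ℝ] F).comp B) := by
      ext w
      simp
    rw [this]
    change LinearMap.det ((e : F →L[ℝ] F).toLinearMap ∘ₗ _) = _
    rw [LinearMap.det_comp, ← LinearMap.det_toMatrix v (ContinuousLinearMap.toLinearMap
      (ContinuousLinearMap.id ℝ F + t • (e.symm : F →L[ℝ] F).comp B))]
    congr 2
    simp [N, map_add]
  have h3 : HasDerivAt (fun t : ℝ => (e : F →L[ℝ] F).det * (1 + N.trace * t + p.eval t * t ^ 2))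
      ((e : F →L[ℝ] F).det * N.trace) 0 := by
    have := ((((hasDerivAt_id (0 : ℝ)).const_mul N.trace).const_add 1).add
      ((p.hasDerivAt 0).mul ((hasDerivAt_id (0 : ℝ)).pow 2))).const_mul (e : F →L[ℝ] F).det
    simpa using this
  rw [h2] at h1
  rw [h1.unique h3]
  congr 1
  refine Finset.sum_congr rfl fun j _ => ?_
  have h4 : B (v j) = ∑ i, v.coord i (B (v j)) • v i := (v.sum_repr _).symm
  refine (LinearMap.toMatrix_apply v v _ j j).trans ?_
  change v.coord j (e.symm (B (v j))) = _
  conv_lhs => rw [h4, map_sum, map_sum]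
  exact Finset.sum_congr rfl fun i _ => by rw [map_smul, map_smul, smul_eq_mul]

/-- Multiplicativity, `χ(s) = χ(t) χ(s / t)`, transports the derivative at `1` to any `t ≠ 0`. -/
lemma SmoothCharacter.hasDerivAt (χ : SmoothCharacter) {t : ℝ} (ht : t ≠ 0) :
    HasDerivAt χ.toHom (χ.weight * χ.toHom t / t) t := by
  have h1 : HasDerivAt χ.toHom χ.weight (t / t) := by
    rw [div_self ht]
    exact ((χ.smooth.contDiffAt (isOpen_compl_singleton.mem_nhds one_ne_zero)).differentiableAt
      (by simp)).hasDerivAt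
  have h2 := (HasDerivAt.comp (h₂ := χ.toHom) (h := fun s => id s / t) t h1
    ((hasDerivAt_id t).div_const t)).const_mul (χ.toHom t)
  have h3 : (fun s => χ.toHom t * (χ.toHom ∘ fun s => id s / t) s) = χ.toHom := by
    funext s
    simp only [Function.comp_apply, id, map_div₀]
    field_simp [(map_ne_zero χ.toHom).2 ht]
  rw [h3] at h2
  refine h2.congr_deriv ?_
  rw [mul_one_div, mul_div_assoc', mul_comm]

lemma weight_volChar : volChar.weight = 1 := deriv_id 1

lemma weight_densChar : densChar.weight = 1 := by
  have h : deriv (fun x : ℝ => |x|) 1 = 1 := by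
    rw [deriv_abs]
    simp
  exact h

end Determinant

section LineBundles

variable {E : Type*} [NormedAddCommGroup E] [NormedSpace ℝ E]
  {M : Type*} [TopologicalSpace M] [ChartedSpace E M]
  {L : M → Type*} [∀ x, AddCommGroup (L x)] [∀ x, Module ℝ (L x)]
  [∀ x, TopologicalSpace (L x)] [TopologicalSpace (TotalSpace ℝ L)]
  [FiberBundle ℝ L] [VectorBundle ℝ ℝ L]

/-! ### Frames of line bundles -/

lemma lineCoord_injective {b y : M} (hy : y ∈ (trivializationAt ℝ L b).baseSet) :
    Function.Injective (lineCoord L b y) := fun u v h => by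
  rw [← lineCoord_smul_lineFrame L b y hy u, h, lineCoord_smul_lineFrame L b y hy v]

lemma lineCoord_eq_mul {b b' y : M} (hy : y ∈ (trivializationAt ℝ L b).baseSet) (v : L y) :
    lineCoord L b' y v = lineCoord L b' y (lineFrame L b y) * lineCoord L b y v := by
  conv_lhs => rw [← lineCoord_smul_lineFrame L b y hy v, map_smul, smul_eq_mul, mul_comm]

lemma lineCoord_lineFrame_ne_zero {b b' y : M} (hy : y ∈ (trivializationAt ℝ L b).baseSet)
    (hy' : y ∈ (trivializationAt ℝ L b').baseSet) : lineCoord L b' y (lineFrame L b y) ≠ 0 := by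
  have h := lineCoord_eq_mul (L := L) (b' := b') hy (lineFrame L b' y)
  rw [lineCoord_lineFrame L b' y hy'] at h
  exact left_ne_zero_of_mul_eq_one h.symm

lemma lineCoord_ne_zero {b y : M} (hy : y ∈ (trivializationAt ℝ L b).baseSet) {v : L y}
    (hv : v ≠ 0) : lineCoord L b y v ≠ 0 := fun h =>
  hv (lineCoord_injective hy (h.trans (map_zero _).symm))

variable [ContMDiffVectorBundle ∞ ℝ L 𝓘(ℝ, E)]

lemma SmoothNear.lineCoord {σ : ∀ x, L x} {b x : M} (h : SmoothNear E ℝ σ x)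
    (hx : x ∈ (trivializationAt ℝ L b).baseSet) :
    SmoothFnNear E (fun y => lineCoord L b y (σ y)) x := by
  have hb := (trivializationAt ℝ L b).open_baseSet
  filter_upwards [h, hb.mem_nhds hx] with y hy hyb
  refine (((trivializationAt ℝ L b).contMDiffAt_section_iff hyb).1 hy).congr_of_eventuallyEq ?_
  filter_upwards [hb.mem_nhds hyb] with z hz
  rw [_root_.lineCoord, Trivialization.coe_linearMapAt_of_mem _ hz]

lemma smoothNear_of_lineCoord {σ : ∀ x, L x} {b x : M}
    (hx : x ∈ (trivializationAt ℝ L b).baseSet)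
    (h : SmoothFnNear E (fun y => lineCoord L b y (σ y)) x) : SmoothNear E ℝ σ x := by
  have hb := (trivializationAt ℝ L b).open_baseSet
  filter_upwards [h, hb.mem_nhds hx] with y hy hyb
  refine ((trivializationAt ℝ L b).contMDiffAt_section_iff hyb).2 (hy.congr_of_eventuallyEq ?_)
  filter_upwards [hb.mem_nhds hyb] with z hz
  rw [_root_.lineCoord, Trivialization.coe_linearMapAt_of_mem _ hz]

lemma smoothNear_lineFrame {b x : M} (hx : x ∈ (trivializationAt ℝ L b).baseSet) :
    SmoothNear E ℝ (lineFrame L b) x := by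
  refine smoothNear_of_lineCoord hx ((SmoothFnNear.const 1).congr ?_)
  filter_upwards [(trivializationAt ℝ L b).open_baseSet.mem_nhds hx] with y hy
  exact lineCoord_lineFrame L b y hy

/-! ### Local forms of operators on line bundles -/

/-- In the coordinate given by the frame around `b`, the operator `P` is `X + w b`. -/
def HasLocalForm (X : ∀ x : M, TangentSpace 𝓘(ℝ, E) x) (P : (∀ x, L x) → ∀ x, L x)
    (w : M → M → ℝ) : Prop :=
  ∀ ⦃b x : M⦄ ⦃σ : ∀ x, L x⦄, x ∈ (trivializationAt ℝ L b).baseSet → SmoothNear E ℝ σ x →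
    lineCoord L b x (P σ x) =
      dirDeriv X (fun y => lineCoord L b y (σ y)) x + w b x * lineCoord L b x (σ x)

variable {X : ∀ x : M, TangentSpace 𝓘(ℝ, E) x} {P : (∀ x, L x) → ∀ x, L x} {w : M → M → ℝ}

/-- Evaluating `P` on the frame of `b` in the coordinates of both `b` and `b'` shows that `w`
changes by the logarithmic derivative of the transition function. -/
lemma HasLocalForm.transition (h : HasLocalForm X P w) {b b' x : M}
    (hx : x ∈ (trivializationAt ℝ L b).baseSet) (hx' : x ∈ (trivializationAt ℝ L b').baseSet) :
    dirDeriv X (fun y => lineCoord L b' y (lineFrame L b y)) x +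
      w b' x * lineCoord L b' x (lineFrame L b x) =
      w b x * lineCoord L b' x (lineFrame L b x) := by
  have h1 := h hx (smoothNear_lineFrame hx)
  have h2 : (fun y => lineCoord L b y (lineFrame L b y)) =ᶠ[𝓝 x] fun _ => 1 := by
    filter_upwards [(trivializationAt ℝ L b).open_baseSet.mem_nhds hx] with y hy
    exact lineCoord_lineFrame L b y hy
  rw [dirDeriv_congr h2, dirDeriv_const, lineCoord_lineFrame L b x hx, zero_add, mul_one] at h1
  rw [← h hx' (smoothNear_lineFrame hx), lineCoord_eq_mul hx, h1, mul_comm]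

/-- It is enough to know the local form at the centres of the trivializations, provided that the
`w b` transform correctly. -/
lemma hasLocalForm_of_center
    (h : ∀ ⦃x : M⦄ ⦃σ : ∀ x, L x⦄, SmoothNear E ℝ σ x → lineCoord L x x (P σ x) =
      dirDeriv X (fun y => lineCoord L x y (σ y)) x + w x x * lineCoord L x x (σ x))
    (hw : ∀ ⦃b x : M⦄, x ∈ (trivializationAt ℝ L b).baseSet →
      dirDeriv X (fun y => lineCoord L x y (lineFrame L b y)) x +
        w x x * lineCoord L x x (lineFrame L b x) = w b x * lineCoord L x x (lineFrame L b x)) :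
    HasLocalForm X P w := fun b x σ hx hσ => by
  have hx' : x ∈ (trivializationAt ℝ L x).baseSet := FiberBundle.mem_baseSet_trivializationAt ℝ L x
  have h1 := h hσ
  have h2 : (fun y => lineCoord L x y (σ y)) =ᶠ[𝓝 x]
      fun y => lineCoord L x y (lineFrame L b y) * lineCoord L b y (σ y) := by
    filter_upwards [(trivializationAt ℝ L b).open_baseSet.mem_nhds hx] with y hy
    exact lineCoord_eq_mul hy _
  rw [dirDeriv_congr h2, dirDeriv_mul ((smoothNear_lineFrame hx).lineCoord hx')
    (hσ.lineCoord hx)] at h1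
  have h3 := lineCoord_eq_mul (L := L) (b' := x) hx (P σ x)
  have h4 := lineCoord_eq_mul (L := L) (b' := x) hx (σ x)
  -- Both sides are compared after multiplication by the transition function from `b` to `x`. Its
  -- derivative, produced by the product rule in `h1`, is absorbed by `hw`.
  refine mul_left_cancel₀ (lineCoord_lineFrame_ne_zero hx hx') ?_
  linear_combination h1 - h3 + w x x * h4 + lineCoord L b x (σ x) * hw hx

end LineBundles

/-! ### Transition functions of the associated line bundles and the local form of `lieAssoc`. -/

section AssocBundles

variable {E : Type*} [NormedAddCommGroup E] [NormedSpace ℝ E]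
  {M : Type*} [TopologicalSpace M] [ChartedSpace E M]
  (χ : SmoothCharacter) (F : Type*) [NormedAddCommGroup F] [NormedSpace ℝ F]
  [FiniteDimensional ℝ F]
  (V : M → Type*) [TopologicalSpace (TotalSpace F V)] [∀ x, AddCommGroup (V x)]
  [∀ x, Module ℝ (V x)] [∀ x, TopologicalSpace (V x)] [FiberBundle F V] [VectorBundle ℝ F V]
  {b b' x : M}

lemma lineCoord_assocBundle (hx : x ∈ (trivializationAt F V b).baseSet) :
    lineCoord (AssocBundle χ F V) b x = AssocBundle.coord χ F V b x := by
  refine LinearMap.ext fun v => ?_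
  unfold lineCoord
  rw [Trivialization.coe_linearMapAt_of_mem (R := ℝ) _
    (show x ∈ (trivializationAt ℝ (AssocBundle χ F V) b).baseSet from hx)]
  rfl

lemma lineFrame_assocBundle (hx : x ∈ (trivializationAt F V b).baseSet) :
    lineFrame (AssocBundle χ F V) b x = AssocBundle.frame χ F V b x := by
  refine lineCoord_injective (b := b) (show x ∈ _ from hx) ?_
  rw [lineCoord_lineFrame _ b x hx, lineCoord_assocBundle χ F V hx]
  exact ((AssocBundle.lineFrames χ F V).coord_frame b x hx).symm

lemma lineCoord_lineFrame_assocBundle (hx : x ∈ (trivializationAt F V b).baseSet)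
    (hx' : x ∈ (trivializationAt F V b').baseSet) :
    lineCoord (AssocBundle χ F V) b' x (lineFrame (AssocBundle χ F V) b x) =
      χ.toHom ((trivializationAt F V b').coordChangeL ℝ (trivializationAt F V b) x :
        F →L[ℝ] F).det := by
  rw [lineCoord_assocBundle χ F V hx', lineFrame_assocBundle χ F V hx,
    AssocBundle.coord_frame' χ F V b b' x hx hx']

variable {F V} [ContMDiffVectorBundle ∞ F V 𝓘(ℝ, E)]
  {X : ∀ x : M, TangentSpace 𝓘(ℝ, E) x} {D : (∀ x, V x) → ∀ x, V x}

/-- The transition function is `χ(det C)`, with `C` the coordinate change of `V`. By the derivative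
of `χ` and Jacobi's formula its logarithmic derivative is the weight times the trace of `C⁻¹ X(C)`,
which in terms of frames is the double sum of `IsDerivation.frameTrace_change`. -/
lemma dirDeriv_lineCoord_lineFrame_assocBundle (hx : x ∈ (trivializationAt F V b).baseSet)
    (hx' : x ∈ (trivializationAt F V b').baseSet) :
    dirDeriv X (fun y => lineCoord (AssocBundle χ F V) b' y
      (lineFrame (AssocBundle χ F V) b y)) x =
    χ.weight * lineCoord (AssocBundle χ F V) b' x (lineFrame (AssocBundle χ F V) b x) *
      ∑ j, ∑ i, dirDeriv X (fun y => coframeAt F V b i y (frameAt F V b' j y)) x *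
        coframeAt F V b' j x (frameAt F V b i x) := by
  let C : M → F →L[ℝ] F := fun y =>
    (trivializationAt F V b').coordChangeL ℝ (trivializationAt F V b) y
  have hU : IsOpen ((trivializationAt F V b').baseSet ∩ (trivializationAt F V b).baseSet) :=
    (trivializationAt F V b').open_baseSet.inter (trivializationAt F V b).open_baseSet
  have hxU : x ∈ (trivializationAt F V b').baseSet ∩ (trivializationAt F V b).baseSet := ⟨hx', hx⟩
  have hC : ContMDiffAt 𝓘(ℝ, E) 𝓘(ℝ, F →L[ℝ] F) ∞ C x :=
    (contMDiffOn_coordChangeL (IB := 𝓘(ℝ, E)) (n := ∞) (trivializationAt F V b')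
      (trivializationAt F V b)).contMDiffAt (hU.mem_nhds hxU)
  have hCd := hC.mdifferentiableAt (by simp : (∞ : ℕ∞ω) ≠ 0)
  let B : F →L[ℝ] F := mfderiv 𝓘(ℝ, E) 𝓘(ℝ, F →L[ℝ] F) C x (X x)
  have hcomp : ∀ g : (F →L[ℝ] F) → ℝ, DifferentiableAt ℝ g (C x) →
      dirDeriv X (fun y => g (C y)) x = fderiv ℝ g (C x) B := fun g hg => by
    have h := mvfderiv_comp_apply (I := 𝓘(ℝ, F →L[ℝ] F)) (I' := 𝓘(ℝ, E)) (g := g) (f := C) x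
      hg.mdifferentiableAt hCd (X x)
    refine h.trans ?_
    rw [mvfderiv, mfderiv_eq_fderiv]
    rfl
  have hcc : ∀ {y : M}, y ∈ (trivializationAt F V b').baseSet ∩ (trivializationAt F V b).baseSet →
      ∀ v : V y, (trivializationAt F V b').coordChangeL ℝ (trivializationAt F V b) y
        ((trivializationAt F V b').linearMapAt ℝ y v) =
        (trivializationAt F V b).linearMapAt ℝ y v := fun {y} hy v => by
    rw [Trivialization.coordChangeL_apply _ _ hy, ← Trivialization.symmₗ_apply (R := ℝ) _ hy.1,
      Trivialization.symmₗ_linearMapAt _ hy.1, Trivialization.coe_linearMapAt_of_mem (R := ℝ) _ hy.2]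
  have hfr : ∀ {y : M} i j, y ∈ (trivializationAt F V b').baseSet ∩
      (trivializationAt F V b).baseSet → coframeAt F V b i y (frameAt F V b' j y) =
      (finBasis ℝ F).coord i (C y (finBasis ℝ F j)) := fun {y} i j hy => by
    rw [← linearMapAt_frameAt F V hy.1 j]
    exact (congrArg ((finBasis ℝ F).coord i) (hcc hy _)).symm
  have hfr' : ∀ i j, coframeAt F V b' j x (frameAt F V b i x) = (finBasis ℝ F).coord j
      (((trivializationAt F V b').coordChangeL ℝ (trivializationAt F V b) x).symm
        (finBasis ℝ F i)) := fun i j => by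
    rw [← linearMapAt_frameAt F V hx i, ← hcc hxU, ContinuousLinearEquiv.symm_apply_apply]
    rfl
  -- A matrix entry is a continuous linear function `ℓ` of `C`, so its derivative is the
  -- corresponding entry of `B`.
  have hG : ∀ i j, dirDeriv X (fun y => coframeAt F V b i y (frameAt F V b' j y)) x =
      (finBasis ℝ F).coord i (B (finBasis ℝ F j)) := fun i j => by
    let ℓ : (F →L[ℝ] F) →L[ℝ] ℝ := ((finBasis ℝ F).coord i).toContinuousLinearMap.comp
      (ContinuousLinearMap.apply ℝ F (finBasis ℝ F j))
    have h := hcomp ℓ ℓ.differentiableAt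
    rw [ℓ.fderiv] at h
    refine (dirDeriv_congr ?_).trans h
    filter_upwards [hU.mem_nhds hxU] with y hy using hfr i j hy
  have hdet : dirDeriv X (fun y => (C y).det) x = (C x).det * ∑ j, ∑ i,
      dirDeriv X (fun y => coframeAt F V b i y (frameAt F V b' j y)) x *
        coframeAt F V b' j x (frameAt F V b i x) := by
    rw [hcomp _ ((contDiff_clm_det F).differentiable (by simp) _)]
    simp only [hG, hfr']
    exact fderiv_det_apply _ B (finBasis ℝ F)
  have hne : (C x).det ≠ 0 := coordChangeL_det_ne_zero F V b b' x
  have hsm : SmoothFnNear E (fun y => (C y).det) x := by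
    have hC' := contMDiffOn_coordChangeL (IB := 𝓘(ℝ, E)) (n := ∞) (trivializationAt F V b')
      (trivializationAt F V b)
    exact .of_contMDiffOn hU ((contDiff_clm_det F).contMDiff.comp_contMDiffOn hC') hxU
  rw [lineCoord_lineFrame_assocBundle χ F V hx hx',
    dirDeriv_congr (g := fun y => χ.toHom (C y).det), dirDeriv_comp hsm (χ.hasDerivAt hne), hdet]
  · change _ = χ.weight * χ.toHom (C x).det * _
    field_simp
  · filter_upwards [hU.mem_nhds hxU] with y hy
    exact lineCoord_lineFrame_assocBundle χ F V hy.2 hy.1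

/-- At the centre of a trivialization this is the definition. Elsewhere the change of the trace with
the frame is matched by the logarithmic derivative of the transition function, so `lieAssoc` does
not depend on the frames chosen to define it. -/
lemma hasLocalForm_lieAssoc (hD : IsDerivation F X D) : HasLocalForm X (lieAssoc (F := F) χ X D)
    (fun b x => -(χ.weight * frameTrace F D b x)) := by
  refine hasLocalForm_of_center (fun x ξ _ => ?_) (fun b x hx => ?_)
  · have hx : x ∈ (trivializationAt F V x).baseSet := FiberBundle.mem_baseSet_trivializationAt F V x
    unfold lieAssoc
    have h1 : lineCoord (AssocBundle χ F V) x x (AssocBundle.frame χ F V x x) = 1 := by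
      rw [← lineFrame_assocBundle χ F V hx, lineCoord_lineFrame _ x x hx]
    rw [map_smul, h1, smul_eq_mul, mul_one, lineCoord_assocBundle χ F V hx,
      dirDeriv_congr (g := fun y => lineCoord (AssocBundle χ F V) x y (ξ y))]
    · exact (sub_eq_add_neg _ _).trans (congrArg _ (neg_mul _ _).symm)
    · filter_upwards [(trivializationAt F V x).open_baseSet.mem_nhds hx] with y hy
      rw [lineCoord_assocBundle χ F V hy]
  · have hx' : x ∈ (trivializationAt F V x).baseSet :=
      FiberBundle.mem_baseSet_trivializationAt F V x
    change x ∈ (trivializationAt F V b).baseSet at hx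
    rw [dirDeriv_lineCoord_lineFrame_assocBundle χ hx hx', hD.frameTrace_change hx hx']
    ring

end AssocBundles

/-! ### Transition functions of tensor products and the local form of `tensorOp`. -/

section TensorBundles

variable {E : Type*} [NormedAddCommGroup E] [NormedSpace ℝ E]
  {M : Type*} [TopologicalSpace M] [ChartedSpace E M]
  (L₁ L₂ : M → Type*)
  [∀ x, AddCommGroup (L₁ x)] [∀ x, Module ℝ (L₁ x)]
  [∀ x, AddCommGroup (L₂ x)] [∀ x, Module ℝ (L₂ x)]
  [∀ x, TopologicalSpace (L₁ x)] [TopologicalSpace (TotalSpace ℝ L₁)]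
  [FiberBundle ℝ L₁] [VectorBundle ℝ ℝ L₁]
  [∀ x, TopologicalSpace (L₂ x)] [TopologicalSpace (TotalSpace ℝ L₂)]
  [FiberBundle ℝ L₂] [VectorBundle ℝ ℝ L₂]
  {b b' x : M}

lemma lineCoord_tensorBundle (hx : x ∈ (trivializationAt ℝ (TensorBundle L₁ L₂) b).baseSet) :
    lineCoord (TensorBundle L₁ L₂) b x = TensorBundle.coord L₁ L₂ b x := by
  refine LinearMap.ext fun v => ?_
  unfold lineCoord
  rw [Trivialization.coe_linearMapAt_of_mem (R := ℝ) _ hx]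
  rfl

lemma lineFrame_tensorBundle (hx : x ∈ (trivializationAt ℝ (TensorBundle L₁ L₂) b).baseSet) :
    lineFrame (TensorBundle L₁ L₂) b x =
      TensorBundle.tmul (lineFrame L₁ b x) (lineFrame L₂ b x) := by
  refine lineCoord_injective hx ?_
  rw [lineCoord_lineFrame _ b x hx, lineCoord_tensorBundle L₁ L₂ hx]
  exact ((TensorBundle.lineFrames L₁ L₂).coord_frame b x hx).symm

lemma lineCoord_lineFrame_tensorBundle
    (hx : x ∈ (trivializationAt ℝ (TensorBundle L₁ L₂) b).baseSet)
    (hx' : x ∈ (trivializationAt ℝ (TensorBundle L₁ L₂) b').baseSet) :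
    lineCoord (TensorBundle L₁ L₂) b' x (lineFrame (TensorBundle L₁ L₂) b x) =
      lineCoord L₁ b' x (lineFrame L₁ b x) * lineCoord L₂ b' x (lineFrame L₂ b x) := by
  rw [lineCoord_tensorBundle L₁ L₂ hx', lineFrame_tensorBundle L₁ L₂ hx, TensorBundle.coord_tmul]

end TensorBundles

lemma HasLocalForm.lineCoord_lineFrame {E : Type*} [NormedAddCommGroup E] [NormedSpace ℝ E]
    {M : Type*} [TopologicalSpace M] [ChartedSpace E M]
    {L : M → Type*} [∀ x, AddCommGroup (L x)] [∀ x, Module ℝ (L x)]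
    [∀ x, TopologicalSpace (L x)] [TopologicalSpace (TotalSpace ℝ L)]
    [FiberBundle ℝ L] [VectorBundle ℝ ℝ L] [ContMDiffVectorBundle ∞ ℝ L 𝓘(ℝ, E)]
    {X : ∀ x : M, TangentSpace 𝓘(ℝ, E) x} {P : (∀ x, L x) → ∀ x, L x} {w : M → M → ℝ}
    (h : HasLocalForm X P w) {b x : M} (hx : x ∈ (trivializationAt ℝ L b).baseSet) :
    lineCoord L b x (P (lineFrame L b) x) = w b x := by
  have h2 : (fun y => lineCoord L b y (lineFrame L b y)) =ᶠ[𝓝 x] fun _ => 1 := by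
    filter_upwards [(trivializationAt ℝ L b).open_baseSet.mem_nhds hx] with y hy
    exact _root_.lineCoord_lineFrame L b y hy
  rw [h hx (smoothNear_lineFrame hx), dirDeriv_congr h2, dirDeriv_const,
    _root_.lineCoord_lineFrame L b x hx, zero_add, mul_one]

namespace LieAlgebroid

section Tensor

variable {E : Type*} [NormedAddCommGroup E] [NormedSpace ℝ E]
  {M : Type*} [TopologicalSpace M] [ChartedSpace E M] [IsManifold 𝓘(ℝ, E) ∞ M]
  {F : Type*} [NormedAddCommGroup F] [NormedSpace ℝ F]
  {A : M → Type*} [TopologicalSpace (TotalSpace F A)] [∀ x, AddCommGroup (A x)]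
  [∀ x, Module ℝ (A x)] [∀ x, TopologicalSpace (A x)] [FiberBundle F A] [VectorBundle ℝ F A]
  (𝔸 : LieAlgebroid E F A)
  {L₁ L₂ : M → Type*}
  [∀ x, AddCommGroup (L₁ x)] [∀ x, Module ℝ (L₁ x)]
  [∀ x, AddCommGroup (L₂ x)] [∀ x, Module ℝ (L₂ x)]
  [∀ x, TopologicalSpace (L₁ x)] [TopologicalSpace (TotalSpace ℝ L₁)]
  [FiberBundle ℝ L₁] [VectorBundle ℝ ℝ L₁] [ContMDiffVectorBundle ∞ ℝ L₁ 𝓘(ℝ, E)]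
  [∀ x, TopologicalSpace (L₂ x)] [TopologicalSpace (TotalSpace ℝ L₂)]
  [FiberBundle ℝ L₂] [VectorBundle ℝ ℝ L₂] [ContMDiffVectorBundle ∞ ℝ L₂ 𝓘(ℝ, E)]

/-- Transition functions multiply, so their logarithmic derivatives add, and the local functions
`w`, `w'` add accordingly. -/
lemma hasLocalForm_tensorOp {D : 𝔸.Operation L₁} {D' : 𝔸.Operation L₂}
    {α : Cₛ^∞⟮𝓘(ℝ, E); F, A⟯} {w w' : M → M → ℝ} (h : HasLocalForm (𝔸.rho α) (D α) w)
    (h' : HasLocalForm (𝔸.rho α) (D' α) w') :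
    HasLocalForm (𝔸.rho α) (𝔸.tensorOp D D' α) (fun b x => w b x + w' b x) := by
  refine hasLocalForm_of_center (fun x ζ _ => ?_) (fun b x hx => ?_)
  · have hx := FiberBundle.mem_baseSet_trivializationAt ℝ (TensorBundle L₁ L₂) x
    have hx₁ := FiberBundle.mem_baseSet_trivializationAt ℝ L₁ x
    have hx₂ := FiberBundle.mem_baseSet_trivializationAt ℝ L₂ x
    unfold tensorOp
    rw [lineCoord_tensorBundle L₁ L₂ hx, map_add, map_smul, map_smul, map_add,
      TensorBundle.coord_tmul, TensorBundle.coord_tmul, TensorBundle.coord_tmul,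
      h.lineCoord_lineFrame hx₁, h'.lineCoord_lineFrame hx₂, lineCoord_lineFrame L₁ x x hx₁,
      lineCoord_lineFrame L₂ x x hx₂,
      dirDeriv_congr (g := fun y => lineCoord (TensorBundle L₁ L₂) x y (ζ y))]
    · simp only [smul_eq_mul]
      ring
    · filter_upwards [(trivializationAt ℝ (TensorBundle L₁ L₂) x).open_baseSet.mem_nhds hx]
        with y hy
      rw [lineCoord_tensorBundle L₁ L₂ hy]
  · have hx' := FiberBundle.mem_baseSet_trivializationAt ℝ (TensorBundle L₁ L₂) x
    have e : (fun y => lineCoord (TensorBundle L₁ L₂) x y (lineFrame (TensorBundle L₁ L₂) b y))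
        =ᶠ[𝓝 x] fun y =>
          lineCoord L₁ x y (lineFrame L₁ b y) * lineCoord L₂ x y (lineFrame L₂ b y) := by
      filter_upwards [(trivializationAt ℝ (TensorBundle L₁ L₂) b).open_baseSet.mem_nhds hx,
        (trivializationAt ℝ (TensorBundle L₁ L₂) x).open_baseSet.mem_nhds hx'] with y hy hy'
      exact lineCoord_lineFrame_tensorBundle L₁ L₂ hy hy'
    rw [dirDeriv_congr e, lineCoord_lineFrame_tensorBundle L₁ L₂ hx hx',
      dirDeriv_mul ((smoothNear_lineFrame hx.1).lineCoord hx'.1)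
        ((smoothNear_lineFrame hx.2).lineCoord hx'.2)]
    linear_combination lineCoord L₂ x x (lineFrame L₂ b x) * h.transition hx.1 hx'.1 +
      lineCoord L₁ x x (lineFrame L₁ b x) * h'.transition hx.2 hx'.2

end Tensor

end LieAlgebroid

/-! ### Commutators -/

section Commutator

variable {E : Type*} [NormedAddCommGroup E] [NormedSpace ℝ E]
  {M : Type*} [TopologicalSpace M] [ChartedSpace E M] [IsManifold 𝓘(ℝ, E) ∞ M]
  {X Y Z : ∀ x : M, TangentSpace 𝓘(ℝ, E) x} {f : M → ℝ} {x : M}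

/-- Apply the commutator relation to `f σ`. The terms in which one operator differentiates `f` and
the other `σ` are symmetric and cancel, so the relation descends from sections to functions wherever
`σ` does not vanish. -/
lemma dirDeriv_commutator_smul {F : Type*} [NormedAddCommGroup F] [NormedSpace ℝ F]
    {V : M → Type*} [TopologicalSpace (TotalSpace F V)]
    [∀ x, AddCommGroup (V x)] [∀ x, Module ℝ (V x)]
    [∀ x, TopologicalSpace (V x)] [FiberBundle F V] [VectorBundle ℝ F V]
    {D₁ D₂ D₃ : (∀ x, V x) → ∀ x, V x}
    (h₁ : IsDerivation F X D₁) (h₂ : IsDerivation F Y D₂) (h₃ : IsDerivation F Z D₃)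
    (s₁ : PreservesSmooth F E D₁) (s₂ : PreservesSmooth F E D₂)
    (hX : ∀ x, SmoothNear E E X x) (hY : ∀ x, SmoothNear E E Y x)
    (h : ∀ {σ : ∀ x, V x} {x : M}, SmoothNear E F σ x → D₃ σ x = D₁ (D₂ σ) x - D₂ (D₁ σ) x)
    {σ : ∀ x, V x} (hf : SmoothFnNear E f x) (hσ : SmoothNear E F σ x) :
    dirDeriv Z f x • σ x = (dirDeriv X (dirDeriv Y f) x - dirDeriv Y (dirDeriv X f) x) • σ x := by
  have key : ∀ {X Y : ∀ x : M, TangentSpace 𝓘(ℝ, E) x} {D₁ D₂ : (∀ x, V x) → ∀ x, V x},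
      IsDerivation F X D₁ → IsDerivation F Y D₂ → PreservesSmooth F E D₂ →
      (∀ x, SmoothNear E E Y x) → D₁ (D₂ fun y => f y • σ y) x = f x • D₁ (D₂ σ) x +
        dirDeriv X f x • D₂ σ x + (dirDeriv Y f x • D₁ σ x + dirDeriv X (dirDeriv Y f) x • σ x) := by
    intro X Y D₁ D₂ h₁ h₂ s₂ hY
    have hYf : SmoothFnNear E (dirDeriv Y f) x := smoothFnNear_dirDeriv hf (hY x)
    rw [← h₁.leibniz hf (s₂ hσ), ← h₁.leibniz hYf hσ,
      ← h₁.add (.smul hf (s₂ hσ)) (.smul hYf hσ)]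
    refine h₁.congr ((SmoothNear.smul hf (s₂ hσ)).add (.smul hYf hσ)) ?_
    have hf' : ∀ᶠ y in 𝓝 x, SmoothFnNear E f y := hf.eventually_nhds
    have hσ' : ∀ᶠ y in 𝓝 x, SmoothNear E F σ y := hσ.eventually_nhds
    filter_upwards [hf', hσ'] with y h h' using h₂.leibniz h h'
  have e := h (.smul hf hσ)
  rw [h₃.leibniz hf hσ, key h₁ h₂ s₂ hY, key h₂ h₁ s₁ hX, h hσ] at e
  rw [sub_smul]
  have e' : dirDeriv Z f x • σ x = (f x • (D₁ (D₂ σ) x - D₂ (D₁ σ) x) + dirDeriv Z f x • σ x) -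
    f x • (D₁ (D₂ σ) x - D₂ (D₁ σ) x) := by abel
  rw [e', e, smul_sub]
  abel

variable [FiniteDimensional ℝ E]

/-- The brackets with `X`, `Y` and `[X, Y]` are derivations of vector fields whose commutator
relation is the Jacobi identity. Testing it on `f` times a nonvanishing frame field gives the action
on functions. -/
lemma dirDeriv_mlieBracket (hX : ∀ x, SmoothNear E E X x) (hY : ∀ x, SmoothNear E E Y x)
    (hf : SmoothFnNear E f x) : dirDeriv (VectorField.mlieBracket 𝓘(ℝ, E) X Y) f x =
      dirDeriv X (dirDeriv Y f) x - dirDeriv Y (dirDeriv X f) x := by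
  have hx : x ∈ (trivializationAt E (fun x : M => TangentSpace 𝓘(ℝ, E) x) x).baseSet :=
    FiberBundle.mem_baseSet_trivializationAt E _ x
  -- In dimension `0` there is no nonvanishing field to test on, but all directional derivatives are
  -- zero.
  rcases isEmpty_or_nonempty (Fin (finrank ℝ E)) with hE | ⟨⟨i⟩⟩
  · have h0 : ∀ (W : ∀ x : M, TangentSpace 𝓘(ℝ, E) x) (g : M → ℝ), dirDeriv W g x = 0 :=
      fun W g => by
        unfold dirDeriv
        rw [← sum_coframeAt_smul_frameAt E (fun x : M => TangentSpace 𝓘(ℝ, E) x) hx (W x),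
          Finset.univ_eq_empty, Finset.sum_empty, map_zero]
    rw [h0, h0, h0, sub_zero]
  · have h := dirDeriv_commutator_smul isDerivation_mlieBracket isDerivation_mlieBracket
      isDerivation_mlieBracket (preservesSmooth_mlieBracket hX) (preservesSmooth_mlieBracket hY)
      hX hY (mlieBracket_mlieBracket hX hY) hf
      (smoothNear_frameAt E (fun x : M => TangentSpace 𝓘(ℝ, E) x) hx i)
    refine smul_left_injective ℝ (fun h0 => ?_) h
    have h1 := coframeAt_frameAt E (fun x : M => TangentSpace 𝓘(ℝ, E) x) hx i i
    rw [h0, map_zero, if_pos rfl] at h1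
    exact zero_ne_one h1

end Commutator

/-! ### Linearity rules for the frame trace. -/

section TraceRules

variable {E : Type*} [NormedAddCommGroup E] [NormedSpace ℝ E]
  {M : Type*} [TopologicalSpace M] [ChartedSpace E M]
  {F : Type*} [NormedAddCommGroup F] [NormedSpace ℝ F] [FiniteDimensional ℝ F]
  {V : M → Type*} [TopologicalSpace (TotalSpace F V)]
  [∀ x, AddCommGroup (V x)] [∀ x, Module ℝ (V x)]
  [∀ x, TopologicalSpace (V x)] [FiberBundle F V] [VectorBundle ℝ F V]
  [ContMDiffVectorBundle ∞ F V 𝓘(ℝ, E)]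
  {D D₁ D₂ : (∀ x, V x) → ∀ x, V x} {b x : M}

lemma frameTrace_add
    (h : ∀ {σ : ∀ x, V x}, SmoothNear E F σ x → D σ x = D₁ σ x + D₂ σ x)
    (hx : x ∈ (trivializationAt F V b).baseSet) :
    frameTrace F D b x = frameTrace F D₁ b x + frameTrace F D₂ b x := by
  unfold frameTrace
  rw [← Finset.sum_add_distrib]
  exact Finset.sum_congr rfl fun i _ => by rw [h (smoothNear_frameAt F V hx i), map_add]

/-- The operator `σ ↦ ℓ(σ) v` has rank at most one and trace `ℓ(v)`. -/
lemma frameTrace_smul_sub (c : ℝ) (ℓ : V x →ₗ[ℝ] ℝ) (v : V x)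
    (h : ∀ {σ : ∀ x, V x}, SmoothNear E F σ x → D σ x = c • D₁ σ x - ℓ (σ x) • v)
    (hx : x ∈ (trivializationAt F V b).baseSet) :
    frameTrace F D b x = c * frameTrace F D₁ b x - ℓ v := by
  have h1 : ℓ v = ∑ i, ℓ (frameAt F V b i x) * coframeAt F V b i x v := by
    conv_lhs => rw [← sum_coframeAt_smul_frameAt F V hx v, map_sum]
    exact Finset.sum_congr rfl fun i _ => by rw [map_smul, smul_eq_mul, mul_comm]
  unfold frameTrace
  rw [h1, Finset.mul_sum, ← Finset.sum_sub_distrib]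
  refine Finset.sum_congr rfl fun i _ => ?_
  rw [h (smoothNear_frameAt F V hx i), map_sub, map_smul, map_smul, smul_eq_mul, smul_eq_mul]

end TraceRules

namespace LieAlgebroid

/-! ### The divergence -/

section Divergence

variable {E : Type*} [NormedAddCommGroup E] [NormedSpace ℝ E] [FiniteDimensional ℝ E]
  {M : Type*} [TopologicalSpace M] [ChartedSpace E M] [IsManifold 𝓘(ℝ, E) ∞ M]
  {F : Type*} [NormedAddCommGroup F] [NormedSpace ℝ F] [FiniteDimensional ℝ F]
  {A : M → Type*} [TopologicalSpace (TotalSpace F A)] [∀ x, AddCommGroup (A x)]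
  [∀ x, Module ℝ (A x)] [∀ x, TopologicalSpace (A x)] [FiberBundle F A] [VectorBundle ℝ F A]
  (𝔸 : LieAlgebroid E F A)

/-- The trace of `[α, ·]` minus the trace of `[ρ(α), ·]`, in the frames of `A` and `TM` around `b`:
the local connection form of the transverse representations. -/
noncomputable def divergence (α : Cₛ^∞⟮𝓘(ℝ, E); F, A⟯) (b x : M) : ℝ :=
  frameTrace F (𝔸.localBracket α) b x -
    frameTrace E (VectorField.mlieBracket 𝓘(ℝ, E) (𝔸.rho α)) b x

/-- The common domain of the frames of `A` and `TM` around `b`. -/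
abbrev frameDomain (_ : LieAlgebroid E F A) (b : M) : Set M :=
  (trivializationAt F A b).baseSet ∩
    (trivializationAt E (fun x : M => TangentSpace 𝓘(ℝ, E) x) b).baseSet

variable [T2Space M] [ContMDiffVectorBundle ∞ F A 𝓘(ℝ, E)]
  (α β : Cₛ^∞⟮𝓘(ℝ, E); F, A⟯) {b x : M}

lemma smoothFnNear_divergence (hx : x ∈ 𝔸.frameDomain b) :
    SmoothFnNear E (𝔸.divergence α b) x :=
  (smoothFnNear_frameTrace (𝔸.preservesSmooth_localBracket α) hx.1).sub
    (smoothFnNear_frameTrace (preservesSmooth_mlieBracket (𝔸.smoothNear_rho α)) hx.2)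

lemma divergence_add (hx : x ∈ 𝔸.frameDomain b) :
    𝔸.divergence (α + β) b x = 𝔸.divergence α b x + 𝔸.divergence β b x := by
  unfold divergence
  rw [frameTrace_add (𝔸.localBracket_add_left α β) hx.1,
    frameTrace_add (E := E) (fun {σ} hσ => (congrArg (fun X => VectorField.mlieBracket 𝓘(ℝ, E) X σ x)
      (𝔸.rho_add α β)).trans (VectorField.mlieBracket_add_left
      (𝔸.smoothNear_rho α x).mdifferentiableAt (𝔸.smoothNear_rho β x).mdifferentiableAt)) hx.2]
  ring

/-- Neither trace is linear over functions: `[f α, σ]` and `[f ρ(α), Y]` contain the corrections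
`-(ρ(σ) f) α` and `-(Y f) ρ(α)`. Both corrections have trace `-ρ(α)(f)`, so they cancel in the
difference. -/
lemma divergence_smulSection (f : C^∞⟮𝓘(ℝ, E), M; 𝓘(ℝ, ℝ), ℝ⟯) (hx : x ∈ 𝔸.frameDomain b) :
    𝔸.divergence (smulSection f α) b x = f x * 𝔸.divergence α b x := by
  have hf : SmoothFnNear E f x := .of_contMDiff f.contMDiff
  have h1 := frameTrace_smul_sub (f x)
    ((mvfderiv 𝓘(ℝ, E) f x).toLinearMap ∘ₗ (𝔸.anchor x).toLinearMap) (α x)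
    (fun {σ} hσ => 𝔸.localBracket_smul_left f α hσ) hx.1
  have h2 := frameTrace_smul_sub (E := E)
    (D := VectorField.mlieBracket 𝓘(ℝ, E) (𝔸.rho (smulSection f α)))
    (D₁ := VectorField.mlieBracket 𝓘(ℝ, E) (𝔸.rho α)) (f x)
    (mvfderiv 𝓘(ℝ, E) f x).toLinearMap (𝔸.rho α x)
    (fun {σ} hσ => by
      rw [𝔸.rho_smulSection]
      refine (VectorField.mlieBracket_smul_left hf.mdifferentiableAt
        (𝔸.smoothNear_rho α x).mdifferentiableAt).trans ?_
      rw [neg_smul, neg_add_eq_sub]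
      rfl) hx.2
  have h3 : ((mvfderiv 𝓘(ℝ, E) f x).toLinearMap ∘ₗ (𝔸.anchor x).toLinearMap) (α x) =
    (mvfderiv 𝓘(ℝ, E) f x).toLinearMap (𝔸.rho α x) := rfl
  unfold divergence
  rw [h1, h2, h3]
  ring

/-- The Jacobi identities on `A` and on `TM`, together with `ρ([α, β]) = [ρ(α), ρ(β)]`, make both
operators commutators, and `frameTrace_commutator` applies to each trace. -/
lemma divergence_bracket (hx : x ∈ 𝔸.frameDomain b) : 𝔸.divergence (𝔸.bracket α β) b x =
    dirDeriv (𝔸.rho α) (𝔸.divergence β b) x - dirDeriv (𝔸.rho β) (𝔸.divergence α b) x := by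
  have h1 := frameTrace_commutator (𝔸.isDerivation_localBracket α) (𝔸.isDerivation_localBracket β)
    (𝔸.preservesSmooth_localBracket α) (𝔸.preservesSmooth_localBracket β)
    (𝔸.localBracket_bracket α β) hx.1
  have h2 := frameTrace_commutator (X := 𝔸.rho α) (Y := 𝔸.rho β) isDerivation_mlieBracket
    isDerivation_mlieBracket (preservesSmooth_mlieBracket (𝔸.smoothNear_rho α))
    (preservesSmooth_mlieBracket (𝔸.smoothNear_rho β))
    (mlieBracket_mlieBracket (𝔸.smoothNear_rho α) (𝔸.smoothNear_rho β)) hx.2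
  have h3 : ∀ α β : Cₛ^∞⟮𝓘(ℝ, E); F, A⟯, dirDeriv (𝔸.rho α) (𝔸.divergence β b) x = _ := fun α β =>
    dirDeriv_sub (smoothFnNear_frameTrace (𝔸.preservesSmooth_localBracket β) hx.1)
      (smoothFnNear_frameTrace (preservesSmooth_mlieBracket (𝔸.smoothNear_rho β)) hx.2)
  rw [h3, h3]
  unfold divergence
  rw [h1, 𝔸.rho_bracket, h2]
  ring

variable {α}

/-- The characters enter the local form only through their weights. The trace on `A*` contributes
with two minus signs, hence as plus the trace on `A`. The result does not depend on `χ` and `χ'`. -/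
lemma hasLocalForm_transverseOp {χ χ' : SmoothCharacter} (h : χ.weight = 1) (h' : χ'.weight = 1) :
    HasLocalForm (𝔸.rho α) (𝔸.transverseOp χ χ' α) (𝔸.divergence α) := by
  have h1 := 𝔸.hasLocalForm_tensorOp
    (D := fun α => lieAssoc χ (𝔸.rho α) (𝔸.lieDual α))
    (D' := fun α => lieAssoc χ' (𝔸.rho α) (VectorField.mlieBracket 𝓘(ℝ, E) (𝔸.rho α)))
    (hasLocalForm_lieAssoc χ (𝔸.isDerivation_lieDual α))
    (hasLocalForm_lieAssoc χ' (isDerivation_mlieBracket (X := 𝔸.rho α)))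
  intro b x σ hx hσ
  have hx1 : x ∈ (trivializationAt (F →L[ℝ] ℝ) (DualBundle A) b).baseSet := hx.1
  rw [baseSet_dualBundle] at hx1
  refine (h1 hx hσ).trans ?_
  beta_reduce
  rw [h, h', 𝔸.frameTrace_lieDual α hx1, divergence]
  ring

end Divergence

/-! ### Representations from local forms -/

section Representations

variable {E : Type*} [NormedAddCommGroup E] [NormedSpace ℝ E] [FiniteDimensional ℝ E]
  {M : Type*} [TopologicalSpace M] [ChartedSpace E M] [IsManifold 𝓘(ℝ, E) ∞ M]
  {F : Type*} [NormedAddCommGroup F] [NormedSpace ℝ F]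
  {A : M → Type*} [TopologicalSpace (TotalSpace F A)] [∀ x, AddCommGroup (A x)]
  [∀ x, Module ℝ (A x)] [∀ x, TopologicalSpace (A x)] [FiberBundle F A] [VectorBundle ℝ F A]
  (𝔸 : LieAlgebroid E F A)
  {L : M → Type*} [∀ x, AddCommGroup (L x)] [∀ x, Module ℝ (L x)]
  [∀ x, TopologicalSpace (L x)] [TopologicalSpace (TotalSpace ℝ L)]
  [FiberBundle ℝ L] [VectorBundle ℝ ℝ L] [ContMDiffVectorBundle ∞ ℝ L 𝓘(ℝ, E)]

lemma dirDeriv_rho_bracket (α β : Cₛ^∞⟮𝓘(ℝ, E); F, A⟯) {f : M → ℝ} {x : M}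
    (hf : SmoothFnNear E f x) : dirDeriv (𝔸.rho (𝔸.bracket α β)) f x =
      dirDeriv (𝔸.rho α) (dirDeriv (𝔸.rho β) f) x - dirDeriv (𝔸.rho β) (dirDeriv (𝔸.rho α) f) x := by
  rw [𝔸.rho_bracket, dirDeriv_mlieBracket (𝔸.smoothNear_rho α) (𝔸.smoothNear_rho β) hf]

/-- An operation which is `X ↦ X + w(X)` in local frames, with flat `w`, is a representation. -/
lemma isRepresentation_of_hasLocalForm {nabla : 𝔸.Operation L}
    {w : Cₛ^∞⟮𝓘(ℝ, E); F, A⟯ → M → M → ℝ} (h : ∀ α, HasLocalForm (𝔸.rho α) (nabla α) (w α))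
    (hs : ∀ α {b x}, x ∈ (trivializationAt ℝ L b).baseSet → SmoothFnNear E (w α b) x)
    (hadd : ∀ α β {b x}, x ∈ (trivializationAt ℝ L b).baseSet →
      w (α + β) b x = w α b x + w β b x)
    (hsmul : ∀ (f : C^∞⟮𝓘(ℝ, E), M; 𝓘(ℝ, ℝ), ℝ⟯) α {b x}, x ∈ (trivializationAt ℝ L b).baseSet →
      w (smulSection f α) b x = f x * w α b x)
    (hflat : ∀ α β {b x}, x ∈ (trivializationAt ℝ L b).baseSet → w (𝔸.bracket α β) b x =
      dirDeriv (𝔸.rho α) (w β b) x - dirDeriv (𝔸.rho β) (w α b) x) :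
    𝔸.IsRepresentation nabla := by
  have hx : ∀ x, x ∈ (trivializationAt ℝ L x).baseSet :=
    FiberBundle.mem_baseSet_trivializationAt ℝ L
  -- The local form is needed on a neighbourhood, not only at `x`, since flatness differentiates
  -- `nabla α σ` once more.
  have hev : ∀ α {σ : ∀ x, L x} {x : M}, SmoothNear E ℝ σ x →
      (fun y => lineCoord L x y (nabla α σ y)) =ᶠ[𝓝 x] fun y =>
        dirDeriv (𝔸.rho α) (fun y => lineCoord L x y (σ y)) y + w α x y * lineCoord L x y (σ y) := by
    intro α σ x hσ
    have hσ' : ∀ᶠ y in 𝓝 x, SmoothNear E ℝ σ y := hσ.eventually_nhds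
    filter_upwards [hσ', (trivializationAt ℝ L x).open_baseSet.mem_nhds (hx x)] with y h1 h2
    exact h α h2 h1
  have hsm : ∀ α {σ : ∀ x, L x} {x : M}, SmoothNear E ℝ σ x → SmoothNear E ℝ (nabla α σ) x :=
    fun α σ x hσ => smoothNear_of_lineCoord (hx x) <| SmoothFnNear.congr
      ((smoothFnNear_dirDeriv (hσ.lineCoord (hx x)) (𝔸.smoothNear_rho α x)).add
        ((hs α (hx x)).mul (hσ.lineCoord (hx x)))) (hev α hσ)
  constructor
  · intro α σ U hU hσ
    exact smoothSectionOn_of_smoothNear fun x hxU => hsm α (.of_smoothSectionOn hU hσ hxU)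
  · intro α β σ U hU hσ x hxU
    have hσx := SmoothNear.of_smoothSectionOn hU hσ hxU
    apply lineCoord_injective (hx x)
    rw [map_add, h _ (hx x) hσx, h _ (hx x) hσx, h _ (hx x) hσx, hadd _ _ (hx x), 𝔸.rho_add]
    have : ∀ f : M → ℝ, dirDeriv (𝔸.rho α + 𝔸.rho β) f x =
      dirDeriv (𝔸.rho α) f x + dirDeriv (𝔸.rho β) f x := fun f => map_add (mvfderiv _ f x) _ _
    rw [this]
    ring
  · intro f α σ U hU hσ x hxU
    have hσx := SmoothNear.of_smoothSectionOn hU hσ hxU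
    apply lineCoord_injective (hx x)
    rw [map_smul, h _ (hx x) hσx, h _ (hx x) hσx, hsmul _ _ (hx x), 𝔸.rho_smulSection]
    have : ∀ g : M → ℝ, dirDeriv (fun x => f x • 𝔸.rho α x) g x = f x * dirDeriv (𝔸.rho α) g x :=
      fun g => map_smul (mvfderiv _ g x) _ _
    rw [this, smul_eq_mul]
    ring
  · intro α σ τ U hU hσ hτ x hxU
    have hσx := SmoothNear.of_smoothSectionOn hU hσ hxU
    have hτx := SmoothNear.of_smoothSectionOn hU hτ hxU
    apply lineCoord_injective (hx x)
    rw [map_add, h _ (hx x) hσx, h _ (hx x) hτx, h _ (hx x) (hσx.add hτx)]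
    simp only [Pi.add_apply, map_add]
    rw [dirDeriv_add (hσx.lineCoord (hx x)) (hτx.lineCoord (hx x))]
    ring
  · intro α σ f U hU hσ hf x hxU
    have hσx := SmoothNear.of_smoothSectionOn hU hσ hxU
    have hfx := SmoothFnNear.of_contMDiffOn hU hf hxU
    apply lineCoord_injective (hx x)
    rw [map_add, map_smul, map_smul, h _ (hx x) hσx, h _ (hx x) (hσx.smul hfx)]
    simp only [map_smul, smul_eq_mul]
    rw [dirDeriv_mul hfx (hσx.lineCoord (hx x))]
    ring
  · intro α β σ U hU hσ x hxU
    have hσx := SmoothNear.of_smoothSectionOn hU hσ hxU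
    have hc := hσx.lineCoord (hx x)
    have hd := fun α => smoothFnNear_dirDeriv hc (𝔸.smoothNear_rho α x)
    -- In the commutator the product of the two local functions and the mixed first-order terms
    -- cancel by symmetry. What is left is the commutator of vector fields and the right side of
    -- `hflat`.
    have key : ∀ α β, lineCoord L x x (nabla α (nabla β σ) x) = _ := fun α β => by
      rw [h _ (hx x) (hsm β hσx), dirDeriv_congr (hev β hσx),
        dirDeriv_add (hd β) ((hs β (hx x)).mul hc), dirDeriv_mul (hs β (hx x)) hc, h _ (hx x) hσx]
    apply lineCoord_injective (hx x)
    rw [map_sub, key, key, h _ (hx x) hσx, 𝔸.dirDeriv_rho_bracket α β hc, hflat _ _ (hx x)]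
    ring

end Representations

end LieAlgebroid

/-! ### One-forms from linear functionals on sections -/

section Forms

variable {E : Type*} [NormedAddCommGroup E] [NormedSpace ℝ E]
  {M : Type*} [TopologicalSpace M] [ChartedSpace E M]
  {F : Type*} [NormedAddCommGroup F] [NormedSpace ℝ F] [FiniteDimensional ℝ F]
  {A : M → Type*} [TopologicalSpace (TotalSpace F A)] [∀ x, AddCommGroup (A x)]
  [∀ x, Module ℝ (A x)] [∀ x, TopologicalSpace (A x)] [FiberBundle F A] [VectorBundle ℝ F A]

variable (F A) in
/-- `coframeAt` as a section of the dual bundle. -/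
noncomputable def dualFrameAt (b : M) (i : Fin (finrank ℝ F)) (y : M) : DualBundle A y :=
  ((finBasis ℝ F).coord i).toContinuousLinearMap.comp
    ((trivializationAt F A b).continuousLinearMapAt ℝ y)

lemma dualFrameAt_apply (b : M) (i : Fin (finrank ℝ F)) (y : M) (v : A y) :
    (dualFrameAt F A b i y v : ℝ) = coframeAt F A b i y v := rfl

variable [ContMDiffVectorBundle ∞ F A 𝓘(ℝ, E)]

/-- In the trivialization of the dual bundle this section is constant, equal to a coordinate
functional of `finBasis ℝ F`. -/
lemma smoothNear_dualFrameAt {b x : M} (hx : x ∈ (trivializationAt F A b).baseSet)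
    (i : Fin (finrank ℝ F)) : SmoothNear E (F →L[ℝ] ℝ) (dualFrameAt F A b i) x := by
  have hb := (trivializationAt F A b).open_baseSet
  filter_upwards [hb.mem_nhds hx] with y hy
  have hy' := hy
  rw [← baseSet_dualBundle] at hy'
  refine ((trivializationAt (F →L[ℝ] ℝ) (DualBundle A) b).contMDiffAt_section_iff hy').2
    (contMDiffAt_const (c := ((finBasis ℝ F).coord i).toContinuousLinearMap)
      |>.congr_of_eventuallyEq ?_)
  filter_upwards [hb.mem_nhds hy] with z hz
  have hz' := hz
  rw [← baseSet_dualBundle] at hz'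
  refine ContinuousLinearMap.ext fun u => ?_
  have h := linearMapAt_dualBundle F A hz (dualFrameAt F A b i z) u
  rw [Trivialization.coe_linearMapAt_of_mem (R := ℝ) _ hz'] at h
  refine h.trans ?_
  rw [dualFrameAt_apply, coframeAt, LinearMap.comp_apply,
    ← Trivialization.symmₗ_apply (R := ℝ) _ hz, Trivialization.linearMapAt_symmₗ _ hz]
  rfl

variable [IsManifold 𝓘(ℝ, E) ∞ M]

variable [FiniteDimensional ℝ E] [T2Space M]

lemma exists_section_eq {x : M} (v : A x) : ∃ α : Cₛ^∞⟮𝓘(ℝ, E); F, A⟯, α x = v := by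
  have hx : x ∈ (trivializationAt F A x).baseSet :=
    FiberBundle.mem_baseSet_trivializationAt F A x
  have h : SmoothNear E F
      (fun y => ∑ i, coframeAt F A x i x v • frameAt F A x i y) x :=
    .sum _ fun i _ => .smul (.const _) (smoothNear_frameAt F A hx i)
  obtain ⟨α, hα⟩ := h.exists_section
  exact ⟨α, hα.self_of_nhds.trans (sum_coframeAt_smul_frameAt F A hx v)⟩

/-- A `C^∞`-linear functional on sections is given by a one-form. -/
lemma exists_oneForm (Φ : Cₛ^∞⟮𝓘(ℝ, E); F, A⟯ → M → ℝ)
    (hs : ∀ α x, SmoothFnNear E (Φ α) x) (hadd : ∀ α β x, Φ (α + β) x = Φ α x + Φ β x)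
    (hsmul : ∀ (f : C^∞⟮𝓘(ℝ, E), M; 𝓘(ℝ, ℝ), ℝ⟯) α x, Φ (smulSection f α) x = f x * Φ α x) :
    ∃ c : Cₛ^∞⟮𝓘(ℝ, E); F →L[ℝ] ℝ, DualBundle A⟯, ∀ α x, (c x (α x) : ℝ) = Φ α x := by
  have hb : ∀ x, x ∈ (trivializationAt F A x).baseSet :=
    FiberBundle.mem_baseSet_trivializationAt F A
  -- Linearity over functions forces locality: multiply by a bump function supported where the
  -- sections agree.
  have hloc : ∀ {α β : Cₛ^∞⟮𝓘(ℝ, E); F, A⟯} {x : M}, (∀ᶠ y in 𝓝 x, α y = β y) →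
      Φ α x = Φ β x := fun {α β x} h => by
    obtain ⟨f, hf, hf1⟩ := exists_smooth_bump (E := E) h
    have heq : smulSection f α = smulSection f β := by
      ext y
      change f y • α y = f y • β y
      by_cases hy : y ∈ tsupport f
      · rw [show α y = β y from hf hy]
      · rw [image_eq_zero_of_notMem_tsupport hy, zero_smul, zero_smul]
    have h1 := hsmul f α x
    rwa [heq, hsmul, hf1.self_of_nhds, one_mul, one_mul, eq_comm] at h1
  have hex : ∀ b : M, ∀ i, ∃ s : Cₛ^∞⟮𝓘(ℝ, E); F, A⟯, ∀ᶠ y in 𝓝 b, s y = frameAt F A b i y :=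
    fun b i => (smoothNear_frameAt F A (hb b) i).exists_section
  choose S hS using hex
  -- The sections `S b i` are global extensions of the frame around `b`. Expanding `α` in them shows
  -- that `Φ α y` depends only on the value `α y`.
  have hexp : ∀ {b y : M}, y ∈ (trivializationAt F A b).baseSet →
      (∀ i, ∀ᶠ z in 𝓝 y, S b i z = frameAt F A b i z) → ∀ α,
      Φ α y = ∑ i, Φ (S b i) y * coframeAt F A b i y (α y) := fun {b y} hy hSy α => by
    have hg : ∀ i, ∃ g : C^∞⟮𝓘(ℝ, E), M; 𝓘(ℝ, ℝ), ℝ⟯,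
        ∀ᶠ z in 𝓝 y, g z = coframeAt F A b i z (α z) := fun i =>
      ((SmoothNear.of_section α).coframeAt hy i).exists_contMDiff
    choose g hg using hg
    have h1 : ∀ᶠ z in 𝓝 y, α z = (∑ i, smulSection (g i) (S b i)) z := by
      filter_upwards [eventually_all.2 hg, eventually_all.2 hSy,
        (trivializationAt F A b).open_baseSet.mem_nhds hy] with z h2 h3 hz
      have h4 : (∑ i, smulSection (g i) (S b i) : Cₛ^∞⟮𝓘(ℝ, E); F, A⟯) z =
          ∑ i, smulSection (g i) (S b i) z :=
        (congrFun (map_sum (ContMDiffSection.coeAddHom 𝓘(ℝ, E) F ∞ A) _ _) z).trans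
          (Finset.sum_apply _ _ _)
      rw [h4]
      conv_lhs => rw [← sum_coframeAt_smul_frameAt F A hz (α z)]
      exact Finset.sum_congr rfl fun i _ => by rw [← h2, ← h3]; rfl
    rw [hloc h1]
    refine (map_sum (AddMonoidHom.mk' (fun β => Φ β y) fun α β => hadd α β y) _ _).trans
      (Finset.sum_congr rfl fun i _ => ?_)
    refine (hsmul (g i) (S b i) y).trans ?_
    rw [(hg i).self_of_nhds, mul_comm]
  let c : ∀ x, DualBundle A x := fun x => ∑ i, Φ (S x i) x • dualFrameAt F A x i x
  have hc : ∀ (α : Cₛ^∞⟮𝓘(ℝ, E); F, A⟯) x, (c x (α x) : ℝ) = Φ α x := fun α x => by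
    rw [hexp (hb x) (hS x)]
    refine (_root_.sum_apply _ _ (α x)).trans ?_
    rfl
  have hcs : ∀ x, SmoothNear E (F →L[ℝ] ℝ) c x := fun x => by
    -- The form `c` uses a different frame at each point. By `hexp` it agrees near `x` with the
    -- expression in the single frame around `x`, which is visibly smooth.
    refine SmoothNear.congr (SmoothNear.sum Finset.univ fun i _ =>
      SmoothNear.smul (hs (S x i) x) (smoothNear_dualFrameAt (hb x) i)) ?_
    filter_upwards [(trivializationAt F A x).open_baseSet.mem_nhds (hb x),
      eventually_all.2 fun i => (hS x i).eventually_nhds] with y hy hSy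
    refine ContinuousLinearMap.ext fun v => ?_
    obtain ⟨α, rfl⟩ := exists_section_eq (E := E) (F := F) v
    refine (hc α y).trans ((hexp hy hSy α).trans ?_)
    symm
    refine (_root_.sum_apply _ _ (α y)).trans ?_
    rfl
  exact ⟨⟨c, fun x => (hcs x).contMDiffAt⟩, hc⟩

end Forms

namespace LieAlgebroid

/-! ### Classes of trivializable representations -/

section LineSections

variable {E : Type*} [NormedAddCommGroup E] [NormedSpace ℝ E]
  {M : Type*} [TopologicalSpace M] [ChartedSpace E M]
  {L : M → Type*} [∀ x, AddCommGroup (L x)] [∀ x, Module ℝ (L x)]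
  [∀ x, TopologicalSpace (L x)] [TopologicalSpace (TotalSpace ℝ L)]
  [FiberBundle ℝ L] [VectorBundle ℝ ℝ L]

lemma exists_eq_smul {σ : Cₛ^∞⟮𝓘(ℝ, E); ℝ, L⟯} (hσ : ∀ x, σ x ≠ 0) (τ : ∀ x, L x) :
    ∃ f : M → ℝ, ∀ y, τ y = f y • σ y := by
  refine ⟨fun y => lineCoord L y y (τ y) / lineCoord L y y (σ y), fun y => ?_⟩
  have hy := FiberBundle.mem_baseSet_trivializationAt ℝ L y
  have := lineCoord_ne_zero hy (hσ y)
  apply lineCoord_injective hy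
  rw [map_smul, smul_eq_mul]
  field_simp

variable [ContMDiffVectorBundle ∞ ℝ L 𝓘(ℝ, E)]

lemma smoothFnNear_of_eq_smul {σ : Cₛ^∞⟮𝓘(ℝ, E); ℝ, L⟯} (hσ : ∀ x, σ x ≠ 0) {τ : ∀ x, L x}
    {x : M} (hτ : SmoothNear E ℝ τ x) {f : M → ℝ} (h : ∀ y, τ y = f y • σ y) :
    SmoothFnNear E f x := by
  have hx := FiberBundle.mem_baseSet_trivializationAt ℝ L x
  have hσx : SmoothNear E ℝ σ x := .of_section σ
  refine SmoothFnNear.congr ((hτ.lineCoord hx).mul ((hσx.lineCoord hx).inv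
    (lineCoord_ne_zero hx (hσ x)))) ?_
  filter_upwards [(trivializationAt ℝ L x).open_baseSet.mem_nhds hx] with y hy
  have := lineCoord_ne_zero hy (hσ y)
  rw [h y, map_smul, smul_eq_mul]
  field_simp

end LineSections

section Classes

variable {E : Type*} [NormedAddCommGroup E] [NormedSpace ℝ E]
  {M : Type*} [TopologicalSpace M] [ChartedSpace E M] [IsManifold 𝓘(ℝ, E) ∞ M]
  {F : Type*} [NormedAddCommGroup F] [NormedSpace ℝ F]
  {A : M → Type*} [TopologicalSpace (TotalSpace F A)] [∀ x, AddCommGroup (A x)]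
  [∀ x, Module ℝ (A x)] [∀ x, TopologicalSpace (A x)] [FiberBundle F A] [VectorBundle ℝ F A]
  {𝔸 : LieAlgebroid E F A}
  {L : M → Type*} [∀ x, AddCommGroup (L x)] [∀ x, Module ℝ (L x)]
  [∀ x, TopologicalSpace (L x)] [TopologicalSpace (TotalSpace ℝ L)]
  [FiberBundle ℝ L] [VectorBundle ℝ ℝ L] [ContMDiffVectorBundle ∞ ℝ L 𝓘(ℝ, E)]
  {nabla : 𝔸.Operation L}

variable {L' : M → Type*} [∀ x, AddCommGroup (L' x)] [∀ x, Module ℝ (L' x)]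
  [∀ x, TopologicalSpace (L' x)] [TopologicalSpace (TotalSpace ℝ L')]
  [FiberBundle ℝ L'] [VectorBundle ℝ ℝ L'] [ContMDiffVectorBundle ∞ ℝ L' 𝓘(ℝ, E)]
  {nabla' : 𝔸.Operation L'}

/-- Line bundles with the same transition functions and operations with the same local forms have
the same class. -/
lemma IsTrivializedClass.eq_of_transition {w : Cₛ^∞⟮𝓘(ℝ, E); F, A⟯ → M → M → ℝ}
    (hw : ∀ α, HasLocalForm (𝔸.rho α) (nabla α) (w α))
    (hw' : ∀ α, HasLocalForm (𝔸.rho α) (nabla' α) (w α))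
    (htr : ∀ {b b' x}, x ∈ (trivializationAt ℝ L b).baseSet →
      x ∈ (trivializationAt ℝ L b').baseSet →
      lineCoord L b' x (lineFrame L b x) = lineCoord L' b' x (lineFrame L' b x))
    {θ θ' : 𝔸.H1} (h : 𝔸.IsTrivializedClass nabla θ) (h' : 𝔸.IsTrivializedClass nabla' θ') :
    θ = θ' := by
  obtain ⟨⟨σ, hσ⟩, hθ⟩ := h
  obtain ⟨⟨c, hc⟩, hcθ⟩ := hθ σ hσ
  have hx : ∀ x, x ∈ (trivializationAt ℝ L x).baseSet :=
    FiberBundle.mem_baseSet_trivializationAt ℝ L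
  have hx' : ∀ x, x ∈ (trivializationAt ℝ L' x).baseSet :=
    FiberBundle.mem_baseSet_trivializationAt ℝ L'
  -- `τ` is `σ` carried over to `L'`. Equality of the transition functions says that it has the same
  -- coordinates as `σ` in every frame (`hτ`), so the same `c` serves as its connection form
  -- (`hc'`).
  let τ : ∀ x, L' x := fun x => lineCoord L x x (σ x) • lineFrame L' x x
  have hτ : ∀ {b y}, y ∈ (trivializationAt ℝ L b).baseSet →
      lineCoord L' b y (τ y) = lineCoord L b y (σ y) := fun {b y} hy => by
    rw [lineCoord_eq_mul (b' := b) (hx y) (σ y), htr (hx y) hy, map_smul, smul_eq_mul, mul_comm]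
  have hτs : ∀ x, SmoothNear E ℝ τ x := fun x => by
    have hσx : SmoothNear E ℝ σ x := .of_section σ
    refine smoothNear_of_lineCoord (hx' x) ((hσx.lineCoord (hx x)).congr ?_)
    filter_upwards [(trivializationAt ℝ L x).open_baseSet.mem_nhds (hx x)] with y hy using hτ hy
  have hτ0 : ∀ x, τ x ≠ 0 := fun x h0 => lineCoord_ne_zero (hx x) (hσ x) <| by
    rw [← hτ (hx x), h0, map_zero]
  have hc' : 𝔸.IsConnectionForm nabla' ⟨τ, fun x => (hτs x).contMDiffAt⟩ c := fun α x => by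
    apply lineCoord_injective (hx' x)
    have h1 := hw α (hx x) (SmoothNear.of_section σ)
    rw [hc α x, map_smul] at h1
    refine (hw' α (hx' x) (hτs x)).trans ?_
    refine Eq.trans ?_ (map_smul _ _ _).symm
    change _ = ((c : 𝔸.Form1) x (α x) : ℝ) * lineCoord L' x x (τ x)
    rw [hτ (hx x)]
    refine Eq.trans ?_ h1.symm
    congr 1
    apply dirDeriv_congr
    filter_upwards [(trivializationAt ℝ L x).open_baseSet.mem_nhds (hx x)] with y hy using hτ hy
  rw [← hcθ _ hc, ← (h'.2 _ hτ0).2 _ hc']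

variable [FiniteDimensional ℝ E] [T2Space M] [FiniteDimensional ℝ F]
  [ContMDiffVectorBundle ∞ F A 𝓘(ℝ, E)]

/-- The connection form of a nowhere vanishing section exists and is closed. -/
lemma IsRepresentation.exists_isConnectionForm (h : 𝔸.IsRepresentation nabla)
    {σ : Cₛ^∞⟮𝓘(ℝ, E); ℝ, L⟯} (hσ : ∀ x, σ x ≠ 0) :
    ∃ c : 𝔸.closedForms, 𝔸.IsConnectionForm nabla σ c := by
  have hσs : SmoothSectionOn E ℝ σ univ := σ.contMDiff.contMDiffOn
  choose Φ hΦ using fun α => exists_eq_smul hσ (nabla α σ)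
  have hs : ∀ α x, SmoothFnNear E (Φ α) x := fun α x => smoothFnNear_of_eq_smul hσ
    (.of_smoothSectionOn isOpen_univ (h.smooth α σ univ isOpen_univ hσs) (mem_univ x)) (hΦ α)
  have hinj : ∀ x, Function.Injective fun t : ℝ => t • σ x := fun x => smul_left_injective ℝ (hσ x)
  obtain ⟨c, hc⟩ := exists_oneForm Φ hs
    (fun α β x => hinj x <| by
      beta_reduce
      rw [← hΦ, h.add_left α β σ univ isOpen_univ hσs x (mem_univ x), hΦ, hΦ, add_smul])
    (fun f α x => hinj x <| by
      beta_reduce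
      rw [← hΦ, h.smul_left f α σ univ isOpen_univ hσs x (mem_univ x), hΦ, mul_smul])
  -- The product `Φ β x * Φ α x` is symmetric, so in the commutator only derivative terms remain and
  -- flatness becomes closedness of the form.
  have hD : ∀ α β x, nabla α (nabla β σ) x =
      (Φ β x * Φ α x + dirDeriv (𝔸.rho α) (Φ β) x) • σ x := fun α β x => by
    rw [show nabla β σ = fun y => Φ β y • σ y from funext (hΦ β),
      h.leibniz α σ (Φ β) univ isOpen_univ hσs
        (fun y _ => (hs β y).contMDiffAt.contMDiffWithinAt) x (mem_univ x), hΦ, smul_smul, add_smul]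
  refine ⟨⟨c, fun α β x => ?_⟩, fun α x => ?_⟩
  · simp only [hc]
    have h1 := h.flat α β σ univ isOpen_univ hσs x (mem_univ x)
    rw [hΦ, hD, hD, ← sub_smul] at h1
    have h2 := hinj x h1
    rw [h2]
    ring
  · change nabla α σ x = (c x (α x) : ℝ) • σ x
    rw [hc, hΦ]

/-- Connection forms of two nowhere vanishing sections are cohomologous. -/
lemma IsRepresentation.sub_mem_exactForms (h : 𝔸.IsRepresentation nabla)
    {σ τ : Cₛ^∞⟮𝓘(ℝ, E); ℝ, L⟯} (hσ : ∀ x, σ x ≠ 0) (hτ : ∀ x, τ x ≠ 0) {c d : 𝔸.Form1}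
    (hc : 𝔸.IsConnectionForm nabla σ c) (hd : 𝔸.IsConnectionForm nabla τ d) :
    d - c ∈ 𝔸.exactForms := by
  obtain ⟨f, hf⟩ := exists_eq_smul hσ τ
  have hfs : ∀ x, SmoothFnNear E f x := fun x => smoothFnNear_of_eq_smul hσ (.of_section τ) hf
  have hf0 : ∀ x, f x ≠ 0 := fun x h0 => hτ x (by rw [hf, h0, zero_smul])
  -- With `τ = f σ`, a primitive of `d - c` is `log|f|`. Since `Real.log` ignores signs, `f` only
  -- has to be nonvanishing.
  have hlog : ∀ x, SmoothFnNear E (fun y => Real.log (f y)) x := fun x =>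
    (hfs x).comp_of_contDiffOn isOpen_compl_singleton
      (fun t ht => (Real.contDiffAt_log.2 ht).contDiffWithinAt) (hf0 x)
  refine ⟨⟨_, fun x => (hlog x).contMDiffAt⟩, fun x v => ?_⟩
  obtain ⟨α, rfl⟩ := exists_section_eq (E := E) (F := F) v
  have h1 : dirDeriv (𝔸.rho α) (fun y => Real.log (f y)) x =
    (f x)⁻¹ * dirDeriv (𝔸.rho α) f x := dirDeriv_comp (hfs x) (Real.hasDerivAt_log (hf0 x))
  refine Eq.trans ?_ h1.symm
  have h2 := h.leibniz α σ f univ isOpen_univ σ.contMDiff.contMDiffOn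
    (fun y _ => (hfs y).contMDiffAt.contMDiffWithinAt) x (mem_univ x)
  rw [← show (τ : ∀ x, L x) = fun y => f y • σ y from funext hf, hd α x, hc α x, hf x, smul_smul,
    smul_smul, ← add_smul] at h2
  have h3 := smul_left_injective ℝ (hσ x) h2
  change (d x (α x) : ℝ) - c x (α x) = _
  have := hf0 x
  field_simp
  linear_combination h3

lemma IsRepresentation.exists_isTrivializedClass (h : 𝔸.IsRepresentation nabla)
    (hσ : ∃ σ : Cₛ^∞⟮𝓘(ℝ, E); ℝ, L⟯, ∀ x, σ x ≠ 0) : ∃ θ, 𝔸.IsTrivializedClass nabla θ := by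
  obtain ⟨σ, hσ⟩ := hσ
  obtain ⟨c, hc⟩ := h.exists_isConnectionForm hσ
  refine ⟨Submodule.Quotient.mk c, ⟨σ, hσ⟩, fun τ hτ => ⟨h.exists_isConnectionForm hτ, ?_⟩⟩
  intro d hd
  exact (Submodule.Quotient.eq _).2 (h.sub_mem_exactForms hσ hτ hc hd)

end Classes

/-! ### Squares of line bundles -/

section Squares

variable {E : Type*} [NormedAddCommGroup E] [NormedSpace ℝ E] [FiniteDimensional ℝ E]
  {M : Type*} [TopologicalSpace M] [ChartedSpace E M] [IsManifold 𝓘(ℝ, E) ∞ M] [T2Space M]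
  [SigmaCompactSpace M]
  (L : M → Type*) [∀ x, AddCommGroup (L x)] [∀ x, Module ℝ (L x)]
  [∀ x, TopologicalSpace (L x)] [TopologicalSpace (TotalSpace ℝ L)]
  [FiberBundle ℝ L] [VectorBundle ℝ ℝ L] [ContMDiffVectorBundle ∞ ℝ L 𝓘(ℝ, E)]

/-- The square of a line bundle is trivializable. -/
lemma exists_nowhere_vanishing_section_tensor_self :
    ∃ σ : Cₛ^∞⟮𝓘(ℝ, E); ℝ, TensorBundle L L⟯, ∀ x, σ x ≠ 0 := by
  have hx : ∀ x, x ∈ (trivializationAt ℝ (TensorBundle L L) x).baseSet :=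
    FiberBundle.mem_baseSet_trivializationAt ℝ (TensorBundle L L)
  -- Positivity of the coordinate in the frame centred at the point is a convex condition on each
  -- fibre. Local frames satisfy it because the transition functions of `L ⊗ L` are nonzero squares,
  -- and a partition of unity combines them into a global section.
  obtain ⟨σ, hσ⟩ := exists_contMDiffSection_forall_mem_convex_of_local 𝓘(ℝ, E) (n := ⊤)
    (F_fiber := ℝ) (TensorBundle L L) (fun x => {v | 0 < lineCoord (TensorBundle L L) x x v})
    (fun x => convex_halfSpace_gt (lineCoord (TensorBundle L L) x x).isLinear 0)
    (fun b => ⟨_, (trivializationAt ℝ (TensorBundle L L) b).open_baseSet.mem_nhds (hx b),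
      lineFrame (TensorBundle L L) b,
      fun y hy => (smoothNear_lineFrame (E := E) hy).contMDiffAt.contMDiffWithinAt,
      fun y hy => by
        change 0 < lineCoord (TensorBundle L L) y y (lineFrame (TensorBundle L L) b y)
        rw [lineCoord_lineFrame_tensorBundle L L hy (hx y)]
        exact mul_self_pos.2 (lineCoord_lineFrame_ne_zero hy.1 (hx y).1)⟩)
  refine ⟨σ, fun x h0 => ?_⟩
  have h1 : 0 < lineCoord (TensorBundle L L) x x (σ x) := hσ x
  rw [h0, map_zero] at h1
  exact lt_irrefl _ h1

end Squares

/-! ### The transverse representations -/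

section Transverse

variable {E : Type*} [NormedAddCommGroup E] [NormedSpace ℝ E] [FiniteDimensional ℝ E]
  {M : Type*} [TopologicalSpace M] [ChartedSpace E M] [IsManifold 𝓘(ℝ, E) ∞ M]
  {F : Type*} [NormedAddCommGroup F] [NormedSpace ℝ F] [FiniteDimensional ℝ F]
  {A : M → Type*} [TopologicalSpace (TotalSpace F A)] [∀ x, AddCommGroup (A x)]
  [∀ x, Module ℝ (A x)] [∀ x, TopologicalSpace (A x)] [FiberBundle F A] [VectorBundle ℝ F A]
  (𝔸 : LieAlgebroid E F A) {χ χ' χ₁ χ₁' : SmoothCharacter}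

lemma baseSet_transverseBundle (b : M) :
    (trivializationAt ℝ (𝔸.TransverseBundle χ χ') b).baseSet = 𝔸.frameDomain b :=
  congrArg (· ∩ _) (baseSet_dualBundle F A b)

lemma baseSet_transverseBundle_tensor_self (b : M) : (trivializationAt ℝ
    (TensorBundle (𝔸.TransverseBundle χ χ') (𝔸.TransverseBundle χ χ')) b).baseSet =
      𝔸.frameDomain b :=
  (inter_self _).trans (𝔸.baseSet_transverseBundle b)

/-- On the square each character occurs squared, and `hχ`, `hχ'` remove it: the sign separating `t`
from `|t|` is lost. -/
lemma lineCoord_lineFrame_transverseBundle_tensor_self {b b' x : M} (hx : x ∈ 𝔸.frameDomain b)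
    (hx' : x ∈ 𝔸.frameDomain b') (hχ : ∀ t, χ.toHom t * χ.toHom t = t * t)
    (hχ' : ∀ t, χ'.toHom t * χ'.toHom t = t * t) :
    lineCoord (TensorBundle (𝔸.TransverseBundle χ χ') (𝔸.TransverseBundle χ χ')) b' x
      (lineFrame (TensorBundle (𝔸.TransverseBundle χ χ') (𝔸.TransverseBundle χ χ')) b x) =
    (((trivializationAt (F →L[ℝ] ℝ) (DualBundle A) b').coordChangeL ℝ
      (trivializationAt (F →L[ℝ] ℝ) (DualBundle A) b) x :
        (F →L[ℝ] ℝ) →L[ℝ] (F →L[ℝ] ℝ)).det *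
    ((trivializationAt E (fun x : M => TangentSpace 𝓘(ℝ, E) x) b').coordChangeL ℝ
      (trivializationAt E (fun x : M => TangentSpace 𝓘(ℝ, E) x) b) x : E →L[ℝ] E).det) ^ 2 := by
  have hd : ∀ {b}, x ∈ 𝔸.frameDomain b →
      x ∈ (trivializationAt (F →L[ℝ] ℝ) (DualBundle A) b).baseSet := fun hx => by
    rw [baseSet_dualBundle]
    exact hx.1
  have ht : ∀ {b}, x ∈ 𝔸.frameDomain b →
      x ∈ (trivializationAt ℝ (𝔸.TransverseBundle χ χ') b).baseSet := fun hx => by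
    rwa [baseSet_transverseBundle]
  have ht2 : ∀ {b}, x ∈ 𝔸.frameDomain b → x ∈ (trivializationAt ℝ
      (TensorBundle (𝔸.TransverseBundle χ χ') (𝔸.TransverseBundle χ χ')) b).baseSet := fun hx => by
    rwa [baseSet_transverseBundle_tensor_self]
  rw [lineCoord_lineFrame_tensorBundle _ _ (ht2 hx) (ht2 hx'),
    lineCoord_lineFrame_tensorBundle _ _ (ht hx) (ht hx'),
    lineCoord_lineFrame_assocBundle χ _ _ (hd hx) (hd hx'),
    lineCoord_lineFrame_assocBundle χ' _ _ hx.2 hx'.2, mul_mul_mul_comm, hχ, hχ']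
  ring

variable [T2Space M] [ContMDiffVectorBundle ∞ F A 𝓘(ℝ, E)]

lemma isRepresentation_transverseOp (h : χ.weight = 1) (h' : χ'.weight = 1) :
    𝔸.IsRepresentation (𝔸.transverseOp χ χ') := by
  refine 𝔸.isRepresentation_of_hasLocalForm (fun α => 𝔸.hasLocalForm_transverseOp h h') ?_ ?_ ?_ ?_
  all_goals simp only [baseSet_transverseBundle]
  · exact fun α _ _ hx => 𝔸.smoothFnNear_divergence α hx
  · exact fun α β _ _ hx => 𝔸.divergence_add α β hx
  · exact fun f α _ _ hx => 𝔸.divergence_smulSection α f hx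
  · exact fun α β _ _ hx => 𝔸.divergence_bracket α β hx

lemma isRepresentation_transverseOp_tensor_self (h : χ.weight = 1) (h' : χ'.weight = 1) :
    𝔸.IsRepresentation (𝔸.tensorOp (𝔸.transverseOp χ χ') (𝔸.transverseOp χ χ')) := by
  refine 𝔸.isRepresentation_of_hasLocalForm (fun α => 𝔸.hasLocalForm_tensorOp
    (𝔸.hasLocalForm_transverseOp h h') (𝔸.hasLocalForm_transverseOp h h')) ?_ ?_ ?_ ?_
  all_goals simp only [baseSet_transverseBundle_tensor_self]
  · exact fun α _ _ hx => (𝔸.smoothFnNear_divergence α hx).add (𝔸.smoothFnNear_divergence α hx)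
  · intro α β _ _ hx
    rw [𝔸.divergence_add α β hx]
    ring
  · intro f α _ _ hx
    rw [𝔸.divergence_smulSection α f hx]
    ring
  · intro α β b x hx
    have key : ∀ α β : Cₛ^∞⟮𝓘(ℝ, E); F, A⟯, dirDeriv (𝔸.rho α) (fun y => 𝔸.divergence β b y +
      𝔸.divergence β b y) x = _ := fun α β =>
      dirDeriv_add (𝔸.smoothFnNear_divergence β hx) (𝔸.smoothFnNear_divergence β hx)
    rw [key, key, 𝔸.divergence_bracket α β hx]
    ring

lemma exists_isTrivializedClass_transverseOp [SigmaCompactSpace M] (h : χ.weight = 1)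
    (h' : χ'.weight = 1) : ∃ θ, 𝔸.IsTrivializedClass
      (𝔸.tensorOp (𝔸.transverseOp χ χ') (𝔸.transverseOp χ χ')) θ :=
  (𝔸.isRepresentation_transverseOp_tensor_self h h').exists_isTrivializedClass
    (exists_nowhere_vanishing_section_tensor_self _)

variable {𝔸} in
-- The two squares have the same transition functions and the same local form, twice the divergence.
lemma isTrivializedClass_transverseOp_unique (h : χ.weight = 1) (h' : χ'.weight = 1)
    (h₁ : χ₁.weight = 1) (h₁' : χ₁'.weight = 1) (hχ : ∀ t, χ.toHom t * χ.toHom t = t * t)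
    (hχ' : ∀ t, χ'.toHom t * χ'.toHom t = t * t) (hχ₁ : ∀ t, χ₁.toHom t * χ₁.toHom t = t * t)
    (hχ₁' : ∀ t, χ₁'.toHom t * χ₁'.toHom t = t * t) {θ θ₁ : 𝔸.H1}
    (hθ : 𝔸.IsTrivializedClass (𝔸.tensorOp (𝔸.transverseOp χ χ') (𝔸.transverseOp χ χ')) θ)
    (hθ₁ : 𝔸.IsTrivializedClass
      (𝔸.tensorOp (𝔸.transverseOp χ₁ χ₁') (𝔸.transverseOp χ₁ χ₁')) θ₁) : θ = θ₁ := by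
  refine hθ.eq_of_transition (fun α => 𝔸.hasLocalForm_tensorOp
      (𝔸.hasLocalForm_transverseOp h h') (𝔸.hasLocalForm_transverseOp h h'))
    (fun α => 𝔸.hasLocalForm_tensorOp
      (𝔸.hasLocalForm_transverseOp h₁ h₁') (𝔸.hasLocalForm_transverseOp h₁ h₁'))
    (fun {b b' x} hx hx' => ?_) hθ₁
  rw [baseSet_transverseBundle_tensor_self] at hx hx'
  rw [𝔸.lineCoord_lineFrame_transverseBundle_tensor_self hx hx' hχ hχ',
    𝔸.lineCoord_lineFrame_transverseBundle_tensor_self hx hx' hχ₁ hχ₁']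

end Transverse

end LieAlgebroid

/-! ### The two characters and the theorem. -/

lemma volChar_mul_self (t : ℝ) : volChar.toHom t * volChar.toHom t = t * t := rfl

lemma densChar_mul_self (t : ℝ) : densChar.toHom t * densChar.toHom t = t * t := abs_mul_abs_self t

theorem mainTheorem5
    {E : Type*} [NormedAddCommGroup E] [NormedSpace ℝ E] [FiniteDimensional ℝ E]
    {M : Type*} [TopologicalSpace M] [ChartedSpace E M] [IsManifold 𝓘(ℝ, E) ∞ M]
    [T2Space M] [SecondCountableTopology M]
    {F : Type*} [NormedAddCommGroup F] [NormedSpace ℝ F] [FiniteDimensional ℝ F]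
    {A : M → Type*} [TopologicalSpace (TotalSpace F A)] [∀ x, AddCommGroup (A x)]
    [∀ x, Module ℝ (A x)] [∀ x, TopologicalSpace (A x)] [FiberBundle F A] [VectorBundle ℝ F A]
    [ContMDiffVectorBundle ∞ F A 𝓘(ℝ, E)]
    (𝔸 : LieAlgebroid E F A) :
    (𝔸.IsRepresentation 𝔸.canOp ∧ 𝔸.IsRepresentation 𝔸.densOp ∧ 𝔸.IsRepresentation 𝔸.volOp) ∧
    (𝔸.IsCharClass 𝔸.canOp 𝔸.modularClass ∧ 𝔸.IsCharClass 𝔸.densOp 𝔸.modularClass ∧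
      𝔸.IsCharClass 𝔸.volOp 𝔸.modularClass) ∧
    𝔸.charClass 𝔸.canOp = 𝔸.modularClass ∧ 𝔸.charClass 𝔸.densOp = 𝔸.modularClass ∧
      𝔸.charClass 𝔸.volOp = 𝔸.modularClass := by
  -- Together with second countability this yields the σ-compactness required by the partition of
  -- unity.
  have : LocallyCompactSpace M := ChartedSpace.locallyCompactSpace E M
  have hv := weight_volChar
  have hd := weight_densChar
  obtain ⟨θ, hθ⟩ := 𝔸.exists_isTrivializedClass_transverseOp hd hd
  obtain ⟨θ₁, hθ₁⟩ := 𝔸.exists_isTrivializedClass_transverseOp hv hd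
  obtain ⟨θ₂, hθ₂⟩ := 𝔸.exists_isTrivializedClass_transverseOp hv hv
  obtain rfl := LieAlgebroid.isTrivializedClass_transverseOp_unique hd hd hv hd densChar_mul_self
    densChar_mul_self volChar_mul_self densChar_mul_self hθ hθ₁
  obtain rfl := LieAlgebroid.isTrivializedClass_transverseOp_unique hd hd hv hv densChar_mul_self
    densChar_mul_self volChar_mul_self volChar_mul_self hθ hθ₂
  have hm : 𝔸.modularClass = (1 / 2 : ℝ) • θ :=
    LieAlgebroid.IsCharClass.charClass_eq 𝔸 ⟨θ, hθ, rfl⟩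
  have h₁ : 𝔸.IsCharClass 𝔸.canOp 𝔸.modularClass := ⟨θ, hθ₁, hm⟩
  have h₂ : 𝔸.IsCharClass 𝔸.densOp 𝔸.modularClass := ⟨θ, hθ, hm⟩
  have h₃ : 𝔸.IsCharClass 𝔸.volOp 𝔸.modularClass := ⟨θ, hθ₂, hm⟩
  exact ⟨⟨𝔸.isRepresentation_transverseOp hv hd, 𝔸.isRepresentation_transverseOp hd hd,
    𝔸.isRepresentation_transverseOp hv hv⟩, ⟨h₁, h₂, h₃⟩, h₁.charClass_eq, h₂.charClass_eq,
    h₃.charClass_eq⟩
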